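/- **Theorem (Injective Recollement Theorem).** Let $\mathcal{A}$ be a weakly idempotent complete (WIC) exact category, i.e. a Quillen exact category in which every split monomorphism has a cokernel, and suppose $\mathcal{A}$ has enough injectives. An *injective cotorsion pair* in $\mathcal{A}$ is a complete cotorsion pair $(\mathcal{W},\mathcal{F})$ with $\mathcal{W}$ thick and $\mathcal{W}\cap\mathcal{F}$ equal to the class of injective objects of $\mathcal{A}$. It corresponds to the exact model structure on $\mathcal{A}$ with Hovey triple $(\mathcal{A},\mathcal{W},\mathcal{F})$ (cofibrant, trivial, fibrant objects); $\gamma:\mathcal{A}\to\mathcal{A}/\mathcal{W}$ denotes the localization at its weak equivalences. For a class of objects $\mathcal{P}$, $\mathcal{P}/{\sim}$ denotes the full subcategory $\mathcal{P}$ modulo the relation $f\sim g$ iff $g-f$ factors through an injective object of $\mathcal{A}$. For injective cotorsion pairs $\mathcal{M}=(\mathcal{W},\mathcal{F})$, $\mathcal{M}'=(\mathcal{W}',\mathcal{F}')$ with $\mathcal{F}'\subseteq\mathcal{F}$, the right localization $\mathcal{M}/\mathcal{M}'$ is the model structure with Hovey triple $(\mathcal{W}',\mathcal{V},\mathcal{F})$,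 where $\mathcal{V}$ is the class of objects $X$ admitting an admissible short exact sequence $X\rightarrowtail R\twoheadrightarrow Q$ with $R\in\mathcal{F}'$ and $Q\in\mathcal{W}$. $\mathrm{E}(\mathcal{M})$ means taking special $\mathcal{F}$-preenvelopes $X\rightarrowtail F\twoheadrightarrow W$, and $\mathrm{C}(\mathcal{M})$ means taking special $\mathcal{W}$-precovers $F\rightarrowtail W\twoheadrightarrow X$ (with $W\in\mathcal{W}$, $F\in\mathcal{F}$). Let $\mathcal{M}_i=(\mathcal{W}_i,\mathcal{F}_i)$, $i=1,2,3$, be injective cotorsion pairs in $\mathcal{A}$ with $\mathcal{F}_2,\mathcal{F}_3\subseteq\mathcal{F}_1$. Then $\mathcal{W}_3\cap\mathcal{F}_1=\mathcal{F}_2$ if and only if $\mathcal{W}_2\cap\mathcal{W}_3=\mathcal{W}_1$ and $\mathcal{F}_2\subseteq\mathcal{W}_3$. Assume this holds. Then: 1. $\mathcal{M}_1/\mathcal{M}_2$ is Quillen equivalent to $\mathcal{M}_3$ and $\mathcal{M}_1/\mathcal{M}_3$ is Quillen equivalent to $\mathcal{M}_2$; in both cases the identity functor of $\mathcal{A}$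 is the left adjoint, from the right localization, of a Quillen equivalence. 2. $\mathcal{F}_1/{\sim}$, $\mathcal{F}_2/{\sim}$ and $\mathcal{A}/\mathcal{W}_3$ carry their canonical triangulated structures, the distinguished triangles being those isomorphic to the images of the admissible short exact sequences (in $\mathcal{F}_1$, in $\mathcal{F}_2$ and in $\mathcal{A}$, respectively) with natural connecting morphisms, and there is a recollement of triangulated categories $$\mathcal{F}_2/{\sim}\ \xrightarrow{\ I\ }\ \mathcal{F}_1/{\sim}\ \xrightarrow{\ Q\ }\ \mathcal{A}/\mathcal{W}_3 ,$$ where $I$ is the inclusion and $Q([f])=\gamma(f)$. The left and right adjoints of $I$ are $\mathrm{E}(\mathcal{M}_2)$ and $\mathrm{C}(\mathcal{M}_3)$; the left and right adjoints of $Q$ are $\lambda=\mathrm{C}(\mathcal{M}_2)\circ\mathrm{E}(\mathcal{M}_1)$ and $\rho=\mathrm{E}(\mathcal{M}_3)$. 3. $\lambda$ has essential image $(\mathcal{W}_2\cap\mathcal{F}_1)/{\sim}$, $\rho$ has essential image $\mathcal{F}_3/{\sim}$, and they provide mutually inverse equivalences $\lambda:\mathcal{F}_3/{\sim}\ \longleftrightarrow\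 (\mathcal{W}_2\cap\mathcal{F}_1)/{\sim}\ :\rho$. -/

import Mathlib

open CategoryTheory CategoryTheory.Limits
open scoped ZeroObject

universe v u

noncomputable section

/-! ### Exact categories -/

/-- A Quillen exact structure on an additive category: a class of kernel-cokernel pairs
(the admissible short exact sequences, here called conflations). -/
structure ExactStructure (A : Type u) [Category.{v} A] [Preadditive A] [HasZeroObject A]
    [HasBinaryBiproducts A] where
  /-- the class of admissible short exact sequences -/
  conflation : ShortComplex A → Prop
  of_iso : ∀ {S T : ShortComplex A}, (S ≅ T) → conflation S → conflation T
  kernel : ∀ {S : ShortComplex A}, conflation S → Nonempty (IsLimit (KernelFork.ofι S.f S.zero))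
  cokernel : ∀ {S : ShortComplex A}, conflation S →
    Nonempty (IsColimit (CokernelCofork.ofπ S.g S.zero))
  split : ∀ X Y : A,
    conflation (ShortComplex.mk (biprod.inl : X ⟶ X ⊞ Y) (biprod.snd : X ⊞ Y ⟶ Y) biprod.inl_snd)
  /-- admissible monomorphisms are closed under composition -/
  inflation_comp : ∀ {X Y Z : A} (i : X ⟶ Y) (j : Y ⟶ Z),
    (∃ (C : A) (p : Y ⟶ C) (w : i ≫ p = 0), conflation (ShortComplex.mk i p w)) →
    (∃ (C : A) (p : Z ⟶ C) (w : j ≫ p = 0), conflation (ShortComplex.mk j p w)) →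
    ∃ (C : A) (p : Z ⟶ C) (w : (i ≫ j) ≫ p = 0), conflation (ShortComplex.mk (i ≫ j) p w)
  /-- admissible epimorphisms are closed under composition -/
  deflation_comp : ∀ {X Y Z : A} (p : X ⟶ Y) (q : Y ⟶ Z),
    (∃ (K : A) (i : K ⟶ X) (w : i ≫ p = 0), conflation (ShortComplex.mk i p w)) →
    (∃ (K : A) (i : K ⟶ Y) (w : i ≫ q = 0), conflation (ShortComplex.mk i q w)) →
    ∃ (K : A) (i : K ⟶ X) (w : i ≫ p ≫ q = 0), conflation (ShortComplex.mk i (p ≫ q) w)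
  /-- pushouts of admissible monomorphisms exist and are admissible monomorphisms -/
  pushout : ∀ {S : ShortComplex A}, conflation S → ∀ {X : A} (f : S.X₁ ⟶ X),
    ∃ (P : A) (g : S.X₂ ⟶ P) (j : X ⟶ P), IsPushout S.f f g j ∧
      ∃ (C : A) (p : P ⟶ C) (w : j ≫ p = 0), conflation (ShortComplex.mk j p w)
  /-- pullbacks of admissible epimorphisms exist and are admissible epimorphisms -/
  pullback : ∀ {S : ShortComplex A}, conflation S → ∀ {X : A} (f : X ⟶ S.X₃),
    ∃ (P : A) (g : P ⟶ S.X₂) (q : P ⟶ X), IsPullback g q S.g f ∧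
      ∃ (K : A) (i : K ⟶ P) (w : i ≫ q = 0), conflation (ShortComplex.mk i q w)

/-- A category is weakly idempotent complete if every split monomorphism has a cokernel. -/
def WeaklyIdempotentComplete (A : Type u) [Category.{v} A] [Preadditive A] : Prop :=
  ∀ ⦃X Y : A⦄ (f : X ⟶ Y), IsSplitMono f → HasCokernel f

/-! ### Model structures and Quillen equivalences -/

/-- Three classes of morphisms, to be the cofibrations, fibrations and weak equivalences of a
model structure. -/
structure ModelData (A : Type u) [Category.{v} A] where
  cof : MorphismProperty A
  fib : MorphismProperty A
  weq : MorphismProperty A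

namespace ModelData

/-- The axioms of a (closed) model structure. No limits or colimits are required of the ambient
category. -/
structure IsModelStructure {A : Type u} [Category.{v} A] (M : ModelData A) : Prop where
  two_out_of_three : M.weq.HasTwoOutOfThreeProperty
  weq_retract : M.weq.IsStableUnderRetracts
  fib_retract : M.fib.IsStableUnderRetracts
  cof_retract : M.cof.IsStableUnderRetracts
  lift_trivial_cof : ∀ {X Y Z T : A} (i : X ⟶ Y) (p : Z ⟶ T),
    M.cof i → M.weq i → M.fib p → HasLiftingProperty i p
  lift_trivial_fib : ∀ {X Y Z T : A} (i : X ⟶ Y) (p : Z ⟶ T),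
    M.cof i → M.fib p → M.weq p → HasLiftingProperty i p
  factor_trivial_cof : (M.cof ⊓ M.weq).HasFactorization M.fib
  factor_trivial_fib : M.cof.HasFactorization (M.fib ⊓ M.weq)

variable {A : Type*} [Category* A] [Preadditive A] [HasZeroObject A]
  {B : Type*} [Category* B] [Preadditive B] [HasZeroObject B]

/-- `X` is cofibrant if the map from the initial object to `X` is a cofibration. -/
def IsCofibrant (M : ModelData A) (X : A) : Prop := M.cof (0 : (0 : A) ⟶ X)

/-- `X` is fibrant if the map from `X` to the terminal object is a fibration. -/
def IsFibrant (M : ModelData A) (X : A) : Prop := M.fib (0 : X ⟶ (0 : A))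

/-- An adjunction between model structures is a Quillen equivalence if it is a Quillen adjunction
such that, for `X` cofibrant and `Y` fibrant, a map `F X ⟶ Y` is a weak equivalence if and only
if its adjoint `X ⟶ G Y` is. -/
structure IsQuillenEquivalence (M : ModelData A) (N : ModelData B) {F : A ⥤ B} {G : B ⥤ A}
    (adj : F ⊣ G) : Prop where
  left_model : M.IsModelStructure
  right_model : N.IsModelStructure
  map_cof : ∀ {X Y : A} (f : X ⟶ Y), M.cof f → N.cof (F.map f)
  map_trivial_cof : ∀ {X Y : A} (f : X ⟶ Y), M.cof f → M.weq f → N.weq (F.map f)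
  weq_iff : ∀ (X : A) (Y : B), M.IsCofibrant X → N.IsFibrant Y → ∀ f : F.obj X ⟶ Y,
    N.weq f ↔ M.weq (adj.homEquiv X Y f)

end ModelData

/-! ### Cotorsion pairs -/

namespace ExactStructure

variable {A : Type u} [Category.{v} A] [Preadditive A] [HasZeroObject A] [HasBinaryBiproducts A]
  (E : ExactStructure A)

/-- Admissible monomorphisms with cokernel in `P`. -/
def monoWithCokernel (P : ObjectProperty A) : MorphismProperty A := fun _ Y i =>
  ∃ (C : A) (p : Y ⟶ C) (w : i ≫ p = 0), E.conflation (ShortComplex.mk i p w) ∧ P C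

/-- Admissible epimorphisms with kernel in `P`. -/
def epiWithKernel (P : ObjectProperty A) : MorphismProperty A := fun X _ p =>
  ∃ (K : A) (i : K ⟶ X) (w : i ≫ p = 0), E.conflation (ShortComplex.mk i p w) ∧ P K

/-- The injective objects of the exact category. -/
def injectives : ObjectProperty A := fun I =>
  ∀ ⦃X Y : A⦄ (i : X ⟶ Y), E.monoWithCokernel ⊤ i → ∀ f : X ⟶ I, ∃ g : Y ⟶ I, i ≫ g = f

/-- Every object has an admissible monomorphism into an injective object. -/
def EnoughInjectives : Prop :=
  ∀ X : A, ∃ (I : A) (i : X ⟶ I), E.injectives I ∧ E.monoWithCokernel ⊤ i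

/-- The vanishing of the Yoneda `Ext¹(X, Y)`: every admissible extension of `X` by `Y` splits. -/
def ExtVanishes (X Y : A) : Prop :=
  ∀ ⦃Z : A⦄ (i : Y ⟶ Z) (p : Z ⟶ X) (w : i ≫ p = 0),
    E.conflation (ShortComplex.mk i p w) → ∃ s : X ⟶ Z, s ≫ p = 𝟙 X

/-- A complete cotorsion pair. -/
structure IsCompleteCotorsionPair (C D : ObjectProperty A) : Prop where
  right_iff : ∀ Y, D Y ↔ ∀ X, C X → E.ExtVanishes X Y
  left_iff : ∀ X, C X ↔ ∀ Y, D Y → E.ExtVanishes X Y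
  /-- the pair has enough injectives -/
  preenvelope : ∀ X : A, ∃ (Y : A) (j : X ⟶ Y), D Y ∧ E.monoWithCokernel C j
  /-- the pair has enough projectives -/
  precover : ∀ X : A, ∃ (Y : A) (p : Y ⟶ X), C Y ∧ E.epiWithKernel D p

/-- A class of objects is thick if it is closed under retracts and if, whenever two of the three
terms of an admissible short exact sequence are in it, so is the third. -/
structure IsThick (W : ObjectProperty A) : Prop where
  retract : W.IsStableUnderRetracts
  left : ∀ {S : ShortComplex A}, E.conflation S → W S.X₂ → W S.X₃ → W S.X₁
  middle : ∀ {S : ShortComplex A}, E.conflation S → W S.X₁ → W S.X₃ → W S.X₂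
  right : ∀ {S : ShortComplex A}, E.conflation S → W S.X₁ → W S.X₂ → W S.X₃

/-- An injective cotorsion pair `(W, F)`. -/
structure InjectiveCotorsionPair where
  W : ObjectProperty A
  F : ObjectProperty A
  complete : E.IsCompleteCotorsionPair W F
  thick : E.IsThick W
  inter : W ⊓ F = E.injectives

/-! ### Hovey triples -/

/-- Classes of cofibrant, trivial and fibrant objects. -/
structure ObjectTriple (A : Type u) [Category.{v} A] where
  cofibrant : ObjectProperty A
  trivial : ObjectProperty A
  fibrant : ObjectProperty A

/-- The conditions on a triple `(Q, W, R)` to be a Hovey triple. -/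
structure IsHoveyTriple (T : ObjectTriple A) : Prop where
  thick : E.IsThick T.trivial
  pair_cof : E.IsCompleteCotorsionPair T.cofibrant (T.fibrant ⊓ T.trivial)
  pair_trivialCof : E.IsCompleteCotorsionPair (T.cofibrant ⊓ T.trivial) T.fibrant

/-- The exact model structure of a Hovey triple. -/
def model (T : ObjectTriple A) : ModelData A where
  cof := E.monoWithCokernel T.cofibrant
  fib := E.epiWithKernel T.fibrant
  weq := fun X Y f => ∃ (Z : A) (i : X ⟶ Z) (p : Z ⟶ Y),
    E.monoWithCokernel (T.cofibrant ⊓ T.trivial) i ∧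
      E.epiWithKernel (T.fibrant ⊓ T.trivial) p ∧ i ≫ p = f

namespace InjectiveCotorsionPair

variable {E}

/-- The Hovey triple of an injective cotorsion pair: every object is cofibrant. -/
def triple (M : E.InjectiveCotorsionPair) : ObjectTriple A where
  cofibrant := ⊤
  trivial := M.W
  fibrant := M.F

/-- Becker's right localization `M₁ / M₂ = (W₂, W, F₁)`, where `W` consists of the objects `X`
having an admissible short exact sequence `X ↣ R ↠ Q` with `R` in `F₂` and `Q` in `W₁`. -/
def rightLocalization (M₁ M₂ : E.InjectiveCotorsionPair) : ObjectTriple A where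
  cofibrant := M₂.W
  trivial := fun X => ∃ (R : A) (i : X ⟶ R), M₂.F R ∧ E.monoWithCokernel M₁.W i
  fibrant := M₁.F

/-- `j : X ⟶ Y` is a special `F`-preenvelope for the cotorsion pair `(W, F)`. -/
def IsSpecialPreenvelope (M : E.InjectiveCotorsionPair) {X Y : A} (j : X ⟶ Y) : Prop :=
  M.F Y ∧ E.monoWithCokernel M.W j

/-- `p : Y ⟶ X` is a special `W`-precover for the cotorsion pair `(W, F)`. -/
def IsSpecialPrecover (M : E.InjectiveCotorsionPair) {Y X : A} (p : Y ⟶ X) : Prop :=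
  M.W Y ∧ E.epiWithKernel M.F p

end InjectiveCotorsionPair

/-! ### Stable categories -/

/-- Two maps of the full subcategory on `P` are homotopic if their difference factors through an
injective object of the ambient exact category. -/
def homotopic (P : ObjectProperty A) : HomRel P.FullSubcategory := fun X Y f g =>
  ∃ (I : A) (a : X.obj ⟶ I) (b : I ⟶ Y.obj), E.injectives I ∧ g.hom - f.hom = a ≫ b

/-- The category `P/∼`. -/
abbrev Stable (P : ObjectProperty A) := CategoryTheory.Quotient (E.homotopic P)

/-- The functor from the full subcategory on `P` to `P/∼`. -/
abbrev toStable (P : ObjectProperty A) : P.FullSubcategory ⥤ E.Stable P :=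
  CategoryTheory.Quotient.functor (E.homotopic P)

/-- The inclusion functor `P/∼ ⥤ P'/∼` for `P ⊆ P'`. -/
def stableInclusion {P P' : ObjectProperty A} (h : P ≤ P') : E.Stable P ⥤ E.Stable P' :=
  CategoryTheory.Quotient.lift _ (ObjectProperty.ιOfLE h ⋙ E.toStable P') (fun _ _ _ _ hfg =>
    CategoryTheory.Quotient.sound _ hfg)

/-- The admissible short exact sequences with all three terms in `P`. -/
def conflationIn (P : ObjectProperty A) : ShortComplex P.FullSubcategory → Prop :=
  fun S => E.conflation (S.map P.ι)

namespace InjectiveCotorsionPair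

variable {E}

/-- The category `A/W`: the localization of `A` at the weak equivalences of the model structure
of the injective cotorsion pair `(W, F)`. -/
abbrev Ho (M : E.InjectiveCotorsionPair) := (E.model M.triple).weq.Localization

/-- The localization functor `A ⥤ A/W`. -/
abbrev γ (M : E.InjectiveCotorsionPair) : A ⥤ M.Ho := (E.model M.triple).weq.Q

/-- The projection `Y ⊞ I ⟶ Y` with `I` injective is a weak equivalence. -/
lemma weq_fst (M : E.InjectiveCotorsionPair) (Y : A) {I : A} (hI : E.injectives I) :
    (E.model M.triple).weq (biprod.fst : Y ⊞ I ⟶ Y) := by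
  have hI' : (M.W ⊓ M.F) I := by rw [M.inter]; exact hI
  have h0 : E.injectives (0 : A) := fun X Y i _ f => ⟨0, (isZero_zero A).eq_of_tgt _ _⟩
  have h0' : (M.W ⊓ M.F) (0 : A) := by rw [M.inter]; exact h0
  refine ⟨Y ⊞ I, 𝟙 _, biprod.fst, ?_, ?_, Category.id_comp _⟩
  · refine ⟨0, 0, by simp, ?_, trivial, h0'.1⟩
    refine E.of_iso ?_ (E.split (Y ⊞ I) 0)
    exact ShortComplex.isoMk
      (Iso.refl _) ⟨biprod.fst, biprod.inl, by ext <;> simp, by simp⟩ (Iso.refl _)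
      (by simp) (by simp)
  · refine ⟨I, biprod.inr, by simp, ?_, hI'.2, hI'.1⟩
    refine E.of_iso ?_ (E.split I Y)
    exact ShortComplex.isoMk (Iso.refl _) (biprod.braiding I Y) (Iso.refl _)
      (by ext <;> simp) (by simp)

/-- Homotopic maps become equal in `A/W`. -/
lemma γ_map_eq (M : E.InjectiveCotorsionPair) {X Y : A} {f g : X ⟶ Y} {I : A}
    (hI : E.injectives I) (a : X ⟶ I) (b : I ⟶ Y) (h : g - f = a ≫ b) :
    M.γ.map f = M.γ.map g := by
  have hp : IsIso (M.γ.map (biprod.fst : Y ⊞ I ⟶ Y)) :=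
    MorphismProperty.Q_inverts _ _ (M.weq_fst Y hI)
  have key : M.γ.map (biprod.fst : Y ⊞ I ⟶ Y) = M.γ.map (biprod.desc (𝟙 Y) b) := by
    have h1 : M.γ.map (biprod.inl : Y ⟶ Y ⊞ I) ≫ M.γ.map (biprod.fst : Y ⊞ I ⟶ Y) = 𝟙 _ := by
      rw [← Functor.map_comp]; simp
    have h2 : M.γ.map (biprod.fst : Y ⊞ I ⟶ Y) ≫ M.γ.map (biprod.inl : Y ⟶ Y ⊞ I) = 𝟙 _ := by
      rw [← cancel_mono (M.γ.map (biprod.fst : Y ⊞ I ⟶ Y)), Category.assoc, h1]; simp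
    have h3 : M.γ.map (biprod.inl : Y ⟶ Y ⊞ I) ≫ M.γ.map (biprod.desc (𝟙 Y) b) = 𝟙 _ := by
      rw [← Functor.map_comp]; simp
    calc M.γ.map (biprod.fst : Y ⊞ I ⟶ Y)
        = M.γ.map (biprod.fst : Y ⊞ I ⟶ Y) ≫ M.γ.map (biprod.inl : Y ⟶ Y ⊞ I) ≫
            M.γ.map (biprod.desc (𝟙 Y) b) := by rw [h3, Category.comp_id]
      _ = _ := by rw [← Category.assoc, h2, Category.id_comp]
  have e1 : f = biprod.lift f a ≫ (biprod.fst : Y ⊞ I ⟶ Y) := by simp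
  have e2 : g = biprod.lift f a ≫ biprod.desc (𝟙 Y) b := by
    rw [biprod.lift_desc, Category.comp_id, ← h]; abel
  rw [e2, Functor.map_comp, ← key, ← Functor.map_comp, ← e1]

/-- The quotient functor `P/∼ ⥤ A/W`, sending the class of `f` to `γ f`. -/
def quotientFunctor (M : E.InjectiveCotorsionPair) (P : ObjectProperty A) : E.Stable P ⥤ M.Ho :=
  CategoryTheory.Quotient.lift _ (P.ι ⋙ M.γ) (fun _ _ _ _ hfg => by
    obtain ⟨I, a, b, hI, h⟩ := hfg
    exact M.γ_map_eq hI a b h)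

end InjectiveCotorsionPair
end ExactStructure

/-! ### Triangulated categories and recollements -/

/-- The structure of a triangulated category on a category. -/
class TriangulatedStructure (T : Type*) [Category* T] where
  preadditive : Preadditive T
  hasZeroObject : HasZeroObject T
  hasShift : HasShift T ℤ
  shift_additive : ∀ n : ℤ, (shiftFunctor T n).Additive
  pretriangulated : Pretriangulated T
  isTriangulated : IsTriangulated T

attribute [reducible, instance] TriangulatedStructure.preadditive
attribute [reducible, instance] TriangulatedStructure.hasShift
attribute [reducible, instance] TriangulatedStructure.pretriangulated
attribute [instance] TriangulatedStructure.hasZeroObject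
  TriangulatedStructure.shift_additive TriangulatedStructure.isTriangulated

open Pretriangulated

/-- The triangulated structure on `T` is the one determined by a functor `G : B ⥤ T` and a class
`conf` of short exact sequences in `B`: there are natural connecting morphisms
`G X₃ ⟶ (G X₁)⟦1⟧` for the sequences `X₁ ⟶ X₂ ⟶ X₃` in `conf`, and the distinguished triangles are
exactly the triangles isomorphic to those obtained in this way. When each `X₁` in `B` has such a
sequence with `G X₂ = 0`, the connecting morphism of the latter identifies the shift of `G X₁` with
`G X₃`, and by naturality this determines all the other connecting morphisms: for the stable
category of a Frobenius category, one gets the usual suspension and triangles. -/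
def IsTriangulatedAlong {B : Type*} [Category* B] [Preadditive B] {T : Type*} [Category* T]
    [TriangulatedStructure T] (conf : ShortComplex B → Prop) (G : B ⥤ T) : Prop :=
  G.Additive ∧
  ∃ δ : ∀ S : ShortComplex B, conf S → (G.obj S.X₃ ⟶ (G.obj S.X₁)⟦(1 : ℤ)⟧),
    (∀ (S S' : ShortComplex B) (hS : conf S) (hS' : conf S') (φ : S ⟶ S'),
      G.map φ.τ₃ ≫ δ S' hS' = δ S hS ≫ (G.map φ.τ₁)⟦(1 : ℤ)⟧') ∧
    ∀ t : Triangle T, t ∈ distTriang T ↔ ∃ (S : ShortComplex B) (hS : conf S),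
      Nonempty (t ≅ Triangle.mk (G.map S.f) (G.map S.g) (δ S hS))

/-- A functor between triangulated categories is exact if it can be made into a triangulated
functor, i.e. one that commutes with the shifts and preserves distinguished triangles. -/
def IsExactFunctor {T T' : Type*} [Category* T] [Category* T'] [TriangulatedStructure T]
    [TriangulatedStructure T'] (G : T ⥤ T') : Prop :=
  ∃ _ : G.CommShift ℤ, G.IsTriangulated

/-- A recollement `T' ⥤ T ⥤ T''` of triangulated categories, with functors `I` and `Q`, the left
and right adjoints `Iₗ`, `Iᵣ` of `I` and the left and right adjoints `Qₗ`, `Qᵣ` of `Q`. -/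
structure IsRecollement {T' T T'' : Type*} [Category* T'] [Category* T] [Category* T'']
    [TriangulatedStructure T'] [TriangulatedStructure T] [TriangulatedStructure T'']
    (I : T' ⥤ T) (Iₗ Iᵣ : T ⥤ T') (Q : T ⥤ T'') (Qₗ Qᵣ : T'' ⥤ T) : Prop where
  exact_I : IsExactFunctor I
  exact_Iₗ : IsExactFunctor Iₗ
  exact_Iᵣ : IsExactFunctor Iᵣ
  exact_Q : IsExactFunctor Q
  exact_Qₗ : IsExactFunctor Qₗ
  exact_Qᵣ : IsExactFunctor Qᵣ
  adj_Iₗ : Nonempty (Iₗ ⊣ I)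
  adj_Iᵣ : Nonempty (I ⊣ Iᵣ)
  adj_Qₗ : Nonempty (Qₗ ⊣ Q)
  adj_Qᵣ : Nonempty (Q ⊣ Qᵣ)
  full_I : I.Full
  faithful_I : I.Faithful
  full_Qₗ : Qₗ.Full
  faithful_Qₗ : Qₗ.Faithful
  full_Qᵣ : Qᵣ.Full
  faithful_Qᵣ : Qᵣ.Faithful
  /-- the kernel of `Q` is the essential image of `I` -/
  kernel_Q : ∀ X : T, IsZero (Q.obj X) ↔ I.essImage X

/-! ### The functors given by special preenvelopes and special precovers -/

namespace ExactStructure.InjectiveCotorsionPair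

variable {A : Type u} [Category.{v} A] [Preadditive A] [HasZeroObject A] [HasBinaryBiproducts A]
  {E : ExactStructure A}

/-- The functor `e : P/∼ ⥤ P'/∼`, for `P' ⊆ P`, is `E(M)`: the object `e X` is a special
preenvelope `X ↣ e X` for `M`, and the classes of these preenvelopes form a natural
transformation. -/
def IsPreenvelopeFunctor (M : E.InjectiveCotorsionPair) {P' P : ObjectProperty A} (h : P' ≤ P)
    (e : E.Stable P ⥤ E.Stable P') : Prop :=
  ∃ j : 𝟭 (E.Stable P) ⟶ e ⋙ E.stableInclusion h, ∀ X : P.FullSubcategory,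
    ∃ f : X ⟶ (ObjectProperty.ιOfLE h).obj (e.obj ((E.toStable P).obj X)).as,
      M.IsSpecialPreenvelope f.hom ∧ j.app ((E.toStable P).obj X) = (E.toStable P).map f

/-- The functor `c : P/∼ ⥤ P'/∼`, for `P' ⊆ P`, is `C(M)`: the object `c X` is a special
precover `c X ↠ X` for `M`, and the classes of these precovers form a natural transformation. -/
def IsPrecoverFunctor (M : E.InjectiveCotorsionPair) {P' P : ObjectProperty A} (h : P' ≤ P)
    (c : E.Stable P ⥤ E.Stable P') : Prop :=
  ∃ p : c ⋙ E.stableInclusion h ⟶ 𝟭 (E.Stable P), ∀ X : P.FullSubcategory,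
    ∃ f : (ObjectProperty.ιOfLE h).obj (c.obj ((E.toStable P).obj X)).as ⟶ X,
      M.IsSpecialPrecover f.hom ∧ p.app ((E.toStable P).obj X) = (E.toStable P).map f

/-- The functor `ρ : A/W ⥤ P/∼` is `E(N)`: the object `ρ X` is a special preenvelope `X ↣ ρ X`
for `N`, and these preenvelopes become a natural isomorphism in `A/W`. -/
def IsPreenvelopeSection (M : E.InjectiveCotorsionPair) (P : ObjectProperty A)
    (N : E.InjectiveCotorsionPair) (ρ : M.Ho ⥤ E.Stable P) : Prop :=
  ∃ j : 𝟭 M.Ho ≅ ρ ⋙ M.quotientFunctor P, ∀ X : A,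
    ∃ f : X ⟶ (ρ.obj (M.γ.obj X)).as.obj,
      N.IsSpecialPreenvelope f ∧ j.hom.app (M.γ.obj X) = M.γ.map f

/-- The functor `l : A/W ⥤ P/∼` is `C(N') ∘ E(N)`: for each `X` there are a special preenvelope
`X ↣ Y` for `N` and a special precover `l X ↠ Y` for `N'`, and the resulting zigzags become a
natural isomorphism in `A/W`. -/
def IsPrecoverPreenvelopeSection (M : E.InjectiveCotorsionPair) (P : ObjectProperty A)
    (N' N : E.InjectiveCotorsionPair) (l : M.Ho ⥤ E.Stable P) : Prop :=
  ∃ θ : l ⋙ M.quotientFunctor P ≅ 𝟭 M.Ho, ∀ X : A,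
    ∃ (Y : A) (j : X ⟶ Y) (p : (l.obj (M.γ.obj X)).as.obj ⟶ Y),
      N.IsSpecialPreenvelope j ∧ N'.IsSpecialPrecover p ∧
        θ.hom.app (M.γ.obj X) ≫ M.γ.map j = M.γ.map p

end ExactStructure.InjectiveCotorsionPair

end

/-! Everything rests on one orthogonality. For an injective cotorsion pair (W, F) every map from W
to F factors through an injective object (`null_of_W_F`). Moreover F is closed under cokernels of
inflations (`F_right`), and a special W-precover of an object of F has its source in W ∩ F. Hence F,
with the exact structure of the ambient category, is a Frobenius category whose projective-injective
objects are the injectives of A, and F/∼ is triangulated in Happel's way: the shift is the cosyzygy,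
triangles come from conflations, and the octahedron is Noether's isomorphism.

Special preenvelopes are universal arrows from A to F/∼. They therefore define a functor A ⥤ F/∼
inverting weak equivalences, and maps X ⟶ R in A/W with R in F are homotopy classes of maps of A
(`γ_map_surjective`, `null_of_γ_map_eq`).

Now let W₃ ∩ F₁ = F₂. Preenvelopes for M₂ give the left adjoint of I. Precovers for M₃ give the
right adjoint, since a precover of an object of F₁ lies in W₃ ∩ F₁ = F₂. The functor Q is bijective
on maps into F₃ because these objects are fibrant for M₃. It is also bijective on maps out of W₂ ∩
F₁: the M₃-preenvelope of an object of F₁ has cokernel in W₃ ∩ F₁ = F₂, which objects of W₂ do not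
see stably (`exists_conf_env`, `quotientFunctor_bijective_of_W`). So F₃/∼ and (W₂ ∩ F₁)/∼ both embed
in A/W₃. Both embeddings are essentially surjective, since preenvelopes, and precovers of
preenvelopes, become invertible in A/W₃. Their inverses are ρ and λ. As γ X = 0 exactly when X is in
W₃, the kernel of Q on F₁ is F₂.

Only F₁/∼ is triangulated by hand. The other two categories inherit their triangles along the fully
faithful functors I and ρ, whose images F₂/∼ and F₃/∼ are closed under shifts and cones. The
remaining functors are exact as adjoints of exact functors. It is then checked that the inherited
triangles are those of the conflations of F₂ and of A; for A the horseshoe lemma replaces a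
conflation by one in F₁.

For the model structures, the weak equivalences of a Hovey triple are the maps whose cone is trivial
(`IsHoveyTriple.weq_iff`), so that two-out-of-three follows from thickness. An object is trivial for
M/M' when its special F-preenvelope lies in F', which yields thickness again by the horseshoe lemma.
Both Quillen equivalences then reduce to comparing two classes of trivial cones. -/

section

/-! ### Conflations -/

namespace ExactStructure

variable {A : Type u} [Category.{v} A] [Preadditive A] [HasZeroObject A] [HasBinaryBiproducts A]
  (E : ExactStructure A)

/-- The pair `(i, p)` is an admissible short exact sequence. -/
def Conf {X Y Z : A} (i : X ⟶ Y) (p : Y ⟶ Z) : Prop :=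
  ∃ w : i ≫ p = 0, E.conflation (ShortComplex.mk i p w)

variable {E}

lemma monoWithCokernel_iff {P : ObjectProperty A} {X Y : A} {i : X ⟶ Y} :
    E.monoWithCokernel P i ↔ ∃ (C : A) (p : Y ⟶ C), E.Conf i p ∧ P C :=
  ⟨fun ⟨C, p, w, h, hC⟩ => ⟨C, p, ⟨w, h⟩, hC⟩, fun ⟨C, p, ⟨w, h⟩, hC⟩ => ⟨C, p, w, h, hC⟩⟩

lemma epiWithKernel_iff {P : ObjectProperty A} {X Y : A} {p : X ⟶ Y} :
    E.epiWithKernel P p ↔ ∃ (K : A) (i : K ⟶ X), E.Conf i p ∧ P K :=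
  ⟨fun ⟨C, p, w, h, hC⟩ => ⟨C, p, ⟨w, h⟩, hC⟩, fun ⟨C, p, ⟨w, h⟩, hC⟩ => ⟨C, p, w, h, hC⟩⟩

namespace Conf

variable {X Y Z : A} {i : X ⟶ Y} {p : Y ⟶ Z}

lemma w (h : E.Conf i p) : i ≫ p = 0 := h.1

lemma exists_lift (h : E.Conf i p) {T : A} (t : T ⟶ Y) (ht : t ≫ p = 0) :
    ∃ s : T ⟶ X, s ≫ i = t := by
  obtain ⟨w, h⟩ := h
  obtain ⟨hl⟩ := E.kernel h
  obtain ⟨s, hs⟩ := KernelFork.IsLimit.lift' hl t ht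
  exact ⟨s, hs⟩

lemma exists_desc (h : E.Conf i p) {T : A} (t : Y ⟶ T) (ht : i ≫ t = 0) :
    ∃ s : Z ⟶ T, p ≫ s = t := by
  obtain ⟨w, h⟩ := h
  obtain ⟨hl⟩ := E.cokernel h
  obtain ⟨s, hs⟩ := CokernelCofork.IsColimit.desc' hl t ht
  exact ⟨s, hs⟩

lemma mono (h : E.Conf i p) : Mono i := by
  obtain ⟨w, h⟩ := h
  obtain ⟨hl⟩ := E.kernel h
  exact mono_of_isLimit_fork hl

lemma epi (h : E.Conf i p) : Epi p := by
  obtain ⟨w, h⟩ := h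
  obtain ⟨hl⟩ := E.cokernel h
  exact epi_of_isColimit_cofork hl

lemma of_iso (h : E.Conf i p) {X' Y' Z' : A} {i' : X' ⟶ Y'} {p' : Y' ⟶ Z'}
    (e₁ : X ≅ X') (e₂ : Y ≅ Y') (e₃ : Z ≅ Z') (h₁ : i ≫ e₂.hom = e₁.hom ≫ i')
    (h₂ : p ≫ e₃.hom = e₂.hom ≫ p') : E.Conf i' p' := by
  obtain ⟨w, h⟩ := h
  have w' : i' ≫ p' = 0 := by
    rw [← cancel_epi e₁.hom, ← Category.assoc, ← h₁, Category.assoc, ← h₂, ← Category.assoc, w]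
    simp
  exact ⟨w', E.of_iso (ShortComplex.isoMk e₁ e₂ e₃ h₁.symm h₂.symm) h⟩

/-- A cokernel of an inflation completes it to a conflation. -/
lemma of_cokernel (h : E.Conf i p) {Z' : A} (p' : Y ⟶ Z') (w' : i ≫ p' = 0)
    (hd : ∀ {T : A} (t : Y ⟶ T), i ≫ t = 0 → ∃ s : Z' ⟶ T, p' ≫ s = t) (he : Epi p') :
    E.Conf i p' := by
  obtain ⟨s, hs⟩ := h.exists_desc p' w'
  obtain ⟨t, ht⟩ := hd p h.w
  have := h.epi
  refine h.of_iso (Iso.refl _) (Iso.refl _)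
    ⟨s, t, by rw [← cancel_epi p, ← Category.assoc, hs, ht, Category.comp_id],
      by rw [← cancel_epi p', ← Category.assoc, ht, hs, Category.comp_id]⟩ (by simp) (by simpa)

/-- A kernel of a deflation completes it to a conflation. -/
lemma of_kernel (h : E.Conf i p) {X' : A} (i' : X' ⟶ Y) (w' : i' ≫ p = 0)
    (hd : ∀ {T : A} (t : T ⟶ Y), t ≫ p = 0 → ∃ s : T ⟶ X', s ≫ i' = t) (he : Mono i') :
    E.Conf i' p := by
  obtain ⟨s, hs⟩ := h.exists_lift i' w'
  obtain ⟨t, ht⟩ := hd i h.w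
  have := h.mono
  refine h.of_iso ⟨t, s, by rw [← cancel_mono i, Category.assoc, hs, ht, Category.id_comp],
      by rw [← cancel_mono i', Category.assoc, ht, hs, Category.id_comp]⟩
      (Iso.refl _) (Iso.refl _) (by simpa using ht.symm) (by simp)

lemma inl_snd (X Y : A) : E.Conf (biprod.inl : X ⟶ X ⊞ Y) (biprod.snd : X ⊞ Y ⟶ Y) :=
  ⟨_, E.split X Y⟩

lemma inr_fst (X Y : A) : E.Conf (biprod.inr : Y ⟶ X ⊞ Y) (biprod.fst : X ⊞ Y ⟶ X) :=
  (inl_snd Y X).of_iso (Iso.refl _) (biprod.braiding Y X) (Iso.refl _) (by ext <;> simp) (by simp)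

lemma id_zero (X : A) : E.Conf (𝟙 X) (0 : X ⟶ (0 : A)) :=
  (inl_snd X 0).of_iso (Iso.refl _) ⟨biprod.fst, biprod.inl, by ext; simp, by simp⟩
    (Iso.refl _) (by simp) (by simp)

lemma zero_id (X : A) : E.Conf (0 : (0 : A) ⟶ X) (𝟙 X) :=
  (inl_snd 0 X).of_iso (Iso.refl _) ⟨biprod.snd, biprod.inr, by ext; simp, by simp⟩
    (Iso.refl _) (by simp) (by simp)

/-- A section of the deflation of a conflation yields a retraction of the inflation. -/
lemma exists_retraction (h : E.Conf i p) (s : Z ⟶ Y) (hs : s ≫ p = 𝟙 Z) :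
    ∃ r : Y ⟶ X, i ≫ r = 𝟙 X ∧ r ≫ i + p ≫ s = 𝟙 Y := by
  obtain ⟨r, hr⟩ := h.exists_lift (𝟙 Y - p ≫ s) (by simp [hs])
  have := h.mono
  refine ⟨r, ?_, by rw [hr]; abel⟩
  rw [← cancel_mono i, Category.assoc, hr, Preadditive.comp_sub, ← Category.assoc, h.w]
  simp

lemma exists_section (h : E.Conf i p) (r : Y ⟶ X) (hr : i ≫ r = 𝟙 X) :
    ∃ s : Z ⟶ Y, s ≫ p = 𝟙 Z ∧ r ≫ i + p ≫ s = 𝟙 Y := by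
  obtain ⟨s, hs⟩ := h.exists_desc (𝟙 Y - r ≫ i) (by rw [Preadditive.comp_sub, ← Category.assoc, hr]; simp)
  have := h.epi
  refine ⟨s, ?_, by rw [hs]; abel⟩
  rw [← cancel_epi p, ← Category.assoc, hs, Preadditive.sub_comp, Category.assoc, h.w]
  simp

lemma comp_inflation (h : E.Conf i p) {W D : A} {j : Y ⟶ W} {q : W ⟶ D} (h' : E.Conf j q) :
    ∃ (B : A) (r : W ⟶ B), E.Conf (i ≫ j) r := by
  obtain ⟨C, r, w, hr⟩ := E.inflation_comp i j ⟨_, _, h.1, h.2⟩ ⟨_, _, h'.1, h'.2⟩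
  exact ⟨C, r, w, hr⟩

lemma comp_deflation (h : E.Conf i p) {W K : A} {j : K ⟶ Z} {q : Z ⟶ W} (h' : E.Conf j q) :
    ∃ (B : A) (r : B ⟶ Y), E.Conf r (p ≫ q) := by
  obtain ⟨C, r, w, hr⟩ := E.deflation_comp p q ⟨_, _, h.1, h.2⟩ ⟨_, _, h'.1, h'.2⟩
  exact ⟨C, r, w, hr⟩

/-- The pushout of a conflation. -/
lemma of_isPushout (h : E.Conf i p) {X' P : A} {f : X ⟶ X'} {g : Y ⟶ P} {j : X' ⟶ P}
    (sq : IsPushout i f g j) {q : P ⟶ Z} (hq₁ : g ≫ q = p) (hq₂ : j ≫ q = 0) : E.Conf j q := by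
  -- The axiom only provides some pushout, with an unspecified cokernel. Uniqueness of pushouts
  -- makes j an inflation, and q is then verified to be its cokernel.
  obtain ⟨P', g', j', sq', C, p', w', h'⟩ := E.pushout h.2 f
  have h₁ : E.Conf j (sq.desc g' j' sq'.w ≫ p') :=
    Conf.of_iso (E := E) ⟨w', h'⟩ (Iso.refl _) (sq'.isoIsPushout _ _ sq) (Iso.refl _)
      (by simp) (by apply sq'.hom_ext <;> simp)
  have := h.epi
  refine h₁.of_cokernel q hq₂ (fun t ht => ?_) ?_
  · obtain ⟨s, hs⟩ := h.exists_desc (g ≫ t) (by rw [sq.w_assoc, ht, comp_zero])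
    exact ⟨s, sq.hom_ext (by rw [reassoc_of% hq₁, hs]) (by rw [reassoc_of% hq₂, ht, zero_comp])⟩
  · have : Epi (g ≫ q) := by rwa [hq₁]
    exact epi_of_epi g q

/-- The pullback of a conflation. -/
lemma of_isPullback (h : E.Conf i p) {Z' P : A} {f : Z' ⟶ Z} {g : P ⟶ Y} {q : P ⟶ Z'}
    (sq : IsPullback g q p f) {j : X ⟶ P} (hj₁ : j ≫ g = i) (hj₂ : j ≫ q = 0) : E.Conf j q := by
  obtain ⟨P', g', q', sq', C, p', w', h'⟩ := E.pullback h.2 f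
  have h₁ : E.Conf (p' ≫ sq.lift g' q' sq'.w) q :=
    Conf.of_iso (E := E) ⟨w', h'⟩ (Iso.refl _) (sq'.isoIsPullback _ _ sq) (Iso.refl _)
      (by simp only [Iso.refl_hom, Category.id_comp]; congr 1)
      (by simp)
  have := h.mono
  refine h₁.of_kernel j hj₂ (fun t ht => ?_) ?_
  · obtain ⟨s, hs⟩ := h.exists_lift (t ≫ g) (by rw [Category.assoc, sq.w, reassoc_of% ht, zero_comp])
    exact ⟨s, sq.hom_ext (by rw [Category.assoc, hj₁, hs])
      (by rw [Category.assoc, hj₂, ht, comp_zero])⟩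
  · have : Mono (j ≫ g) := by rwa [hj₁]
    exact mono_of_mono j g

lemma exists_pushout (h : E.Conf i p) {X' : A} (f : X ⟶ X') :
    ∃ (P : A) (g : Y ⟶ P) (j : X' ⟶ P) (q : P ⟶ Z), IsPushout i f g j ∧ g ≫ q = p ∧
      E.Conf j q := by
  obtain ⟨P, g, j, sq, -⟩ := E.pushout h.2 f
  have w : i ≫ p = f ≫ 0 := by simp [h.w]
  exact ⟨P, g, j, sq.desc p 0 w, sq, sq.inl_desc _ _ w,
    h.of_isPushout sq (sq.inl_desc _ _ w) (sq.inr_desc _ _ w)⟩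

lemma exists_pullback (h : E.Conf i p) {Z' : A} (f : Z' ⟶ Z) :
    ∃ (P : A) (g : P ⟶ Y) (q : P ⟶ Z') (j : X ⟶ P), IsPullback g q p f ∧ j ≫ g = i ∧
      E.Conf j q := by
  obtain ⟨P, g, q, sq, -⟩ := E.pullback h.2 f
  have w : i ≫ p = 0 ≫ f := by simp [h.w]
  exact ⟨P, g, q, sq.lift i 0 w, sq, sq.lift_fst _ _ w,
    h.of_isPullback sq (sq.lift_fst _ _ w) (sq.lift_snd _ _ w)⟩

/-- The pullback of two deflations with the same target. -/
lemma exists_pullback₂ (h : E.Conf i p) {X' Y' : A} {i' : X' ⟶ Y'} {p' : Y' ⟶ Z}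
    (h' : E.Conf i' p') : ∃ (P : A) (g : P ⟶ Y) (q : P ⟶ Y') (j : X ⟶ P) (j' : X' ⟶ P),
      IsPullback g q p p' ∧ j ≫ g = i ∧ j' ≫ q = i' ∧ E.Conf j q ∧ E.Conf j' g := by
  obtain ⟨P, g, q, j, sq, hj, hc⟩ := h.exists_pullback p'
  have w : 0 ≫ p = i' ≫ p' := by simp [h'.w]
  exact ⟨P, g, q, j, sq.lift 0 i' w, sq, hj, sq.lift_snd _ _ w, hc,
    h'.of_isPullback sq.flip (sq.lift_snd _ _ w) (sq.lift_fst _ _ w)⟩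

lemma exists_pushout₂ (h : E.Conf i p) {Y' Z' : A} {i' : X ⟶ Y'} {p' : Y' ⟶ Z'}
    (h' : E.Conf i' p') : ∃ (P : A) (g : Y ⟶ P) (j : Y' ⟶ P) (q : P ⟶ Z) (q' : P ⟶ Z'),
      IsPushout i i' g j ∧ g ≫ q = p ∧ j ≫ q' = p' ∧ E.Conf j q ∧ E.Conf g q' := by
  obtain ⟨P, g, j, q, sq, hj, hc⟩ := h.exists_pushout i'
  have w : i ≫ 0 = i' ≫ p' := by simp [h'.w]
  exact ⟨P, g, j, q, sq.desc 0 p' w, sq, hj, sq.inr_desc _ _ w, hc,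
    h'.of_isPushout sq.flip (sq.inr_desc _ _ w) (sq.inl_desc _ _ w)⟩

lemma id_biprod_map (h : E.Conf i p) (B : A) :
    E.Conf (biprod.map (𝟙 B) i) (biprod.snd ≫ p) := by
  have sq : IsPushout i (biprod.inr : X ⟶ B ⊞ X) (biprod.inr : Y ⟶ B ⊞ Y)
      (biprod.map (𝟙 B) i) := by
    refine ⟨⟨by simp⟩, ⟨PushoutCocone.IsColimit.mk _
      (fun s => biprod.desc (biprod.inl ≫ s.inr) s.inl) (fun s => by simp)
      (fun s => by
        have := s.condition
        ext <;> simp [this]) (fun s m h₁ h₂ => ?_)⟩⟩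
    ext
    · simp [← h₂]
    · simp [← h₁]
  exact h.of_isPushout sq (by simp) (by ext <;> simp [h.w])

lemma biprod_map_id (h : E.Conf i p) (B : A) :
    E.Conf (i ≫ biprod.inr) (biprod.map (𝟙 B) p) := by
  have sq : IsPullback (biprod.snd : B ⊞ Y ⟶ Y) (biprod.map (𝟙 B) p) p
      (biprod.snd : B ⊞ Z ⟶ Z) := by
    refine ⟨⟨by simp⟩, ⟨PullbackCone.IsLimit.mk _
      (fun s => biprod.lift (s.snd ≫ biprod.fst) s.fst) (fun s => by simp)
      (fun s => by
        have := s.condition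
        ext <;> simp [this]) (fun s m h₁ h₂ => ?_)⟩⟩
    ext
    · simp [← h₂]
    · simp [← h₁]
  exact h.of_isPullback sq (by simp) (by ext <;> simp [h.w])

/-- The graph-like map `X ⟶ B ⊞ Y` with second component an inflation is an inflation. -/
lemma exists_lift_conf (h : E.Conf i p) {B : A} (f : X ⟶ B) :
    ∃ (C : A) (q : B ⊞ Y ⟶ C), E.Conf (biprod.lift f i) q := by
  -- The graph of f is a split inflation, obtained from `biprod.inr` by a shear. Composing it with 𝟙
  -- ⊞ i gives the map in question.
  have h₁ : E.Conf (biprod.lift f (𝟙 X)) (biprod.fst - biprod.snd ≫ f : B ⊞ X ⟶ B) :=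
    (inr_fst B X).of_iso (Iso.refl _)
      ⟨biprod.fst ≫ biprod.inl + biprod.snd ≫ biprod.lift f (𝟙 X),
        biprod.fst ≫ biprod.inl + biprod.snd ≫ biprod.lift (-f) (𝟙 X),
        by ext <;> simp, by ext <;> simp⟩ (Iso.refl _) (by ext <;> simp) (by ext <;> simp)
  obtain ⟨C, r, hr⟩ := h₁.comp_inflation (h.id_biprod_map B)
  refine ⟨C, r, ?_⟩
  convert hr using 1
  ext <;> simp

lemma exists_desc_conf (h : E.Conf i p) {B : A} (f : B ⟶ Z) :
    ∃ (C : A) (q : C ⟶ B ⊞ Y), E.Conf q (biprod.desc f p) := by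
  have h₁ : E.Conf (biprod.lift (𝟙 B) (-f)) (biprod.desc f (𝟙 Z)) :=
    (inl_snd B Z).of_iso (Iso.refl _)
      ⟨biprod.fst ≫ biprod.lift (𝟙 B) (-f) + biprod.snd ≫ biprod.inr,
        biprod.fst ≫ biprod.lift (𝟙 B) f + biprod.snd ≫ biprod.inr,
        by ext <;> simp, by ext <;> simp⟩ (Iso.refl _) (by ext <;> simp) (by ext <;> simp)
  obtain ⟨C, r, hr⟩ := (h.biprod_map_id B).comp_deflation h₁
  refine ⟨C, r, ?_⟩
  convert hr using 1
  ext <;> simp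

/-- A pullback square along a deflation yields a conflation. -/
lemma lift_desc_of_isPullback (h : E.Conf i p) {Z' P : A} {f : Z' ⟶ Z} {g : P ⟶ Y} {q : P ⟶ Z'}
    (sq : IsPullback g q p f) : E.Conf (biprod.lift q g) (biprod.desc f (-p)) := by
  obtain ⟨C, r, hr⟩ := h.exists_desc_conf f
  have hr' : E.Conf (r ≫ biprod.map (𝟙 _) (-𝟙 _)) (biprod.desc f (-p)) :=
    hr.of_iso (Iso.refl _) ⟨biprod.map (𝟙 _) (-𝟙 _), biprod.map (𝟙 _) (-𝟙 _),
      by ext <;> simp, by ext <;> simp⟩ (Iso.refl _) (by simp) (by ext <;> simp)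
  refine hr'.of_kernel _ (by simp [sq.w]) (fun t ht => ?_) ?_
  · have ht' : (t ≫ biprod.snd) ≫ p = (t ≫ biprod.fst) ≫ f := by
      have h2 : t = biprod.lift (t ≫ biprod.fst) (t ≫ biprod.snd) := by ext <;> simp
      rw [h2, biprod.lift_desc, Preadditive.comp_neg, add_neg_eq_zero] at ht
      exact ht.symm
    refine ⟨sq.lift (t ≫ biprod.snd) (t ≫ biprod.fst) ht', ?_⟩
    ext <;> simp
  · refine ⟨fun a b hab => sq.hom_ext ?_ ?_⟩
    · simpa using congrArg (· ≫ biprod.snd) hab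
    · simpa using congrArg (· ≫ biprod.fst) hab

/-- A pushout square along an inflation yields a conflation. -/
lemma lift_desc_of_isPushout (h : E.Conf i p) {X' P : A} {f : X ⟶ X'} {g : Y ⟶ P} {j : X' ⟶ P}
    (sq : IsPushout i f g j) : E.Conf (biprod.lift f i) (biprod.desc j (-g)) := by
  obtain ⟨C, r, hr⟩ := h.exists_lift_conf f
  refine hr.of_cokernel _ (by simp [sq.w]) (fun t ht => ?_) ?_
  · have ht' : i ≫ (-(biprod.inr ≫ t)) = f ≫ biprod.inl ≫ t := by
      have h2 : t = biprod.desc (biprod.inl ≫ t) (biprod.inr ≫ t) := by ext <;> simp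
      rw [h2, biprod.lift_desc, add_eq_zero_iff_eq_neg] at ht
      rw [ht, Preadditive.comp_neg]
    refine ⟨sq.desc (-(biprod.inr ≫ t)) (biprod.inl ≫ t) ht', ?_⟩
    ext <;> simp
  · refine ⟨fun a b hab => sq.hom_ext ?_ ?_⟩
    · simpa using congrArg (biprod.inr ≫ ·) hab
    · simpa using congrArg (biprod.inl ≫ ·) hab

/-- The short five lemma. -/
lemma isIso_of_id_id {Y' : A} {i' : X ⟶ Y'} {p' : Y' ⟶ Z} (h : E.Conf i p) (h' : E.Conf i' p')
    (c : Y ⟶ Y') (h₁ : i ≫ c = i') (h₂ : c ≫ p' = p) : IsIso c := by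
  -- The inverse is constructed on the pullback R of p and p'. There a ≫ c - b comes from a map m to
  -- X, and a - m ≫ i vanishes on the kernel of the deflation b, so it descends to a section s of c.
  -- Since c is also left cancellable by zero, s is its inverse.
  obtain ⟨R, a, b, k, -, sq, hk, -, hkb, -⟩ := h.exists_pullback₂ h'
  have := h'.mono
  have := h.mono
  have := hkb.epi
  obtain ⟨m, hm⟩ := h'.exists_lift (a ≫ c - b) (by
    rw [Preadditive.sub_comp, Category.assoc, h₂, sq.w, sub_self])
  have hkm : k ≫ m = 𝟙 X := by
    rw [← cancel_mono i', Category.assoc, hm, Preadditive.comp_sub, reassoc_of% hk, h₁, hkb.w]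
    simp
  obtain ⟨s, hs⟩ := hkb.exists_desc (a - m ≫ i) (by
    rw [Preadditive.comp_sub, hk, reassoc_of% hkm, sub_self])
  have hsc : s ≫ c = 𝟙 Y' := by
    rw [← cancel_epi b, reassoc_of% hs, Preadditive.sub_comp, Category.assoc, h₁, hm]
    simp
  have hc : ∀ {T : A} (t : T ⟶ Y), t ≫ c = 0 → t = 0 := fun t ht => by
    obtain ⟨u, rfl⟩ := h.exists_lift t (by rw [← h₂, reassoc_of% ht, zero_comp])
    have : u = 0 := by rw [← cancel_mono i', zero_comp, ← h₁, ← Category.assoc, ht]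
    rw [this, zero_comp]
  refine ⟨s, ?_, hsc⟩
  rw [← sub_eq_zero]
  apply hc
  rw [Preadditive.sub_comp, Category.assoc, hsc]
  simp

/-- A morphism of conflations which is the identity on the first terms yields a pullback. -/
lemma isPullback {Y' Z' : A} {i' : X ⟶ Y'} {p' : Y' ⟶ Z'} (h : E.Conf i p) (h' : E.Conf i' p')
    {b : Y ⟶ Y'} {c : Z ⟶ Z'} (h₁ : i ≫ b = i') (h₂ : b ≫ p' = p ≫ c) :
    IsPullback b p p' c := by
  obtain ⟨P, g, q, j, sq, hj, hc⟩ := h'.exists_pullback c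
  have h₃ := h.isIso_of_id_id hc (sq.lift b p h₂)
    (by apply sq.hom_ext <;> simp [h₁, hj, h.w, hc.w]) (by simp)
  exact sq.of_iso (asIso (sq.lift b p h₂)).symm (Iso.refl _) (Iso.refl _) (Iso.refl _)
    (by simp) (by simp) (by simp) (by simp)

/-- The quotient of two composable inflations. -/
lemma noether (h : E.Conf i p) {W D : A} {j : Y ⟶ W} {q : W ⟶ D} (h' : E.Conf j q) :
    ∃ (B : A) (r : W ⟶ B) (a : Z ⟶ B) (b : B ⟶ D), E.Conf (i ≫ j) r ∧ E.Conf a b ∧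
      IsPushout j p r a ∧ r ≫ b = q := by
  obtain ⟨B, r, a, b, sq, hb, hc⟩ := h'.exists_pushout p
  have := h.epi
  refine ⟨B, r, a, b, ?_, hc, sq, hb⟩
  obtain ⟨C, s, hs⟩ := h.comp_inflation h'
  refine hs.of_cokernel r (by rw [Category.assoc, sq.w, reassoc_of% h.w, zero_comp])
    (fun t ht => ?_) ⟨fun u v huv => sq.hom_ext huv ?_⟩
  · obtain ⟨x, hx⟩ := h.exists_desc (j ≫ t) (by simpa using ht)
    exact ⟨sq.desc t x hx.symm, by simp⟩
  · rw [← cancel_epi p, ← sq.w_assoc, ← sq.w_assoc, huv]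

/-- The kernel of a composition of two deflations. -/
lemma noether_kernel (h : E.Conf i p) {W K : A} {j : K ⟶ Z} {q : Z ⟶ W} (h' : E.Conf j q) :
    ∃ (B : A) (r : B ⟶ Y) (a : X ⟶ B) (b : B ⟶ K), E.Conf r (p ≫ q) ∧ E.Conf a b ∧
      a ≫ r = i ∧ r ≫ p = b ≫ j := by
  obtain ⟨B, r, b, a, sq, hb, hc⟩ := h.exists_pullback j
  have := h'.mono
  refine ⟨B, r, a, b, ?_, hc, hb, sq.w⟩
  obtain ⟨C, s, hs⟩ := h.comp_deflation h'
  refine hs.of_kernel r (by rw [sq.w_assoc, h'.w, comp_zero])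
    (fun t ht => ?_) ⟨fun u v huv => sq.hom_ext huv ?_⟩
  · obtain ⟨x, hx⟩ := h'.exists_lift (t ≫ p) (by simpa using ht)
    exact ⟨sq.lift t x hx.symm, by simp⟩
  · rw [← cancel_mono j, Category.assoc, Category.assoc, ← sq.w, reassoc_of% huv]

end Conf

/-! ### Cancellation of inflations and deflations in weakly idempotent complete categories -/

section WeaklyIdempotentComplete

variable (hA : WeaklyIdempotentComplete A)

omit [HasZeroObject A] [HasBinaryBiproducts A] in
include hA in
/-- In a weakly idempotent complete category, complements of split monomorphisms exist. -/
lemma exists_complement {X Y : A} (s : X ⟶ Y) (r : Y ⟶ X) (h : s ≫ r = 𝟙 X) :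
    ∃ (D : A) (k : D ⟶ Y) (q : Y ⟶ D), k ≫ q = 𝟙 D ∧ r ≫ s + q ≫ k = 𝟙 Y ∧ s ≫ q = 0 ∧
      k ≫ r = 0 := by
  have := hA s (IsSplitMono.mk' ⟨r, h⟩)
  let k : Limits.cokernel s ⟶ Y := cokernel.desc s (𝟙 Y - r ≫ s) (by
    rw [Preadditive.comp_sub, reassoc_of% h]; simp)
  have hk : cokernel.π s ≫ k = 𝟙 Y - r ≫ s := cokernel.π_desc _ _ _
  refine ⟨Limits.cokernel s, k, cokernel.π s, ?_, by rw [hk]; abel, cokernel.condition s, ?_⟩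
  · rw [← cancel_epi (cokernel.π s), reassoc_of% hk, Preadditive.sub_comp]
    simp
  · rw [← cancel_epi (cokernel.π s), reassoc_of% hk, Preadditive.sub_comp, Category.assoc, h]
    simp

include hA in
/-- In a weakly idempotent complete exact category, the first factor of an inflation is an
inflation. -/
lemma Conf.of_comp_inflation {X Y Z C : A} {i : X ⟶ Y} {j : Y ⟶ Z} {q : Z ⟶ C}
    (h : E.Conf (i ≫ j) q) : ∃ (D : A) (p : Y ⟶ D), E.Conf i p := by
  -- The map (i, i ≫ j) is an inflation, and the shear α carries it to i ≫ inl. The cokernel of the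
  -- latter has Z as a direct summand; the complement D, which exists by weak idempotent
  -- completeness, is the cokernel of i.
  obtain ⟨B, r, hr⟩ := h.exists_lift_conf i
  let α : Y ⊞ Z ≅ Y ⊞ Z :=
    ⟨biprod.fst ≫ biprod.lift (𝟙 Y) (-j) + biprod.snd ≫ biprod.inr,
      biprod.fst ≫ biprod.lift (𝟙 Y) j + biprod.snd ≫ biprod.inr,
      by ext <;> simp, by ext <;> simp⟩
  have hr' : E.Conf (i ≫ biprod.inl) (α.inv ≫ r) :=
    hr.of_iso (Iso.refl _) α (Iso.refl _) (by ext <;> simp [α]) (by simp)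
  obtain ⟨s, hs⟩ := hr'.exists_desc (biprod.snd) (by simp)
  obtain ⟨D, k, p, hkp, hsum, h₁, h₂⟩ := exists_complement hA (biprod.inr ≫ α.inv ≫ r) s
    (by rw [Category.assoc, hs]; simp)
  have := hr'.epi
  have hk : Mono k := ⟨fun a b hab => by
    rw [← Category.comp_id a, ← hkp, ← Category.assoc, hab, Category.assoc, hkp, Category.comp_id]⟩
  refine ⟨D, biprod.inl ≫ α.inv ≫ r ≫ p, ?_⟩
  have w : biprod.inl ≫ α.inv ≫ r = (biprod.inl ≫ α.inv ≫ r ≫ p) ≫ k := by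
    have h3 : (biprod.inl ≫ α.inv ≫ r) ≫ s = 0 := by simp only [Category.assoc] at hs ⊢; simp [hs]
    calc biprod.inl ≫ α.inv ≫ r = (biprod.inl ≫ α.inv ≫ r) ≫ 𝟙 _ := by simp
      _ = _ := by
        rw [← hsum, Preadditive.comp_add, ← Category.assoc _ s, h3]
        simp
  -- Pulling the conflation back along the complement D removes the summand Z from the middle term.
  have sq : IsPullback (biprod.inl : Y ⟶ Y ⊞ Z) (biprod.inl ≫ α.inv ≫ r ≫ p) (α.inv ≫ r) k := by
    refine ⟨⟨w⟩, ⟨PullbackCone.IsLimit.mk _ (fun t => t.fst ≫ biprod.fst) (fun t => ?_)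
      (fun t => ?_) (fun t m h₁ h₂ => by simp [← h₁])⟩⟩
    · have : t.fst ≫ biprod.snd = 0 := by
        rw [← hs, ← Category.assoc, t.condition, Category.assoc, h₂, comp_zero]
      ext <;> simp [this]
    · have h0 : t.fst ≫ biprod.snd = 0 := by
        rw [← hs, ← Category.assoc, t.condition, Category.assoc, h₂, comp_zero]
      have h1 : t.fst = (t.fst ≫ biprod.fst) ≫ biprod.inl := by ext <;> simp [h0]
      rw [← cancel_mono k, ← t.condition, Category.assoc, ← w]
      conv_rhs => rw [h1]
      simp
  refine hr'.of_isPullback sq rfl ?_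
  have := hr'.w
  simp only [Category.assoc] at this
  rw [reassoc_of% this, zero_comp]

include hA in
/-- In a weakly idempotent complete exact category, the second factor of a deflation is a
deflation. -/
lemma Conf.of_comp_deflation {X Y Z C : A} {i : X ⟶ Y} {j : Y ⟶ Z} {q : C ⟶ X}
    (h : E.Conf q (i ≫ j)) : ∃ (D : A) (p : D ⟶ Y), E.Conf p j := by
  obtain ⟨B, r, hr⟩ := h.exists_desc_conf j
  let α : Y ⊞ X ≅ Y ⊞ X :=
    ⟨biprod.fst ≫ biprod.inl + biprod.snd ≫ biprod.lift i (𝟙 X),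
      biprod.fst ≫ biprod.inl + biprod.snd ≫ biprod.lift (-i) (𝟙 X),
      by ext <;> simp, by ext <;> simp⟩
  have hr' : E.Conf (r ≫ α.hom) (biprod.fst ≫ j) :=
    hr.of_iso (Iso.refl _) α (Iso.refl _) (by simp) (by ext <;> simp [α])
  obtain ⟨s, hs⟩ := hr'.exists_lift (biprod.inr) (by simp)
  obtain ⟨D, k, p, hkp, hsum, h₁, h₂⟩ := exists_complement hA s (r ≫ α.hom ≫ biprod.snd)
    (by rw [reassoc_of% hs]; simp)
  have hp : Epi p := ⟨fun a b hab => by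
    rw [← Category.id_comp a, ← hkp, Category.assoc, hab, ← Category.assoc, hkp, Category.id_comp]⟩
  refine ⟨D, k ≫ r ≫ α.hom ≫ biprod.fst, ?_⟩
  have w : (r ≫ α.hom) ≫ biprod.fst = p ≫ k ≫ r ≫ α.hom ≫ biprod.fst := by
    have h3 : s ≫ r ≫ α.hom ≫ biprod.fst = 0 := by
      rw [reassoc_of% hs]; simp
    calc (r ≫ α.hom) ≫ biprod.fst = 𝟙 _ ≫ r ≫ α.hom ≫ biprod.fst := by simp
      _ = _ := by
        rw [← hsum, Preadditive.add_comp, Category.assoc _ s, h3]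
        simp
  have sq : IsPushout (r ≫ α.hom) p (biprod.fst : Y ⊞ X ⟶ Y) (k ≫ r ≫ α.hom ≫ biprod.fst) := by
    have key : ∀ {T : A} (t : Y ⊞ X ⟶ T) (u : D ⟶ T), (r ≫ α.hom) ≫ t = p ≫ u →
        biprod.inr ≫ t = 0 := fun t u h => by
      rw [← hs, Category.assoc, h, reassoc_of% h₁, zero_comp]
    refine ⟨⟨w⟩, ⟨PushoutCocone.IsColimit.mk _ (fun t => biprod.inl ≫ t.inl) (fun t => ?_)
      (fun t => ?_) (fun t m h₁ h₂ => by simp [← h₁])⟩⟩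
    · have := key _ _ t.condition
      ext <;> simp [this]
    · have h0 := key _ _ t.condition
      have h1 : t.inl = biprod.fst ≫ biprod.inl ≫ t.inl := by ext <;> simp [h0]
      rw [← cancel_epi p, ← t.condition, ← Category.assoc p, ← w]
      conv_rhs => rw [h1]
      simp
  refine hr'.of_isPushout sq rfl ?_
  have := hr'.w
  simp only [Category.assoc] at this ⊢
  rw [this, comp_zero]

end WeaklyIdempotentComplete

/-! ### Extensions and lifting -/

lemma ExtVanishes.exists_lift {K Z T C : A} {k : K ⟶ Z} {p : Z ⟶ T} (hE : E.ExtVanishes C K)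
    (h : E.Conf k p) (g : C ⟶ T) : ∃ f : C ⟶ Z, f ≫ p = g := by
  obtain ⟨P, a, q, j, sq, hj, hc⟩ := h.exists_pullback g
  obtain ⟨s, hs⟩ := hE j q hc.1 hc.2
  exact ⟨s ≫ a, by rw [Category.assoc, sq.w, reassoc_of% hs]⟩

lemma ExtVanishes.exists_extension {X Y C K : A} {i : X ⟶ Y} {p : Y ⟶ C}
    (hE : E.ExtVanishes C K) (h : E.Conf i p) (f : X ⟶ K) : ∃ g : Y ⟶ K, i ≫ g = f := by
  obtain ⟨P, a, j, q, sq, hj, hc⟩ := h.exists_pushout f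
  obtain ⟨s, hs⟩ := hE j q hc.1 hc.2
  obtain ⟨r, hr, -⟩ := hc.exists_retraction s hs
  exact ⟨a ≫ r, by rw [sq.w_assoc, hr, Category.comp_id]⟩

lemma extVanishes_of_retraction {X Y : A}
    (h : ∀ {Z : A} (i : Y ⟶ Z) (p : Z ⟶ X), E.Conf i p → ∃ r : Z ⟶ Y, i ≫ r = 𝟙 Y) :
    E.ExtVanishes X Y := fun Z i p w hc => by
  obtain ⟨r, hr⟩ := h i p ⟨w, hc⟩
  obtain ⟨s, hs, -⟩ := Conf.exists_section (E := E) ⟨w, hc⟩ r hr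
  exact ⟨s, hs⟩

/-- Inflations with cokernel `C` lift against deflations with kernel `K` if `Ext¹(C, K) = 0`. -/
lemma ExtVanishes.hasLiftingProperty (hA : WeaklyIdempotentComplete A) {X Y C K Z T : A}
    {i : X ⟶ Y} {c : Y ⟶ C} {k : K ⟶ Z} {p : Z ⟶ T} (hE : E.ExtVanishes C K) (hi : E.Conf i c)
    (hp : E.Conf k p) : HasLiftingProperty i p := by
  refine ⟨fun {f g} sq₀ => ?_⟩
  -- After pulling p back along g, what is needed is a section of q : P ⟶ Y that extends the given
  -- map X ⟶ P.
  obtain ⟨P, a, q, j, sq, hj, hc⟩ := hp.exists_pullback g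
  obtain ⟨D, d, hd⟩ : ∃ (D : A) (d : P ⟶ D), E.Conf (sq.lift f i sq₀.w) d := by
    refine Conf.of_comp_inflation hA (j := q) (q := c) ?_
    rw [sq.lift_snd]
    exact hi
  obtain ⟨v, hv⟩ := hd.exists_desc (q ≫ c) (by rw [sq.lift_snd_assoc, hi.w])
  have sq' : IsPullback q d c v := hd.isPullback hi (by simp) hv.symm
  obtain ⟨L, l, hl⟩ : ∃ (L : A) (l : L ⟶ D), E.Conf l v := by
    obtain ⟨B, r, hr⟩ := hc.comp_deflation hi
    rw [← hv] at hr
    exact Conf.of_comp_deflation hA hr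
  -- The cokernel D of X ⟶ P is an extension of C by K, hence split. As P is the pullback of D and Y
  -- over C, a section of v yields the wanted section of q.
  have hl' : E.Conf (j ≫ d) v := by
    have := hc.mono
    refine hl.of_kernel _ (by rw [Category.assoc, hv, reassoc_of% hc.w, zero_comp])
      (fun t ht => ?_) ⟨fun x y hxy => ?_⟩
    · obtain ⟨s, hs⟩ := hc.exists_lift (sq'.lift 0 t (by simp [ht])) (by simp)
      exact ⟨s, by rw [reassoc_of% hs, sq'.lift_snd]⟩
    · rw [← cancel_mono j]
      apply sq'.hom_ext
      · simp [hc.w]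
      · simpa using hxy
  obtain ⟨s, hs⟩ := hE _ _ hl'.1 hl'.2
  have w : 𝟙 Y ≫ c = (c ≫ s) ≫ v := by simp [hs]
  refine ⟨⟨⟨sq'.lift (𝟙 Y) (c ≫ s) w ≫ a, ?_, ?_⟩⟩⟩
  · have : i ≫ sq'.lift (𝟙 Y) (c ≫ s) w = sq.lift f i sq₀.w := by
      apply sq'.hom_ext
      · simp
      · simp [hd.w, reassoc_of% hi.w]
    rw [reassoc_of% this, sq.lift_fst]
  · rw [Category.assoc, sq.w, sq'.lift_fst_assoc, Category.id_comp]

end ExactStructure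

end

section

/-! ### Injective objects and null maps -/

namespace ExactStructure

variable {A : Type u} [Category.{v} A] [Preadditive A] [HasZeroObject A] [HasBinaryBiproducts A]
  {E : ExactStructure A}

lemma injectives.exists_extension {I X Y Z : A} (hI : E.injectives I) {i : X ⟶ Y} {p : Y ⟶ Z}
    (h : E.Conf i p) (f : X ⟶ I) : ∃ g : Y ⟶ I, i ≫ g = f :=
  hI i ⟨Z, p, h.1, h.2, trivial⟩ f

lemma EnoughInjectives.exists_conf (hE : E.EnoughInjectives) (X : A) :
    ∃ (I C : A) (i : X ⟶ I) (p : I ⟶ C), E.injectives I ∧ E.Conf i p := by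
  obtain ⟨I, i, hI, C, p, w, h, -⟩ := hE X
  exact ⟨I, C, i, p, hI, w, h⟩

lemma injectives_zero : E.injectives (0 : A) :=
  fun _ _ _ _ _ => ⟨0, (isZero_zero A).eq_of_tgt _ _⟩

lemma injectives_biprod {I J : A} (hI : E.injectives I) (hJ : E.injectives J) :
    E.injectives (I ⊞ J) := fun X Y i hi f => by
  obtain ⟨a, ha⟩ := hI i hi (f ≫ biprod.fst)
  obtain ⟨b, hb⟩ := hJ i hi (f ≫ biprod.snd)
  exact ⟨biprod.lift a b, by ext <;> simp [ha, hb]⟩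

variable (E) in
/-- The map `f` factors through an injective object. -/
def Null {X Y : A} (f : X ⟶ Y) : Prop :=
  ∃ (I : A) (a : X ⟶ I) (b : I ⟶ Y), E.injectives I ∧ f = a ≫ b

namespace Null

variable {X Y Z : A}

lemma zero : E.Null (0 : X ⟶ Y) := ⟨0, 0, 0, injectives_zero, by simp⟩

lemma comp_left {f : Y ⟶ Z} (h : E.Null f) (g : X ⟶ Y) : E.Null (g ≫ f) := by
  obtain ⟨I, a, b, hI, rfl⟩ := h
  exact ⟨I, g ≫ a, b, hI, by simp⟩

lemma comp_right {f : X ⟶ Y} (h : E.Null f) (g : Y ⟶ Z) : E.Null (f ≫ g) := by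
  obtain ⟨I, a, b, hI, rfl⟩ := h
  exact ⟨I, a, b ≫ g, hI, by simp⟩

lemma neg {f : X ⟶ Y} (h : E.Null f) : E.Null (-f) := by
  obtain ⟨I, a, b, hI, rfl⟩ := h
  exact ⟨I, a, -b, hI, by simp⟩

lemma add {f g : X ⟶ Y} (hf : E.Null f) (hg : E.Null g) : E.Null (f + g) := by
  obtain ⟨I, a, b, hI, rfl⟩ := hf
  obtain ⟨J, c, d, hJ, rfl⟩ := hg
  exact ⟨I ⊞ J, biprod.lift a c, biprod.desc b d, injectives_biprod hI hJ, by simp⟩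

lemma of_injective_left (hX : E.injectives X) (f : X ⟶ Y) : E.Null f := ⟨X, 𝟙 X, f, hX, by simp⟩

/-- A retract up to null maps belongs to each class which is stable under retracts and under sums
with injective objects. -/
lemma prop_of_retract {P : ObjectProperty A} [P.IsStableUnderRetracts] {s : X ⟶ Y} {r : Y ⟶ X}
    (h : E.Null (𝟙 X - s ≫ r)) (hP : ∀ I, E.injectives I → P (Y ⊞ I)) : P X := by
  obtain ⟨I, a, b, hI, h⟩ := h
  refine P.prop_of_retract (⟨biprod.lift s a, biprod.desc r b, ?_⟩ : Retract X (Y ⊞ I)) (hP I hI)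
  rw [biprod.lift_desc, ← h]
  abel

end Null

/-! ### Injective cotorsion pairs -/

namespace InjectiveCotorsionPair

variable (M : E.InjectiveCotorsionPair)

lemma ext {X Y : A} (hX : M.W X) (hY : M.F Y) : E.ExtVanishes X Y :=
  (M.complete.right_iff Y).1 hY X hX

instance : M.W.IsStableUnderRetracts := M.thick.retract

variable {M}

lemma W_of_injectives {I : A} (h : E.injectives I) : M.W I := by
  rw [← M.inter] at h; exact h.1

lemma F_of_injectives {I : A} (h : E.injectives I) : M.F I := by
  rw [← M.inter] at h; exact h.2

lemma injectives_of {I : A} (h : M.W I) (h' : M.F I) : E.injectives I := by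
  rw [← M.inter]; exact ⟨h, h'⟩

lemma W_left {X Y Z : A} {i : X ⟶ Y} {p : Y ⟶ Z} (h : E.Conf i p) (hY : M.W Y) (hZ : M.W Z) :
    M.W X := M.thick.left h.2 hY hZ

lemma W_middle {X Y Z : A} {i : X ⟶ Y} {p : Y ⟶ Z} (h : E.Conf i p) (hX : M.W X) (hZ : M.W Z) :
    M.W Y := M.thick.middle h.2 hX hZ

lemma W_right {X Y Z : A} {i : X ⟶ Y} {p : Y ⟶ Z} (h : E.Conf i p) (hX : M.W X) (hY : M.W Y) :
    M.W Z := M.thick.right h.2 hX hY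

lemma W_biprod {X Y : A} (hX : M.W X) (hY : M.W Y) : M.W (X ⊞ Y) :=
  W_middle (Conf.inl_snd (E := E) X Y) hX hY

instance : M.F.IsStableUnderRetracts := ⟨fun {X Y} r hY => by
  rw [M.complete.right_iff]
  intro C hC
  refine extVanishes_of_retraction fun i p h => ?_
  obtain ⟨g, hg⟩ := (M.ext hC hY).exists_extension h r.i
  exact ⟨g ≫ r.r, by rw [reassoc_of% hg, r.retract]⟩⟩

/-- An extension of C by Y is split in two stages: p extends to the middle term because Z is
orthogonal to C, and the identity of Y then lifts against p because the kernel X is. -/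
lemma F_middle (hA : WeaklyIdempotentComplete A) {X Y Z : A} {i : X ⟶ Y} {p : Y ⟶ Z}
    (h : E.Conf i p) (hX : M.F X) (hZ : M.F Z) : M.F Y := by
  rw [M.complete.right_iff]
  intro C hC
  refine extVanishes_of_retraction fun j q h' => ?_
  obtain ⟨g, hg⟩ := (M.ext hC hZ).exists_extension h' p
  have := (M.ext hC hX).hasLiftingProperty hA h' h
  have sq : CommSq (𝟙 Y) j p g := ⟨by rw [Category.id_comp, hg]⟩
  exact ⟨sq.lift, sq.fac_left⟩

lemma F_biprod (hA : WeaklyIdempotentComplete A) {X Y : A} (hX : M.F X) (hY : M.F Y) :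
    M.F (X ⊞ Y) := F_middle hA (Conf.inl_snd (E := E) X Y) hX hY

variable (M)

lemma exists_preenvelope (X : A) : ∃ (R C : A) (j : X ⟶ R) (q : R ⟶ C),
    M.F R ∧ M.W C ∧ E.Conf j q := by
  obtain ⟨R, j, hR, C, q, w, h, hC⟩ := M.complete.preenvelope X
  exact ⟨R, C, j, q, hR, hC, w, h⟩

lemma exists_precover (X : A) : ∃ (K C : A) (k : K ⟶ C) (q : C ⟶ X),
    M.F K ∧ M.W C ∧ E.Conf k q := by
  obtain ⟨C, q, hC, K, k, w, h, hK⟩ := M.complete.precover X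
  exact ⟨K, C, k, q, hK, hC, w, h⟩

variable {M}

/-- The source of the precover is in W, and in F as an extension of X by K, hence injective.
Together with `ext` this makes the ambient injectives the projective objects of F, with enough of
them: F is Frobenius. -/
lemma exists_injective_cover (hA : WeaklyIdempotentComplete A) {X : A} (hX : M.F X) :
    ∃ (K I : A) (k : K ⟶ I) (q : I ⟶ X), M.F K ∧ E.injectives I ∧ E.Conf k q := by
  obtain ⟨K, I, k, q, hK, hI, h⟩ := M.exists_precover X
  exact ⟨K, I, k, q, hK, injectives_of hI (F_middle hA h hK hX), h⟩

/-- Maps from `W` to `F` factor through injective objects. -/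
lemma null_of_W_F (hA : WeaklyIdempotentComplete A) {X Y : A} (hX : M.W X) (hY : M.F Y)
    (f : X ⟶ Y) : E.Null f := by
  obtain ⟨K, I, k, q, hK, hI, h⟩ := exists_injective_cover hA hY
  obtain ⟨g, hg⟩ := (M.ext hX hK).exists_lift h f
  exact ⟨I, g, q, hI, hg.symm⟩

/-- The class `F` is closed under cokernels of inflations. -/
lemma F_right (hA : WeaklyIdempotentComplete A) {X Y Z : A} {i : X ⟶ Y} {p : Y ⟶ Z}
    (h : E.Conf i p) (hX : M.F X) (hY : M.F Y) : M.F Z := by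
  obtain ⟨K, V, k, π, hK, hV, hkπ⟩ := M.exists_precover Z
  -- The pullback of Y and V over Z is an extension of V by X, which splits, and an extension of Y
  -- by K, which is in F. So V is in F, a fact that does not presuppose that Z is.
  have hV' : M.F V := by
    obtain ⟨P, g, q, j, j', -, -, -, hj, hj'⟩ := h.exists_pullback₂ hkπ
    obtain ⟨s, hs⟩ := M.ext hV hX _ _ hj.1 hj.2
    exact M.F.prop_of_retract ⟨s, q, hs⟩ (F_middle hA hj' hK hY)
  obtain ⟨R, C, j, q, hR, hC, hjq⟩ := M.exists_preenvelope Z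
  obtain ⟨K₁, I₁, k₁, π₁, hK₁, hI₁, h₁⟩ := exists_injective_cover hA hR
  -- B is the kernel of the composite I₁ ⟶ R ⟶ C and an extension of Z by K₁. It is in W by
  -- thickness, and in F by the same pullback argument, now using V. So B is injective, B ⟶ I₁
  -- splits, and so does Z ⟶ R.
  obtain ⟨B, r, a, b, hr, hab, -, hrb⟩ := h₁.noether_kernel hjq
  have hB : M.W B := W_left hr (W_of_injectives hI₁) hC
  have hB' : M.F B := by
    obtain ⟨P, g', q', j₁, j₂, -, -, -, hj, hj'⟩ := hkπ.exists_pullback₂ hab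
    obtain ⟨s, hs⟩ := M.ext hB hK _ _ hj.1 hj.2
    exact M.F.prop_of_retract ⟨s, q', hs⟩ (F_middle hA hj' hK₁ hV')
  obtain ⟨t, ht⟩ := (injectives_of hB hB').exists_extension hr (𝟙 B)
  obtain ⟨s, hs, -⟩ := hr.exists_section t ht
  obtain ⟨u, hu, -⟩ := hjq.exists_retraction (s ≫ π₁) (by simpa using hs)
  exact M.F.prop_of_retract ⟨j, u, hu⟩ hR

/-- For `F' ⊆ F`, the class `F'` is closed under kernels, in `F`, of deflations. -/
lemma F_left (hA : WeaklyIdempotentComplete A) {M' : E.InjectiveCotorsionPair}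
    {X Y Z : A} {i : X ⟶ Y} {p : Y ⟶ Z}
    (h : E.Conf i p) (hX : M.F X) (hY : M'.F Y) (hZ : M'.F Z) : M'.F X := by
  obtain ⟨K, I, k, q, hK, hI, hkq⟩ := exists_injective_cover hA hZ
  obtain ⟨P, g', q', j₁, j₂, -, -, -, hj, hj'⟩ := h.exists_pullback₂ hkq
  -- The splitting uses that I is in W and X is in F; an injective object need not be projective in
  -- the ambient category.
  obtain ⟨s, hs⟩ := M.ext (W_of_injectives hI) hX _ _ hj.1 hj.2
  obtain ⟨r, hr, -⟩ := hj.exists_retraction s hs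
  exact M'.F.prop_of_retract ⟨j₁, r, hr⟩ (F_middle hA hj' hK hY)

lemma F_of_null (hA : WeaklyIdempotentComplete A) {X Y : A} {s : X ⟶ Y} {r : Y ⟶ X}
    (h : E.Null (𝟙 X - s ≫ r)) (hY : M.F Y) : M.F X :=
  h.prop_of_retract fun _ hI => F_biprod hA hY (F_of_injectives hI)

lemma W_of_null {X Y : A} {s : X ⟶ Y} {r : Y ⟶ X}
    (h : E.Null (𝟙 X - s ≫ r)) (hY : M.W Y) : M.W X :=
  h.prop_of_retract fun _ hI => W_biprod hY (W_of_injectives hI)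

lemma W_le {M' : E.InjectiveCotorsionPair} (h : M'.F ≤ M.F) : M.W ≤ M'.W := fun X hX => by
  rw [M'.complete.left_iff]
  exact fun Y hY => M.ext hX (h _ hY)

/-- Two extensions to a special preenvelope differ by a null map. -/
lemma null_sub_of_conf (hA : WeaklyIdempotentComplete A) {X R C Y : A} {j : X ⟶ R} {q : R ⟶ C}
    (h : E.Conf j q) (hC : M.W C) (hY : M.F Y) (f : R ⟶ Y) (hf : E.Null (j ≫ f)) :
    E.Null f := by
  obtain ⟨I, a, b, hI, hab⟩ := hf
  obtain ⟨c, hc⟩ := hI.exists_extension h a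
  obtain ⟨t, ht⟩ := h.exists_desc (f - c ≫ b) (by
    rw [Preadditive.comp_sub, reassoc_of% hc, hab, sub_self])
  have h₂ : E.Null (f - c ≫ b) := ht ▸ (null_of_W_F hA hC hY t).comp_left q
  simpa using h₂.add (⟨I, c, b, hI, rfl⟩ : E.Null (c ≫ b))

/-- Two lifts to a special precover differ by a null map. -/
lemma null_of_comp_precover (hA : WeaklyIdempotentComplete A) {K C X Z : A} {k : K ⟶ C} {q : C ⟶ X}
    (h : E.Conf k q) (hK : M.F K) (hZ : M.W Z) (f : Z ⟶ C) (hf : E.Null (f ≫ q)) :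
    E.Null f := by
  obtain ⟨I, a, b, hI, hab⟩ := hf
  obtain ⟨c, hc⟩ := (M.ext (W_of_injectives hI) hK).exists_lift h b
  obtain ⟨t, ht⟩ := h.exists_lift (f - a ≫ c) (by
    rw [Preadditive.sub_comp, Category.assoc, hc, hab, sub_self])
  have h₂ : E.Null (f - a ≫ c) := ht ▸ (null_of_W_F hA hZ hK t).comp_right k
  simpa using h₂.add (⟨I, a, c, hI, rfl⟩ : E.Null (a ≫ c))

/-- The horseshoe lemma for special preenvelopes. -/
lemma horseshoe (hA : WeaklyIdempotentComplete A) (M : E.InjectiveCotorsionPair)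
    {X Y Z : A} {i : X ⟶ Y} {p : Y ⟶ Z} (h : E.Conf i p) :
    ∃ (X' Y' Z' : A) (i' : X' ⟶ Y') (p' : Y' ⟶ Z') (a : X ⟶ X') (b : Y ⟶ Y') (c : Z ⟶ Z'),
      E.Conf i' p' ∧ a ≫ i' = i ≫ b ∧ b ≫ p' = p ≫ c ∧ M.IsSpecialPreenvelope a ∧
      M.IsSpecialPreenvelope b ∧ M.IsSpecialPreenvelope c := by
  obtain ⟨X', C, a, c, hX', hC, hac⟩ := M.exists_preenvelope X
  -- The pushout P replaces the first term by X', and Y' is a preenvelope of P. Then Z' = Y'/X' is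
  -- in F by `F_right`, and Z ⟶ Z' has the same cokernel D as P ⟶ Y'.
  obtain ⟨P, g, j, q, q', sq, hq, hq', hj, hg⟩ := h.exists_pushout₂ hac
  obtain ⟨Y', D, t, d, hY', hD, htd⟩ := M.exists_preenvelope P
  obtain ⟨Z', r, u, v, hr, huv, hqu, hrv⟩ := hj.noether htd
  obtain ⟨D', r', u', v', hr', huv', -, -⟩ := hg.noether htd
  refine ⟨X', Y', Z', j ≫ t, r, a, g ≫ t, u, hr, ?_, ?_, ⟨hX', monoWithCokernel_iff.2 ⟨_, _, hac, hC⟩⟩,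
    ⟨hY', monoWithCokernel_iff.2 ⟨_, _, hr', W_middle huv' hC hD⟩⟩,
    ⟨F_right hA hr hX' hY', monoWithCokernel_iff.2 ⟨_, _, huv, hD⟩⟩⟩
  · rw [sq.w_assoc]
  · rw [Category.assoc, hqu.w, reassoc_of% hq]

/-! ### Right localizations -/

/-- The special preenvelopes of a retract of an object having one in `F'` are in `F'`. -/
lemma F_of_preenvelope_retract (hA : WeaklyIdempotentComplete A) {M' : E.InjectiveCotorsionPair}
    {X Y R R' : A} {j : X ⟶ R} {j' : Y ⟶ R'} (hj : M.IsSpecialPreenvelope j)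
    (hj' : M.IsSpecialPreenvelope j') (e : Retract X Y) (h : M'.F R') : M'.F R := by
  obtain ⟨hR, C, q, w, hq, hC⟩ := hj
  obtain ⟨hR', C', q', w', hq', hC'⟩ := hj'
  obtain ⟨s, hs⟩ := (M.ext hC hR').exists_extension ⟨w, hq⟩ (e.i ≫ j')
  obtain ⟨r, hr⟩ := (M.ext hC' hR).exists_extension ⟨w', hq'⟩ (e.r ≫ j)
  refine F_of_null hA (s := s) (r := r) ?_ h
  refine null_sub_of_conf hA (⟨w, hq⟩ : E.Conf j q) hC hR _ ?_
  rw [Preadditive.comp_sub, reassoc_of% hs, hr, e.retract_assoc]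
  simpa using Null.zero

/-- Any two special preenvelopes of X are stably isomorphic and F' is closed under stable
isomorphism, so triviality can be tested on any one of them. Thickness of the trivial class thereby
becomes a statement on conflations in F. -/
lemma rightLocalization_trivial_iff (hA : WeaklyIdempotentComplete A)
    {M' : E.InjectiveCotorsionPair} (h : M'.F ≤ M.F) {X R : A} {j : X ⟶ R}
    (hj : M.IsSpecialPreenvelope j) : (M.rightLocalization M').trivial X ↔ M'.F R :=
  ⟨fun ⟨_, _, hR', hj'⟩ => F_of_preenvelope_retract hA hj ⟨h _ hR', hj'⟩ (Retract.refl X) hR',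
    fun hR => ⟨R, j, hR, hj.2⟩⟩

lemma isSpecialPreenvelope_id {X : A} (hX : M.F X) : M.IsSpecialPreenvelope (𝟙 X) :=
  ⟨hX, monoWithCokernel_iff.2 ⟨_, _, Conf.id_zero X, W_of_injectives injectives_zero⟩⟩

lemma isThick_rightLocalization (hA : WeaklyIdempotentComplete A)
    {M' : E.InjectiveCotorsionPair} (h : M'.F ≤ M.F) :
    E.IsThick (M.rightLocalization M').trivial where
  retract := ⟨fun {X Y} e hY => by
    obtain ⟨R, C, j, q, hR, hC, hj⟩ := M.exists_preenvelope X
    obtain ⟨R', C', j', q', hR', hC', hj'⟩ := M.exists_preenvelope Y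
    have hj := (⟨hR, monoWithCokernel_iff.2 ⟨_, _, hj, hC⟩⟩ : M.IsSpecialPreenvelope j)
    have hj' := (⟨hR', monoWithCokernel_iff.2 ⟨_, _, hj', hC'⟩⟩ : M.IsSpecialPreenvelope j')
    rw [rightLocalization_trivial_iff hA h hj'] at hY
    rw [rightLocalization_trivial_iff hA h hj]
    exact F_of_preenvelope_retract hA hj hj' e hY⟩
  left {S} hS h₂ h₃ := by
    obtain ⟨X', Y', Z', i', p', a, b, c, hc, -, -, ha, hb, hc'⟩ := M.horseshoe hA ⟨S.zero, hS⟩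
    rw [rightLocalization_trivial_iff hA h ha]
    rw [rightLocalization_trivial_iff hA h hb] at h₂
    rw [rightLocalization_trivial_iff hA h hc'] at h₃
    exact F_left hA hc ha.1 h₂ h₃
  middle {S} hS h₁ h₃ := by
    obtain ⟨X', Y', Z', i', p', a, b, c, hc, -, -, ha, hb, hc'⟩ := M.horseshoe hA ⟨S.zero, hS⟩
    rw [rightLocalization_trivial_iff hA h ha] at h₁
    rw [rightLocalization_trivial_iff hA h hb]
    rw [rightLocalization_trivial_iff hA h hc'] at h₃
    exact F_middle hA hc h₁ h₃
  right {S} hS h₁ h₂ := by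
    obtain ⟨X', Y', Z', i', p', a, b, c, hc, -, -, ha, hb, hc'⟩ := M.horseshoe hA ⟨S.zero, hS⟩
    rw [rightLocalization_trivial_iff hA h ha] at h₁
    rw [rightLocalization_trivial_iff hA h hb] at h₂
    rw [rightLocalization_trivial_iff hA h hc']
    exact F_right hA hc h₁ h₂

lemma fibrant_inf_trivial_rightLocalization (hA : WeaklyIdempotentComplete A)
    {M' : E.InjectiveCotorsionPair} (h : M'.F ≤ M.F) :
    M.F ⊓ (M.rightLocalization M').trivial = M'.F := by
  ext X
  refine ⟨fun ⟨hX, hX'⟩ => ?_, fun hX => ⟨h _ hX, ?_⟩⟩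
  · rwa [rightLocalization_trivial_iff hA h (isSpecialPreenvelope_id hX)] at hX'
  · rwa [rightLocalization_trivial_iff hA h (isSpecialPreenvelope_id (h _ hX))]

lemma cofibrant_inf_trivial_rightLocalization
    {M' : E.InjectiveCotorsionPair} (h : M'.F ≤ M.F) :
    M'.W ⊓ (M.rightLocalization M').trivial = M.W := by
  ext X
  refine ⟨fun ⟨hX, R, j, hR, C, q, w, hq, hC⟩ => ?_, fun hX => ⟨W_le h _ hX, ?_⟩⟩
  · have hq : E.Conf j q := ⟨w, hq⟩
    -- R is an extension of C by X, both in W', so it lies in W' ∩ F' and is injective. Hence R is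
    -- in W, and so is X.
    exact W_left hq (W_of_injectives (injectives_of (W_middle hq hX (W_le h _ hC)) hR)) hC
  · obtain ⟨R, C, j, q, hR, hC, hj⟩ := M.exists_preenvelope X
    exact ⟨R, j, F_of_injectives (injectives_of (W_middle hj hX hC) hR),
      monoWithCokernel_iff.2 ⟨_, _, hj, hC⟩⟩

/-- The right localization is a Hovey triple. -/
lemma isHoveyTriple_rightLocalization (hA : WeaklyIdempotentComplete A)
    {M' : E.InjectiveCotorsionPair} (h : M'.F ≤ M.F) :
    E.IsHoveyTriple (M.rightLocalization M') where
  thick := isThick_rightLocalization hA h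
  pair_cof := by
    have := fibrant_inf_trivial_rightLocalization hA h
    change E.IsCompleteCotorsionPair M'.W (M.F ⊓ (M.rightLocalization M').trivial)
    rw [this]
    exact M'.complete
  pair_trivialCof := by
    have := cofibrant_inf_trivial_rightLocalization h
    change E.IsCompleteCotorsionPair (M'.W ⊓ (M.rightLocalization M').trivial) M.F
    rw [this]
    exact M.complete

/-- An injective cotorsion pair is a Hovey triple. -/
lemma isHoveyTriple_triple (hE : E.EnoughInjectives) (M : E.InjectiveCotorsionPair) :
    E.IsHoveyTriple M.triple where
  thick := M.thick
  pair_cof := by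
    have : M.triple.fibrant ⊓ M.triple.trivial = E.injectives := by
      rw [← M.inter, inf_comm]; rfl
    rw [this]
    refine ⟨fun Y => ⟨fun hY X _ => extVanishes_of_retraction fun i p h =>
        hY.exists_extension h (𝟙 Y), fun h X Y' i hi f => ?_⟩,
      fun X => ⟨fun _ Y hY => extVanishes_of_retraction fun i p h =>
        hY.exists_extension h (𝟙 Y), fun _ => trivial⟩, fun X => ?_, fun X => ?_⟩
    · obtain ⟨C, p, hp, -⟩ := monoWithCokernel_iff.1 hi
      exact (h C trivial).exists_extension hp f
    · obtain ⟨I, C, i, p, hI, hi⟩ := hE.exists_conf X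
      exact ⟨I, i, hI, monoWithCokernel_iff.2 ⟨C, p, hi, trivial⟩⟩
    · exact ⟨X, 𝟙 X, trivial, epiWithKernel_iff.2 ⟨_, _, Conf.zero_id X, injectives_zero⟩⟩
  pair_trivialCof := by
    have : M.triple.cofibrant ⊓ M.triple.trivial = M.W := top_inf_eq _
    rw [this]
    exact M.complete

/-! ### The recollement conditions -/

section

variable {M₁ M₂ M₃ : E.InjectiveCotorsionPair} (h₂₁ : M₂.F ≤ M₁.F) (h₃₁ : M₃.F ≤ M₁.F)

-- The M₁-preenvelope of an object of W₂ ∩ W₃ lies in W₃ ∩ F₁ = F₂ and in W₂, hence is injective.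
include h₂₁ h₃₁ in
lemma W_inf_W_eq (h : M₃.W ⊓ M₁.F = M₂.F) : M₂.W ⊓ M₃.W = M₁.W := by
  ext X
  refine ⟨fun ⟨h₂, h₃⟩ => ?_, fun hX => ⟨W_le h₂₁ _ hX, W_le h₃₁ _ hX⟩⟩
  obtain ⟨R, C, j, q, hR, hC, hj⟩ := M₁.exists_preenvelope X
  have hR' : M₂.F R := by
    rw [← h]; exact ⟨W_middle hj h₃ (W_le h₃₁ _ hC), hR⟩
  exact W_left hj (W_of_injectives (injectives_of (W_middle hj h₂ (W_le h₂₁ _ hC)) hR')) hC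

lemma F_le_W (h : M₃.W ⊓ M₁.F = M₂.F) : M₂.F ≤ M₃.W := fun X hX => by
  rw [← h] at hX; exact hX.1

-- For the converse, the M₂-preenvelope of an object X of W₃ ∩ F₁ has cokernel in W₂ ∩ W₃ = W₁. It
-- therefore splits, as X is in F₁, and X is a retract of an object of F₂.
include h₂₁ h₃₁ in
lemma W_inf_F_eq_iff :
    M₃.W ⊓ M₁.F = M₂.F ↔ M₂.W ⊓ M₃.W = M₁.W ∧ M₂.F ≤ M₃.W := by
  refine ⟨fun h => ⟨W_inf_W_eq h₂₁ h₃₁ h, F_le_W h⟩, fun ⟨h, h'⟩ => ?_⟩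
  ext X
  refine ⟨fun ⟨h₃, h₁⟩ => ?_, fun hX => ⟨h' _ hX, h₂₁ _ hX⟩⟩
  obtain ⟨R, C, j, q, hR, hC, hj⟩ := M₂.exists_preenvelope X
  have hC' : M₁.W C := by
    rw [← h]; exact ⟨hC, W_right hj h₃ (h' _ hR)⟩
  obtain ⟨s, hs⟩ := M₁.ext hC' h₁ _ _ hj.1 hj.2
  obtain ⟨r, hr, -⟩ := hj.exists_retraction s hs
  exact M₂.F.prop_of_retract ⟨j, r, hr⟩ hR

-- X and its M₁-preenvelope R differ by an object of W₁ ⊆ W₃. So X is in W₃ iff R is in W₃ ∩ F₁ =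
-- F₂.
include h₂₁ h₃₁ in
lemma trivial_rightLocalization_eq (hA : WeaklyIdempotentComplete A)
    (h : M₃.W ⊓ M₁.F = M₂.F) : (M₁.rightLocalization M₂).trivial = M₃.W := by
  ext X
  obtain ⟨R, C, j, q, hR, hC, hj⟩ := M₁.exists_preenvelope X
  rw [rightLocalization_trivial_iff hA h₂₁
    (⟨hR, monoWithCokernel_iff.2 ⟨_, _, hj, hC⟩⟩ : M₁.IsSpecialPreenvelope j)]
  refine ⟨fun hR' => W_left hj (F_le_W h _ hR') (W_le h₃₁ _ hC), fun hX => ?_⟩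
  rw [← h]
  exact ⟨W_middle hj hX (W_le h₃₁ _ hC), hR⟩

end

end InjectiveCotorsionPair

end ExactStructure

end

section

/-! ### Cones and the model structure of a Hovey triple -/

namespace ExactStructure

variable {A : Type u} [Category.{v} A] [Preadditive A] [HasZeroObject A] [HasBinaryBiproducts A]
  {E : ExactStructure A}

variable (E) in
/-- The map `f` has a cone in `W`, the cone being the cokernel of an inflation `X ⟶ I ⊞ Y` with `I`
injective and second component `f`. -/
def HasConeIn (W : ObjectProperty A) {X Y : A} (f : X ⟶ Y) : Prop :=
  ∃ (I C : A) (m : X ⟶ I ⊞ Y) (q : I ⊞ Y ⟶ C),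
    E.injectives I ∧ m ≫ biprod.snd = f ∧ E.Conf m q ∧ W C

lemma EnoughInjectives.exists_cone (hE : E.EnoughInjectives) {X Y : A} (f : X ⟶ Y) :
    ∃ (I C : A) (m : X ⟶ I ⊞ Y) (q : I ⊞ Y ⟶ C),
      E.injectives I ∧ m ≫ biprod.snd = f ∧ E.Conf m q := by
  obtain ⟨I, D, i, p, hI, h⟩ := hE.exists_conf X
  obtain ⟨C, q, hq⟩ := h.exists_lift_conf f
  refine ⟨I, C, biprod.lift i f, (biprod.braiding I Y).hom ≫ q, hI, by simp, ?_⟩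
  exact hq.of_iso (Iso.refl _) (biprod.braiding Y I) (Iso.refl _) (by ext <;> simp)
    (by ext <;> simp)

/-- Cones of retracts are retracts up to injective objects. -/
lemma cone_of_retract {W : ObjectProperty A} (hW : E.IsThick W) (hI : E.injectives ≤ W)
    {X Y X' Y' : A} {f : X ⟶ Y} {f' : X' ⟶ Y'} {s₁ : X ⟶ X'} {s₂ : Y ⟶ Y'} {r₁ : X' ⟶ X}
    {r₂ : Y' ⟶ Y} (hs : f ≫ s₂ = s₁ ≫ f') (hr : f' ≫ r₂ = r₁ ≫ f) (h₁ : s₁ ≫ r₁ = 𝟙 X)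
    (h₂ : s₂ ≫ r₂ = 𝟙 Y) {I C I' C' : A}
    {m : X ⟶ I ⊞ Y} {q : I ⊞ Y ⟶ C} {m' : X' ⟶ I' ⊞ Y'} {q' : I' ⊞ Y' ⟶ C'}
    (hI₀ : E.injectives I) (hI₁ : E.injectives I') (hm : m ≫ biprod.snd = f)
    (hm' : m' ≫ biprod.snd = f')
    (h : E.Conf m q) (h' : E.Conf m' q') (hC : W C') : W C := by
  -- A commutative square induces a map of cones, by injectivity of I'. It is not unique, but the
  -- second component of b is controlled by v.
  have key : ∀ {X Y X' Y' : A} {f : X ⟶ Y} {f' : X' ⟶ Y'} (u : X ⟶ X') (v : Y ⟶ Y')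
      {I C I' C' : A} {m : X ⟶ I ⊞ Y} {q : I ⊞ Y ⟶ C} {m' : X' ⟶ I' ⊞ Y'} {q' : I' ⊞ Y' ⟶ C'},
      E.injectives I' → m ≫ biprod.snd = f → m' ≫ biprod.snd = f' → E.Conf m q →
      E.Conf m' q' → f ≫ v = u ≫ f' → ∃ (b : I ⊞ Y ⟶ I' ⊞ Y') (c : C ⟶ C'),
        m ≫ b = u ≫ m' ∧ q ≫ c = b ≫ q' ∧ b ≫ biprod.snd = biprod.snd ≫ v := by
    intro X Y X' Y' f f' u v I C I' C' m q m' q' hI' hm hm' h h' huv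
    obtain ⟨a, ha⟩ := hI'.exists_extension h (u ≫ m' ≫ biprod.fst)
    have hb : m ≫ biprod.lift a (biprod.snd ≫ v) = u ≫ m' := by
      ext
      · simp [ha]
      · simp [reassoc_of% hm, hm', huv]
    obtain ⟨c, hc⟩ := h.exists_desc (biprod.lift a (biprod.snd ≫ v) ≫ q') (by
      rw [reassoc_of% hb, h'.w, comp_zero])
    exact ⟨_, c, hb, hc, by simp⟩
  obtain ⟨b, c, hb, hc, hb'⟩ := key s₁ s₂ hI₁ hm hm' h h' hs
  obtain ⟨b', c', hb₂, hc₂, hb₂'⟩ := key r₁ r₂ hI₀ hm' hm h' h hr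
  have hW' := hW.retract
  refine Null.prop_of_retract (E := E) (P := W) (s := c) (r := c') ?_
    (fun J hJ => hW.middle (E.split C' J) hC (hI _ hJ))
  -- The composite of the two maps of cones need not be the identity of C; the defect is t ≫ q.
  -- Since t has zero component in Y, the defect factors through I.
  obtain ⟨t, ht⟩ := h.exists_desc (𝟙 _ - b ≫ b') (by
    rw [Preadditive.comp_sub, reassoc_of% hb, hb₂, reassoc_of% h₁]
    simp)
  have := h.epi
  refine ⟨I, t ≫ biprod.fst, biprod.inl ≫ q, hI₀, ?_⟩
  have ht' : t ≫ biprod.snd = 0 := by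
    rw [← cancel_epi q, reassoc_of% ht, Preadditive.sub_comp, Category.assoc, hb₂',
      reassoc_of% hb', h₂]
    simp
  have ht₂ : t = (t ≫ biprod.fst) ≫ biprod.inl := by ext <;> simp [ht']
  rw [← Category.assoc, ← ht₂, ← cancel_epi q, reassoc_of% ht]
  simp [reassoc_of% hc, hc₂]

section

variable {W : ObjectProperty A} (hW : E.IsThick W) (hI : E.injectives ≤ W)

-- Membership of the cone in W does not depend on the choices: f is a retract of itself, whatever
-- the two cones are.
include hW hI in
lemma HasConeIn.prop {X Y : A} {f : X ⟶ Y} (hf : E.HasConeIn W f) {I C : A} {m : X ⟶ I ⊞ Y}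
    {q : I ⊞ Y ⟶ C} (hI₀ : E.injectives I) (hm : m ≫ biprod.snd = f) (h : E.Conf m q) : W C := by
  obtain ⟨I', C', m', q', hI', hm', hc, hC⟩ := hf
  exact cone_of_retract hW hI (f := f) (f' := f) (s₁ := 𝟙 X) (s₂ := 𝟙 Y) (r₁ := 𝟙 X)
    (r₂ := 𝟙 Y) (by simp) (by simp) (by simp) (by simp) hI₀ hI' hm hm' h hc hC

/-- The cone of a composition is an extension of the cones. -/
lemma cone_comp {X Y Z : A} {f : X ⟶ Y} {g : Y ⟶ Z} {I C J D : A} {m : X ⟶ I ⊞ Y}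
    {q : I ⊞ Y ⟶ C} {n : Y ⟶ J ⊞ Z} {r : J ⊞ Z ⟶ D} (hI₀ : E.injectives I)
    (hJ₀ : E.injectives J) (hm : m ≫ biprod.snd = f) (hn : n ≫ biprod.snd = g)
    (h : E.Conf m q) (h' : E.Conf n r) :
    ∃ (K B : A) (k : X ⟶ K ⊞ Z) (s : K ⊞ Z ⟶ B) (a : C ⟶ B) (b : B ⟶ D),
      E.injectives K ∧ k ≫ biprod.snd = f ≫ g ∧ E.Conf k s ∧ E.Conf a b := by
  -- Noether's isomorphism for X ⟶ I ⊞ Y ⟶ I ⊞ (J ⊞ Z); the second inflation has the same cokernel D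
  -- as n.
  obtain ⟨B, s, a, b, hs, hab, -, -⟩ := h.noether (h'.id_biprod_map I)
  let α : I ⊞ (J ⊞ Z) ≅ (I ⊞ J) ⊞ Z :=
    ⟨biprod.lift (biprod.map (𝟙 I) biprod.fst) (biprod.snd ≫ biprod.snd),
      biprod.lift (biprod.fst ≫ biprod.fst) (biprod.map biprod.snd (𝟙 Z)),
      by ext <;> simp, by ext <;> simp⟩
  refine ⟨I ⊞ J, B, (m ≫ biprod.map (𝟙 I) n) ≫ α.hom, α.inv ≫ s, a, b,
    injectives_biprod hI₀ hJ₀, ?_, ?_, hab⟩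
  · simp [α, hn, reassoc_of% hm]
  · exact hs.of_iso (Iso.refl _) α (Iso.refl _) (by simp) (by simp)

lemma hasConeIn_of_inflation {X Y C : A} {i : X ⟶ Y} {p : Y ⟶ C} (h : E.Conf i p) (hC : W C) :
    E.HasConeIn W i := by
  refine ⟨0, C, i ≫ biprod.inr, biprod.snd ≫ p, injectives_zero, by simp, ?_, hC⟩
  exact h.of_iso (Iso.refl _) ⟨biprod.inr, biprod.snd, by simp, by ext; simp⟩ (Iso.refl _)
    (by simp) (by simp)

include hW hI in
lemma hasConeIn_inflation_iff {X Y C : A} {i : X ⟶ Y} {p : Y ⟶ C} (h : E.Conf i p) :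
    E.HasConeIn W i ↔ W C := by
  refine ⟨fun hi => ?_, hasConeIn_of_inflation h⟩
  refine hi.prop hW hI (I := 0) (m := i ≫ biprod.inr) (q := biprod.snd ≫ p) injectives_zero
    (by simp) ?_
  exact h.of_iso (Iso.refl _) ⟨biprod.inr, biprod.snd, by simp, by ext; simp⟩ (Iso.refl _)
    (by simp) (by simp)

-- The cone of p is the pushout of an inflation X ⟶ I along p, which is I/K. It is in W with I and
-- K.
include hW hI in
lemma hasConeIn_of_deflation (hE : E.EnoughInjectives) {X Y K : A} {k : K ⟶ X} {p : X ⟶ Y}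
    (h : E.Conf k p) (hK : W K) : E.HasConeIn W p := by
  obtain ⟨I, D, i, d, hI₀, hi⟩ := hE.exists_conf X
  obtain ⟨B, r, a, b, hr, -, sq, -⟩ := h.noether hi
  have hq := hi.lift_desc_of_isPushout sq
  refine ⟨I, B, biprod.lift i p, (biprod.braiding I Y).hom ≫ biprod.desc a (-r), hI₀, by simp, ?_,
    hW.right hr.2 hK (hI _ hI₀)⟩
  exact hq.of_iso (Iso.refl _) (biprod.braiding Y I) (Iso.refl _) (by ext <;> simp)
    (by ext <;> simp)

include hW hI in
lemma hasTwoOutOfThree_hasConeIn (hE : E.EnoughInjectives) :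
    MorphismProperty.HasTwoOutOfThreeProperty
      (fun _ _ f => E.HasConeIn W f : MorphismProperty A) where
  comp_mem := by
    rintro X Y Z f g ⟨I, C, m, q, hI₀, hm, h, hC⟩ ⟨J, D, n, r, hJ₀, hn, h', hD⟩
    obtain ⟨K, B, k, s, a, b, hK, hk, hs, hab⟩ := cone_comp hI₀ hJ₀ hm hn h h'
    exact ⟨K, B, k, s, hK, hk, hs, hW.middle hab.2 hC hD⟩
  of_postcomp := by
    rintro X Y Z f g ⟨J, D, n, r, hJ₀, hn, h', hD⟩ hfg
    obtain ⟨I, C, m, q, hI₀, hm, h⟩ := hE.exists_cone f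
    obtain ⟨K, B, k, s, a, b, hK, hk, hs, hab⟩ := cone_comp hI₀ hJ₀ hm hn h h'
    exact ⟨I, C, m, q, hI₀, hm, h, hW.left hab.2 (hfg.prop hW hI hK hk hs) hD⟩
  of_precomp := by
    rintro X Y Z f g ⟨I, C, m, q, hI₀, hm, h, hC⟩ hfg
    obtain ⟨J, D, n, r, hJ₀, hn, h'⟩ := hE.exists_cone g
    obtain ⟨K, B, k, s, a, b, hK, hk, hs, hab⟩ := cone_comp hI₀ hJ₀ hm hn h h'
    exact ⟨J, D, n, r, hJ₀, hn, h', hW.right hab.2 hC (hfg.prop hW hI hK hk hs)⟩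

end

/-! #### Factorizations -/

namespace IsCompleteCotorsionPair

variable {C D : ObjectProperty A} (h : E.IsCompleteCotorsionPair C D)

include h

lemma isStableUnderRetracts_left : C.IsStableUnderRetracts := ⟨fun {X Y} e hY => by
  rw [h.left_iff]
  intro K hK Z i p w hc
  obtain ⟨s, hs⟩ := ((h.left_iff Y).1 hY K hK).exists_lift (⟨w, hc⟩ : E.Conf i p) e.r
  exact ⟨e.i ≫ s, by rw [Category.assoc, hs, e.retract]⟩⟩

lemma isStableUnderRetracts_right : D.IsStableUnderRetracts := ⟨fun {X Y} e hY => by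
  rw [h.right_iff]
  intro K hK
  refine extVanishes_of_retraction fun i p hc => ?_
  obtain ⟨s, hs⟩ := ((h.right_iff Y).1 hY K hK).exists_extension hc e.i
  exact ⟨s ≫ e.r, by rw [reassoc_of% hs, e.retract]⟩⟩

lemma left_middle (hA : WeaklyIdempotentComplete A) {X Y Z : A} {i : X ⟶ Y} {p : Y ⟶ Z}
    (hc : E.Conf i p) (hX : C X) (hZ : C Z) : C Y := by
  rw [h.left_iff]
  intro K hK U k q w hkq
  have hkq : E.Conf k q := ⟨w, hkq⟩
  obtain ⟨g, hg⟩ := ((h.left_iff X).1 hX K hK).exists_lift hkq i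
  have := ((h.left_iff Z).1 hZ K hK).hasLiftingProperty hA hc hkq
  have sq : CommSq g i q (𝟙 Y) := ⟨by rw [hg, Category.comp_id]⟩
  exact ⟨sq.lift, sq.fac_right⟩

/-- Each map is the composition of an inflation with cokernel in `C` and a deflation with kernel
in `D`. -/
lemma hasFactorization (hA : WeaklyIdempotentComplete A) :
    (E.monoWithCokernel C).HasFactorization (E.epiWithKernel D) := ⟨fun {X Y} f => by
  obtain ⟨V, q, hV, K, k, w, hkq, hK⟩ := h.precover Y
  -- P is X ⊞ V written as a pullback. It makes (f, q) : P ⟶ Y visibly a composite of deflations,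
  -- with kernel L. Pushing out along a preenvelope L ⟶ R changes the kernel to R, in D, while the
  -- cokernel of X becomes an extension of B by V, in C.
  obtain ⟨P, g, r, j, j', sq, hj, hj', hc, hc'⟩ :=
    (Conf.inl_snd (E := E) X Y).exists_pullback₂ (⟨w, hkq⟩ : E.Conf k q)
  have hf : E.Conf (biprod.lift (𝟙 X) (-f)) (biprod.desc f (𝟙 Y)) :=
    (Conf.inl_snd X Y).of_iso (Iso.refl _)
      ⟨biprod.fst ≫ biprod.lift (𝟙 X) (-f) + biprod.snd ≫ biprod.inr,
        biprod.fst ≫ biprod.lift (𝟙 X) f + biprod.snd ≫ biprod.inr,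
        by ext <;> simp, by ext <;> simp⟩ (Iso.refl _) (by ext <;> simp) (by ext <;> simp)
  obtain ⟨L, l, hl⟩ := hc'.comp_deflation hf
  obtain ⟨R, s, hR, B, b, w', hsb, hB⟩ := h.preenvelope L
  obtain ⟨Q, x, y, z, z', sq', hz, hz', hd, hd'⟩ :=
    hl.exists_pushout₂ (⟨w', hsb⟩ : E.Conf s b)
  obtain ⟨B', t, a, a', ht, haa', -, -⟩ := hc.noether hd'
  exact ⟨⟨Q, j ≫ x, z, by rw [Category.assoc, hz, reassoc_of% hj]; simp,
    monoWithCokernel_iff.2 ⟨_, _, ht, h.left_middle hA haa' hV hB⟩,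
    epiWithKernel_iff.2 ⟨_, _, hd, hR⟩⟩⟩⟩

end IsCompleteCotorsionPair

/-- A retract f followed by the split monomorphism on targets is a composite of inflations, because
split monomorphisms are inflations. Cancellation makes f an inflation, and its cokernel is a retract
of the given one. -/
lemma isStableUnderRetracts_monoWithCokernel (hA : WeaklyIdempotentComplete A)
    (P : ObjectProperty A) [P.IsStableUnderRetracts] :
    (E.monoWithCokernel P).IsStableUnderRetracts := ⟨fun {X Y X' Y'} f g e hg => by
  obtain ⟨C, p, hp, hC⟩ := monoWithCokernel_iff.1 hg
  obtain ⟨D, q, hq⟩ : ∃ (D : A) (q : Y ⟶ D), E.Conf f q := by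
    obtain ⟨K, k, hk⟩ : ∃ (K : A) (k : X' ⟶ K), E.Conf e.i.left k := by
      refine Conf.of_comp_inflation hA (j := e.r.left) (q := (0 : X ⟶ 0)) ?_
      rw [e.retract_left]
      exact Conf.id_zero X
    obtain ⟨B, b, hb⟩ := hk.comp_inflation hp
    rw [e.i_w] at hb
    exact Conf.of_comp_inflation hA hb
  refine monoWithCokernel_iff.2 ⟨D, q, hq, ?_⟩
  obtain ⟨s, hs⟩ := hq.exists_desc (e.i.right ≫ p) (by
    rw [← e.i_w_assoc, hp.w, comp_zero])
  obtain ⟨r, hr⟩ := hp.exists_desc (e.r.right ≫ q) (by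
    rw [← e.r_w_assoc, hq.w, comp_zero])
  have := hq.epi
  exact P.prop_of_retract ⟨s, r, by
    rw [← cancel_epi q, reassoc_of% hs, hr, e.retract_right_assoc, Category.comp_id]
    exact Category.id_comp q⟩ hC⟩

lemma isStableUnderRetracts_epiWithKernel (hA : WeaklyIdempotentComplete A)
    (P : ObjectProperty A) [P.IsStableUnderRetracts] :
    (E.epiWithKernel P).IsStableUnderRetracts := ⟨fun {X Y X' Y'} f g e hg => by
  obtain ⟨C, p, hp, hC⟩ := epiWithKernel_iff.1 hg
  obtain ⟨D, q, hq⟩ : ∃ (D : A) (q : D ⟶ X), E.Conf q f := by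
    obtain ⟨K, k, hk⟩ : ∃ (K : A) (k : K ⟶ Y'), E.Conf k e.r.right := by
      refine Conf.of_comp_deflation hA (i := e.i.right) (q := (0 : 0 ⟶ Y)) ?_
      rw [e.retract_right]
      exact Conf.zero_id Y
    obtain ⟨B, b, hb⟩ := hp.comp_deflation hk
    rw [← e.r_w] at hb
    exact Conf.of_comp_deflation hA hb
  refine epiWithKernel_iff.2 ⟨D, q, hq, ?_⟩
  obtain ⟨s, hs⟩ := hp.exists_lift (q ≫ e.i.left) (by
    rw [Category.assoc, e.i_w, reassoc_of% hq.w, zero_comp])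
  obtain ⟨r, hr⟩ := hq.exists_lift (p ≫ e.r.left) (by
    rw [Category.assoc, e.r_w, reassoc_of% hp.w, zero_comp])
  have := hq.mono
  exact P.prop_of_retract ⟨s, r, by
    rw [← cancel_mono q, Category.assoc, hr, reassoc_of% hs, e.retract_left]; simp⟩ hC⟩

namespace IsHoveyTriple

variable {T : ObjectTriple A} (hT : E.IsHoveyTriple T)

include hT

lemma injectives_le : E.injectives ≤ T.trivial := fun I hI =>
  ((hT.pair_cof.right_iff I).2 fun _ _ => extVanishes_of_retraction fun _ _ h =>
    hI.exists_extension h (𝟙 I)).2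

/-- The weak equivalences are the maps whose cone is trivial. -/
lemma weq_iff (hA : WeaklyIdempotentComplete A) (hE : E.EnoughInjectives) {X Y : A} (f : X ⟶ Y) :
    (E.model T).weq f ↔ E.HasConeIn T.trivial f := by
  have h23 := hasTwoOutOfThree_hasConeIn hT.thick hT.injectives_le hE
  constructor
  · rintro ⟨Z, i, p, hi, hp, rfl⟩
    obtain ⟨C, c, hc, hC⟩ := monoWithCokernel_iff.1 hi
    obtain ⟨K, k, hk, hK⟩ := epiWithKernel_iff.1 hp
    exact h23.comp_mem _ _ (hasConeIn_of_inflation hc hC.2)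
      (hasConeIn_of_deflation hT.thick hT.injectives_le hE hk hK.2)
  · intro hf
    -- The second factor already has a trivial kernel, so two-out-of-three for cones forces the
    -- cokernel of i to be trivial.
    obtain ⟨⟨Z, i, p, rfl, hi, hp⟩⟩ :=
      (hT.pair_cof.hasFactorization hA).nonempty_mapFactorizationData f
    obtain ⟨C, c, hc, hC⟩ := monoWithCokernel_iff.1 hi
    obtain ⟨K, k, hk, hK⟩ := epiWithKernel_iff.1 hp
    refine ⟨Z, i, p, monoWithCokernel_iff.2 ⟨C, c, hc, hC, ?_⟩, hp, rfl⟩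
    rw [← hasConeIn_inflation_iff hT.thick hT.injectives_le hc]
    exact h23.of_postcomp _ _ (hasConeIn_of_deflation hT.thick hT.injectives_le hE hk hK.2) hf

lemma weq_eq (hA : WeaklyIdempotentComplete A) (hE : E.EnoughInjectives) :
    (E.model T).weq = fun _ _ f => E.HasConeIn T.trivial f := by
  ext X Y f
  exact hT.weq_iff hA hE f

/-- Hovey's theorem: a Hovey triple yields a model structure. -/
theorem isModelStructure (hA : WeaklyIdempotentComplete A) (hE : E.EnoughInjectives) :
    (E.model T).IsModelStructure where
  two_out_of_three := by
    rw [hT.weq_eq hA hE]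
    exact hasTwoOutOfThree_hasConeIn hT.thick hT.injectives_le hE
  weq_retract := ⟨fun {X Y X' Y' f g} e hg => by
    rw [hT.weq_iff hA hE] at hg ⊢
    obtain ⟨I', C', m', q', hI', hm', h', hC⟩ := hg
    obtain ⟨I, C, m, q, hI, hm, h⟩ := hE.exists_cone f
    exact ⟨I, C, m, q, hI, hm, h,
      cone_of_retract hT.thick hT.injectives_le e.i_w.symm e.r_w.symm
        e.retract_left e.retract_right hI hI' hm hm' h h' hC⟩⟩
  fib_retract :=
    have := hT.pair_trivialCof.isStableUnderRetracts_right
    isStableUnderRetracts_epiWithKernel hA _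
  cof_retract :=
    have := hT.pair_cof.isStableUnderRetracts_left
    isStableUnderRetracts_monoWithCokernel hA _
  lift_trivial_cof i p hi hi' hp := by
    obtain ⟨C, c, hc, hC⟩ := monoWithCokernel_iff.1 hi
    obtain ⟨K, k, hk, hK⟩ := epiWithKernel_iff.1 hp
    rw [hT.weq_iff hA hE, hasConeIn_inflation_iff hT.thick hT.injectives_le hc] at hi'
    exact ((hT.pair_trivialCof.right_iff K).1 hK C ⟨hC, hi'⟩).hasLiftingProperty hA hc hk
  lift_trivial_fib {X Y Z V} i p hi hp hp' := by
    obtain ⟨C, c, hc, hC⟩ := monoWithCokernel_iff.1 hi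
    -- The kernel of p is not known to be trivial, so the retract argument is used: a is a trivial
    -- cofibration by two-out-of-three, lifts against p, and exhibits p as a retract of b.
    obtain ⟨⟨P, a, b, hab, ha, hb⟩⟩ :=
      (hT.pair_cof.hasFactorization hA).nonempty_mapFactorizationData p
    obtain ⟨B, r, hr, hB⟩ := monoWithCokernel_iff.1 ha
    obtain ⟨K, k, hk, hK⟩ := epiWithKernel_iff.1 hp
    obtain ⟨L, l, hl, hL⟩ := epiWithKernel_iff.1 hb
    have hB' : T.trivial B := by
      rw [← hasConeIn_inflation_iff hT.thick hT.injectives_le hr]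
      rw [hT.weq_iff hA hE, ← hab] at hp'
      exact (hasTwoOutOfThree_hasConeIn hT.thick hT.injectives_le hE).of_postcomp _ _
        (hasConeIn_of_deflation hT.thick hT.injectives_le hE hl hL.2) hp'
    have := ((hT.pair_trivialCof.right_iff K).1 hK B ⟨hB, hB'⟩).hasLiftingProperty hA hr hk
    have sq : CommSq (𝟙 Z) a p b := ⟨by simp [hab]⟩
    have e : RetractArrow p b :=
      { i := Arrow.homMk a (𝟙 V) (by simp [hab])
        r := Arrow.homMk sq.lift (𝟙 V) (by simp)
        retract := by ext <;> simp }
    have := ((hT.pair_cof.right_iff L).1 hL C hC).hasLiftingProperty hA hc hl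
    exact e.rightLiftingProperty i
  factor_trivial_cof := ⟨fun f => by
    obtain ⟨⟨Z, i, p, hf, hi, hp⟩⟩ :=
      (hT.pair_trivialCof.hasFactorization hA).nonempty_mapFactorizationData f
    obtain ⟨C, c, hc, hC⟩ := monoWithCokernel_iff.1 hi
    refine ⟨⟨Z, i, p, hf, ⟨monoWithCokernel_iff.2 ⟨C, c, hc, hC.1⟩, ?_⟩, hp⟩⟩
    rw [hT.weq_iff hA hE]
    exact hasConeIn_of_inflation hc hC.2⟩
  factor_trivial_fib := ⟨fun f => by
    obtain ⟨⟨Z, i, p, hf, hi, hp⟩⟩ :=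
      (hT.pair_cof.hasFactorization hA).nonempty_mapFactorizationData f
    obtain ⟨K, k, hk, hK⟩ := epiWithKernel_iff.1 hp
    refine ⟨⟨Z, i, p, hf, hi, ⟨epiWithKernel_iff.2 ⟨K, k, hk, hK.1⟩, ?_⟩⟩⟩
    rw [hT.weq_iff hA hE]
    exact hasConeIn_of_deflation hT.thick hT.injectives_le hE hk hK.2⟩

end IsHoveyTriple

/-! ### Quillen equivalences between right localizations and injective models -/

namespace InjectiveCotorsionPair

variable {M₁ M₂ M₃ : E.InjectiveCotorsionPair}

/-- The identity functor is a Quillen equivalence from `M₁ / M₂` to `M₃` as soon as, for maps from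
`W₂` to `F₃`, the two notions of trivial cone agree. -/
lemma isQuillenEquivalence_id (hA : WeaklyIdempotentComplete A) (hE : E.EnoughInjectives)
    (h₂₁ : M₂.F ≤ M₁.F) (h₃₁ : M₃.F ≤ M₁.F)
    (h : ∀ {X Y I C : A} {m : X ⟶ I ⊞ Y} {q : I ⊞ Y ⟶ C}, M₂.W X → M₃.F Y → E.injectives I →
      E.Conf m q → (M₃.W C ↔ (M₁.rightLocalization M₂).trivial C)) :
    (E.model (M₁.rightLocalization M₂)).IsQuillenEquivalence (E.model M₃.triple)
      (Adjunction.id (C := A)) where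
  left_model := (isHoveyTriple_rightLocalization hA h₂₁).isModelStructure hA hE
  right_model := (isHoveyTriple_triple hE M₃).isModelStructure hA hE
  map_cof f hf := by
    obtain ⟨C, c, hc, -⟩ := monoWithCokernel_iff.1 hf
    exact monoWithCokernel_iff.2 ⟨C, c, hc, trivial⟩
  map_trivial_cof f hf hf' := by
    obtain ⟨C, c, hc, hC⟩ := monoWithCokernel_iff.1 hf
    have hT := isHoveyTriple_rightLocalization hA h₂₁
    rw [hT.weq_iff hA hE, hasConeIn_inflation_iff hT.thick hT.injectives_le hc] at hf'
    have hC' : M₁.W C := by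
      rw [← cofibrant_inf_trivial_rightLocalization h₂₁]
      exact ⟨hC, hf'⟩
    rw [(isHoveyTriple_triple hE M₃).weq_iff hA hE]
    exact hasConeIn_of_inflation hc (W_le h₃₁ _ hC')
  weq_iff X Y hX hY f := by
    -- Cofibrancy only says that some cokernel of 0 ⟶ X is in W₂; X is a retract of it. The argument
    -- for Y is dual.
    have hX' : M₂.W X := by
      obtain ⟨C, c, hc, hC⟩ := monoWithCokernel_iff.1 hX
      have : M₂.W.IsStableUnderRetracts := inferInstance
      obtain ⟨s, hs⟩ := hc.exists_desc (𝟙 X) (by simp)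
      exact M₂.W.prop_of_retract ⟨c, s, hs⟩ hC
    have hY' : M₃.F Y := by
      obtain ⟨K, k, hk, hK⟩ := epiWithKernel_iff.1 hY
      obtain ⟨s, hs⟩ := hk.exists_lift (𝟙 Y) (by simp)
      exact M₃.F.prop_of_retract ⟨s, k, hs⟩ hK
    rw [(isHoveyTriple_triple hE M₃).weq_iff hA hE,
      (isHoveyTriple_rightLocalization hA h₂₁).weq_iff hA hE]
    have hf : (Adjunction.id (C := A)).homEquiv X Y f = f := by
      rw [Adjunction.homEquiv_unit]
      exact Category.id_comp f
    rw [hf]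
    constructor
    · rintro ⟨I, C, m, q, hI, hm, hc, hC⟩
      exact ⟨I, C, m, q, hI, hm, hc, (h hX' hY' hI hc).1 hC⟩
    · rintro ⟨I, C, m, q, hI, hm, hc, hC⟩
      exact ⟨I, C, m, q, hI, hm, hc, (h hX' hY' hI hc).2 hC⟩

/-- The trivial objects of M₁/M₂ are exactly those of M₃. -/
lemma isQuillenEquivalence_right (hA : WeaklyIdempotentComplete A) (hE : E.EnoughInjectives)
    (h₂₁ : M₂.F ≤ M₁.F) (h₃₁ : M₃.F ≤ M₁.F) (h : M₃.W ⊓ M₁.F = M₂.F) :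
    (E.model (M₁.rightLocalization M₂)).IsQuillenEquivalence (E.model M₃.triple)
      (Adjunction.id (C := A)) := by
  refine isQuillenEquivalence_id hA hE h₂₁ h₃₁ fun _ _ _ _ => ?_
  rw [trivial_rightLocalization_eq h₂₁ h₃₁ hA h]

/-- The trivial classes may differ here, but a cone of a map from W₃ to F₂ ⊆ W₃ lies in W₃. Within
W₃ both trivial classes cut out W₁. -/
lemma isQuillenEquivalence_left (hA : WeaklyIdempotentComplete A) (hE : E.EnoughInjectives)
    (h₂₁ : M₂.F ≤ M₁.F) (h₃₁ : M₃.F ≤ M₁.F) (h : M₃.W ⊓ M₁.F = M₂.F) :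
    (E.model (M₁.rightLocalization M₃)).IsQuillenEquivalence (E.model M₂.triple)
      (Adjunction.id (C := A)) := by
  refine isQuillenEquivalence_id hA hE h₃₁ h₂₁ fun hX hY hI hc => ?_
  have hC := W_right hc hX (W_biprod (W_of_injectives hI) (F_le_W h _ hY))
  have h₁ := cofibrant_inf_trivial_rightLocalization h₃₁
  rw [← W_inf_W_eq h₂₁ h₃₁ h] at h₁
  constructor
  · intro hC'
    exact (h₁.ge _ ⟨hC', hC⟩).2
  · intro hC'
    exact (h₁.le _ ⟨hC, hC'⟩).1

end InjectiveCotorsionPair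

end ExactStructure

end

noncomputable section

/-! ### The shift by the integers given by an autoequivalence -/

/-- A sequence of objects indexed by `ℤ`, each of which is the image of the previous one by the
functor `S`. -/
structure SuspensionSequence {C : Type*} [Category* C] (S : C ⥤ C) where
  X : ℤ → C
  -- The successor is a separate index m, so that reindexed sequences need no transport along
  -- equalities of integers.
  e : ∀ n m : ℤ, n + 1 = m → (S.obj (X n) ≅ X m)

namespace SuspensionSequence

variable {C : Type*} [Category* C] {S : C ⥤ C}

/-- Morphisms of sequences. -/
@[ext]
structure Hom (X Y : SuspensionSequence S) where
  f : ∀ n, X.X n ⟶ Y.X n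
  comm : ∀ n m (h : n + 1 = m), S.map (f n) ≫ (Y.e n m h).hom = (X.e n m h).hom ≫ f m := by
    cat_disch

instance : Category (SuspensionSequence S) where
  Hom := Hom
  id X := { f := fun n => 𝟙 _ }
  comp f g :=
    { f := fun n => f.f n ≫ g.f n
      comm := fun n m h => by rw [S.map_comp, Category.assoc, g.comm,
        ← Category.assoc, f.comm, Category.assoc] }

@[ext]
lemma hom_ext {X Y : SuspensionSequence S} (f g : X ⟶ Y) (h : ∀ n, f.f n = g.f n) : f = g :=
  Hom.ext (funext h)

@[simp]
lemma comp_f {X Y Z : SuspensionSequence S} (f : X ⟶ Y) (g : Y ⟶ Z) (n : ℤ) :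
    (f ≫ g).f n = f.f n ≫ g.f n := rfl

lemma eqToHom_f {X Y : SuspensionSequence S} (h : X = Y) (n : ℤ) :
    (eqToHom h).f n = eqToHom (by rw [h]) := by
  subst h; rfl

lemma e_eqToHom (X : SuspensionSequence S) {n n' m m' : ℤ} (hn : n = n') (hm : m = m')
    (h : n + 1 = m) (h' : n' + 1 = m') :
    S.map (eqToHom (by rw [hn])) ≫ (X.e n' m' h').hom =
      (X.e n m h).hom ≫ eqToHom (by rw [hm]) := by
  subst hn hm; simp

lemma f_eqToHom {X Y : SuspensionSequence S} (f : X ⟶ Y) {n n' : ℤ} (hn : n = n') :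
    f.f n ≫ eqToHom (by rw [hn]) = eqToHom (by rw [hn]) ≫ f.f n' := by
  subst hn; simp

variable (S) in
/-- Reindexing a sequence. -/
def reindex (k : ℤ) : SuspensionSequence S ⥤ SuspensionSequence S where
  obj X := { X := fun n => X.X (n + k), e := fun n m h => X.e (n + k) (m + k) (by omega) }
  map f := { f := fun n => f.f (n + k), comm := fun n m h => f.comm _ _ _ }
  map_id _ := rfl
  map_comp _ _ := rfl

variable (S) in
/-- Reindexing by zero. -/
def reindexZero : reindex S 0 ≅ 𝟭 _ :=
  NatIso.ofComponents (fun X =>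
    { hom := { f := fun n => eqToHom (congrArg X.X (add_zero n)),
               comm := fun n m h => X.e_eqToHom (add_zero n) (add_zero m) _ _ }
      inv := { f := fun n => eqToHom (congrArg X.X (add_zero n).symm),
               comm := fun n m h => X.e_eqToHom (add_zero n).symm (add_zero m).symm _ _ }
      hom_inv_id := by
        ext n
        exact eqToHom_trans (congrArg X.X (add_zero n)) (congrArg X.X (add_zero n).symm)
      inv_hom_id := by
        ext n
        exact eqToHom_trans (congrArg X.X (add_zero n).symm) (congrArg X.X (add_zero n)) })
    (fun f => by ext n; exact f_eqToHom f (add_zero n))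

variable (S) in
/-- Reindexing by a sum. -/
def reindexAdd (a b : ℤ) : reindex S (a + b) ≅ reindex S a ⋙ reindex S b :=
  NatIso.ofComponents (fun X =>
    { hom := { f := fun n => eqToHom (congrArg X.X (by ring : n + (a + b) = n + b + a)),
               comm := fun n m h => X.e_eqToHom (by ring) (by ring) _ _ }
      inv := { f := fun n => eqToHom (congrArg X.X (by ring : n + b + a = n + (a + b))),
               comm := fun n m h => X.e_eqToHom (by ring) (by ring) _ _ }
      hom_inv_id := by
        ext n
        exact eqToHom_trans (congrArg X.X (by ring : n + (a + b) = n + b + a)) (congrArg X.X (by ring))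
      inv_hom_id := by
        ext n
        exact eqToHom_trans (congrArg X.X (by ring : n + b + a = n + (a + b))) (congrArg X.X (by ring)) })
    (fun f => by ext n; exact f_eqToHom f (by ring))

/-- Reindexing takes the place of the powers of S. All structure isomorphisms are transports along
equalities of integers, so coherence is automatic. -/
instance : HasShift (SuspensionSequence S) ℤ :=
  hasShiftMk _ _
    { F := reindex S
      zero := reindexZero S
      add := reindexAdd S
      assoc_hom_app := fun a b c X => by
        ext n
        rw [comp_f, comp_f, comp_f, eqToHom_f]
        exact (eqToHom_trans (congrArg X.X (by ring : n + (a + b + c) = n + c + (a + b)))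
          (congrArg X.X (by ring : n + c + (a + b) = n + c + b + a))).trans
          (((eqToHom_trans (congrArg X.X (by ring : n + (a + b + c) = n + (a + (b + c))))
            (congrArg X.X (by ring : _ = n + c + b + a))).symm).trans
            (congrArg (eqToHom _ ≫ ·)
              (eqToHom_trans (congrArg X.X (by ring : n + (a + (b + c)) = n + (b + c) + a))
                (congrArg X.X (by ring : n + (b + c) + a = n + c + b + a))).symm))
      zero_add_hom_app := fun a X => by
        ext n
        rw [comp_f, eqToHom_f]
        exact (eqToHom_trans (congrArg X.X (by ring : n + (0 + a) = n + a))
          (congrArg X.X (by ring : n + a = n + a + 0))).symm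
      add_zero_hom_app := fun a X => by
        ext n
        rw [comp_f, eqToHom_f]
        exact (eqToHom_trans (congrArg X.X (by ring : n + (a + 0) = n + a))
          (congrArg X.X (by ring : n + a = n + 0 + a))).symm }

variable (S) in
/-- The evaluation of a sequence at zero. -/
def eval : SuspensionSequence S ⥤ C where
  obj X := X.X 0
  map f := f.f 0

/-- The component at 0 determines the others: upwards by applying S, downwards because S is
faithful. -/
instance [S.Faithful] : (eval S).Faithful where
  map_injective {X Y f g} h := by
    ext n
    have h₀ : f.f 0 = g.f 0 := h
    induction n using Int.induction_on with
    | zero => exact h₀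
    | succ n hn =>
      rw [← cancel_epi (X.e n (n + 1) rfl).hom, ← f.comm, ← g.comm, hn]
    | pred n hn =>
      apply S.map_injective
      rw [← cancel_mono (Y.e (-(n : ℤ) - 1) (-n) (by omega)).hom, f.comm, g.comm, hn]

section

variable [S.Full] {X Y : SuspensionSequence S} (φ : X.X 0 ⟶ Y.X 0)

/-- The extension of a map to non-negative indices. -/
def extendNat : ∀ n : ℕ, X.X n ⟶ Y.X n
  | 0 => φ
  | n + 1 => (X.e n (n + 1 : ℕ) (by simp)).inv ≫ S.map (extendNat n) ≫
      (Y.e n (n + 1 : ℕ) (by simp)).hom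

/-- The extension of a map to negative indices. -/
def extendNegSucc : ∀ n : ℕ, X.X (Int.negSucc n) ⟶ Y.X (Int.negSucc n)
  | 0 => S.preimage ((X.e (Int.negSucc 0) 0 rfl).hom ≫ φ ≫ (Y.e (Int.negSucc 0) 0 rfl).inv)
  | n + 1 => S.preimage ((X.e (Int.negSucc (n + 1)) (Int.negSucc n) rfl).hom ≫ extendNegSucc n ≫
      (Y.e (Int.negSucc (n + 1)) (Int.negSucc n) rfl).inv)

/-- The extension of a map to all indices. -/
def extend : ∀ n : ℤ, X.X n ⟶ Y.X n
  | Int.ofNat n => extendNat φ n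
  | Int.negSucc n => extendNegSucc φ n

lemma extend_comm : ∀ (n m : ℤ) (h : n + 1 = m),
    S.map (extend φ n) ≫ (Y.e n m h).hom = (X.e n m h).hom ≫ extend φ m
  | Int.ofNat n, Int.ofNat m, h => by
    obtain rfl : m = n + 1 := by simp at h; omega
    simp [extend, extendNat]
  | Int.ofNat n, Int.negSucc m, h => by simp at h; omega
  | Int.negSucc n, Int.ofNat m, h => by
    obtain rfl : n = 0 := by simp at h; omega
    obtain rfl : m = 0 := by simp at h; omega
    simp [extend, extendNat, extendNegSucc]
  | Int.negSucc n, Int.negSucc m, h => by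
    obtain rfl : n = m + 1 := by omega
    simp [extend, extendNegSucc]

end

instance [S.Full] : (eval S).Full where
  map_surjective φ := ⟨{ f := extend φ, comm := extend_comm φ }, rfl⟩

instance [S.EssSurj] : (eval S).EssSurj where
  mem_essImage X := by
    let Z : ℤ → C := fun
      | Int.ofNat n => S.obj^[n] X
      -- The index is -(n + 1), hence n + 1 preimages.
      | Int.negSucc n => S.objPreimage^[n + 1] X
    have hZ : ∀ n m : ℤ, n + 1 = m → Nonempty (S.obj (Z n) ≅ Z m)
      | Int.ofNat n, Int.ofNat m, h => by
        obtain rfl : m = n + 1 := by simp at h; omega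
        exact ⟨eqToIso (Function.iterate_succ_apply' _ _ _).symm⟩
      | Int.ofNat n, Int.negSucc m, h => by simp at h; omega
      | Int.negSucc n, Int.ofNat m, h => by
        obtain rfl : n = 0 := by simp at h; omega
        obtain rfl : m = 0 := by simp at h; omega
        exact ⟨S.objObjPreimageIso X⟩
      | Int.negSucc n, Int.negSucc m, h => by
        obtain rfl : n = m + 1 := by omega
        exact ⟨eqToIso (congrArg S.obj (Function.iterate_succ_apply' _ _ _)) ≪≫
          S.objObjPreimageIso _⟩
    exact ⟨{ X := Z, e := fun n m h => (hZ n m h).some }, ⟨Iso.refl _⟩⟩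

instance [S.IsEquivalence] : (eval S).IsEquivalence where

end SuspensionSequence

/-- An autoequivalence is the shift by one for some shift by the integers. -/
theorem exists_hasShift {C : Type*} [Category* C] (S : C ⥤ C) [S.IsEquivalence] :
    ∃ _ : HasShift C ℤ, Nonempty (shiftFunctor C (1 : ℤ) ≅ S) := by
  -- As S is an equivalence, a sequence amounts to its term at 0. The shift by reindexing is
  -- transported along this equivalence, and X 1 ≅ S (X 0) identifies its first power with S.
  let ev := SuspensionSequence.eval S
  let s : ℤ → C ⥤ C := fun n => ev.inv ⋙ shiftFunctor (SuspensionSequence S) n ⋙ ev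
  let i : ∀ n, s n ⋙ ev.inv ≅ ev.inv ⋙ shiftFunctor (SuspensionSequence S) n := fun n =>
    Functor.isoWhiskerLeft (ev.inv ⋙ shiftFunctor (SuspensionSequence S) n)
      ev.asEquivalence.unitIso.symm
  refine ⟨(Functor.FullyFaithful.ofFullyFaithful ev.inv).hasShift s i, ⟨?_⟩⟩
  let j : shiftFunctor (SuspensionSequence S) (1 : ℤ) ⋙ ev ≅ ev ⋙ S :=
    NatIso.ofComponents (fun X => (X.e 0 (0 + 1) rfl).symm) (fun {X Y} f => by
      change f.f (0 + 1) ≫ (Y.e 0 (0 + 1) rfl).inv = (X.e 0 (0 + 1) rfl).inv ≫ S.map (f.f 0)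
      rw [Iso.comp_inv_eq, Category.assoc, f.comm 0 (0 + 1) rfl, Iso.inv_hom_id_assoc])
  exact Functor.isoWhiskerLeft ev.inv j ≪≫ (Functor.associator _ _ _).symm ≪≫
    Functor.isoWhiskerRight ev.asEquivalence.counitIso S ≪≫ S.leftUnitor

end

noncomputable section

namespace ExactStructure

variable {A : Type u} [Category.{v} A] [Preadditive A] [HasZeroObject A] [HasBinaryBiproducts A]
  {E : ExactStructure A} {P : ObjectProperty A}

/-! ### Stable categories -/

lemma homotopic_iff {X Y : P.FullSubcategory} (f g : X ⟶ Y) :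
    E.homotopic P f g ↔ E.Null (f.hom - g.hom) := by
  refine ⟨fun h => ?_, fun h => ?_⟩
  · rw [← neg_sub]
    exact Null.neg h
  · change E.Null (g.hom - f.hom)
    rw [← neg_sub]
    exact h.neg

instance : Congruence (E.homotopic P) where
  equivalence :=
    ⟨fun f => (homotopic_iff _ _).2 (by rw [sub_self]; exact Null.zero),
      fun h => (homotopic_iff _ _).2 (by
        rw [← neg_sub]; exact ((homotopic_iff _ _).1 h).neg),
      fun h h' => (homotopic_iff _ _).2 (by
        rw [← sub_add_sub_cancel]
        exact ((homotopic_iff _ _).1 h).add ((homotopic_iff _ _).1 h'))⟩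
  comp_left f _ _ h := (homotopic_iff _ _).2 (by
    have := ((homotopic_iff _ _).1 h).comp_left f.hom
    rwa [Preadditive.comp_sub] at this)
  comp_right g h := (homotopic_iff _ _).2 (by
    have := ((homotopic_iff _ _).1 h).comp_right g.hom
    rwa [Preadditive.sub_comp] at this)

lemma homotopic_add {X Y : P.FullSubcategory} {f₁ f₂ g₁ g₂ : X ⟶ Y}
    (hf : E.homotopic P f₁ f₂) (hg : E.homotopic P g₁ g₂) :
    E.homotopic P (f₁ + g₁) (f₂ + g₂) := (homotopic_iff _ _).2 (by
  have := ((homotopic_iff _ _).1 hf).add ((homotopic_iff _ _).1 hg)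
  rwa [sub_add_sub_comm] at this)

/-- The sum of morphisms of the stable category. -/
@[reducible]
def preadditiveStable : Preadditive (E.Stable P) :=
  Quotient.preadditive _ (fun _ _ _ _ _ _ hf hg => homotopic_add hf hg)

-- Local only: once a `TriangulatedStructure` on the stable category is in play, the addition is the
-- one bundled in it.
attribute [local instance] preadditiveStable

instance : (E.toStable P).Additive :=
  Quotient.functor_additive _ (fun _ _ _ _ _ _ hf hg => homotopic_add hf hg)

variable (E) in
/-- The morphism of `P/∼` given by a morphism of the ambient category. -/
def st {X Y : P.FullSubcategory} (f : X.obj ⟶ Y.obj) :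
    (E.toStable P).obj X ⟶ (E.toStable P).obj Y :=
  (E.toStable P).map (ObjectProperty.homMk f)

section

variable {X Y Z : P.FullSubcategory}

lemma exists_st (φ : (E.toStable P).obj X ⟶ (E.toStable P).obj Y) :
    ∃ f : X.obj ⟶ Y.obj, E.st f = φ := by
  obtain ⟨f, rfl⟩ := (E.toStable P).map_surjective φ
  exact ⟨f.hom, rfl⟩

lemma st_eq_iff {f g : X.obj ⟶ Y.obj} : E.st f = E.st g ↔ E.Null (f - g) := by
  rw [st, st, Quotient.functor_map_eq_iff, homotopic_iff]
  rfl

@[simp]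
lemma st_id (X : P.FullSubcategory) : E.st (𝟙 X.obj) = 𝟙 ((E.toStable P).obj X) :=
  (E.toStable P).map_id X

lemma st_comp (f : X.obj ⟶ Y.obj) (g : Y.obj ⟶ Z.obj) :
    E.st (X := X) (Y := Z) (f ≫ g) = E.st f ≫ E.st g :=
  (E.toStable P).map_comp (ObjectProperty.homMk f) (ObjectProperty.homMk g)

lemma st_add (f g : X.obj ⟶ Y.obj) : E.st (f + g) = E.st f + E.st g :=
  (E.toStable P).map_add (f := ObjectProperty.homMk f) (g := ObjectProperty.homMk g)

lemma st_neg (f : X.obj ⟶ Y.obj) : E.st (-f) = -E.st f :=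
  (E.toStable P).map_neg (f := ObjectProperty.homMk f)

@[simp]
lemma st_zero : E.st (0 : X.obj ⟶ Y.obj) = 0 := (E.toStable P).map_zero X Y

lemma st_eq_zero_iff {f : X.obj ⟶ Y.obj} : E.st f = 0 ↔ E.Null f := by
  rw [← st_zero, st_eq_iff, sub_zero]

lemma isZero_toStable_iff : IsZero ((E.toStable P).obj X) ↔ E.Null (𝟙 X.obj) := by
  rw [IsZero.iff_id_eq_zero, ← st_id, st_eq_zero_iff]

lemma isZero_toStable (hX : E.injectives X.obj) : IsZero ((E.toStable P).obj X) :=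
  isZero_toStable_iff.2 (Null.of_injective_left hX _)

/-- Morphisms which are inverse to each other up to null morphisms give an isomorphism. -/
def stIso (f : X.obj ⟶ Y.obj) (g : Y.obj ⟶ X.obj) (h : E.Null (f ≫ g - 𝟙 _))
    (h' : E.Null (g ≫ f - 𝟙 _)) : (E.toStable P).obj X ≅ (E.toStable P).obj Y where
  hom := E.st f
  inv := E.st g
  hom_inv_id := by rwa [← st_comp, ← st_id, st_eq_iff]
  inv_hom_id := by rwa [← st_comp, ← st_id, st_eq_iff]

end

/-- Adding an injective object does not change the stable isomorphism class. -/
@[simps!]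
def stFstIso {X : P.FullSubcategory} {I : A} (hI : E.injectives I) (h : P (X.obj ⊞ I)) :
    (E.toStable P).obj ⟨X.obj ⊞ I, h⟩ ≅ (E.toStable P).obj X :=
  stIso (X := ⟨X.obj ⊞ I, h⟩) biprod.fst biprod.inl (by
    have : (biprod.fst ≫ biprod.inl : X.obj ⊞ I ⟶ X.obj ⊞ I) - 𝟙 _ =
        -(biprod.snd ≫ biprod.inr) := by ext <;> simp
    rw [this]
    exact ((Null.of_injective_left hI _).comp_left _).neg) (by
    simpa using Null.zero)

end ExactStructure

end

noncomputable section

namespace ExactStructure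

attribute [local instance] preadditiveStable

variable {A : Type u} [Category.{v} A] [Preadditive A] [HasZeroObject A] [HasBinaryBiproducts A]
  {E : ExactStructure A} {P : ObjectProperty A}

/-! ### The suspension functor -/

/-- The third components of two morphisms of conflations to a conflation with injective middle
term are homotopic if the first components are. -/
lemma Conf.null_sub {X₁ X₂ X₃ Y₁ Y₂ Y₃ : A} {i : X₁ ⟶ X₂} {p : X₂ ⟶ X₃} (h : E.Conf i p)
    {j : Y₁ ⟶ Y₂} {q : Y₂ ⟶ Y₃} (hY : E.injectives Y₂) (w : j ≫ q = 0)
    {a a' : X₁ ⟶ Y₁} {b b' : X₂ ⟶ Y₂} {c c' : X₃ ⟶ Y₃}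
    (h₁ : i ≫ b = a ≫ j) (h₂ : p ≫ c = b ≫ q) (h₁' : i ≫ b' = a' ≫ j) (h₂' : p ≫ c' = b' ≫ q)
    (ha : E.Null (a - a')) : E.Null (c - c') := by
  obtain ⟨J, u, v, hJ, hu⟩ := ha
  obtain ⟨u', hu'⟩ := hJ.exists_extension h u
  obtain ⟨r, hr⟩ := h.exists_desc (b - b' - u' ≫ v ≫ j) (by
    rw [Preadditive.comp_sub, Preadditive.comp_sub, h₁, h₁', reassoc_of% hu', ← Preadditive.sub_comp,
      hu, Category.assoc, sub_self])
  have : c - c' = r ≫ q := by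
    have := h.epi
    rw [← cancel_epi p, reassoc_of% hr, Preadditive.comp_sub, h₂, h₂', Preadditive.sub_comp,
      Preadditive.sub_comp, Category.assoc, Category.assoc, w, comp_zero, comp_zero, sub_zero]
  rw [this]
  exact (Null.of_injective_left hY q).comp_left r

variable (E P) in
/-- A choice, for each object of `P`, of a conflation in `P` with injective middle term. -/
structure Suspension where
  I : P.FullSubcategory → A
  obj : P.FullSubcategory → P.FullSubcategory
  ι : ∀ X, X.obj ⟶ I X
  π : ∀ X, I X ⟶ (obj X).obj
  injective : ∀ X, E.injectives (I X)
  conf : ∀ X, E.Conf (ι X) (π X)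

namespace Suspension

variable (s : E.Suspension P)

/-- `g` is induced by `f` on suspensions. -/
def Ind {X Y : P.FullSubcategory} (f : X.obj ⟶ Y.obj) (g : (s.obj X).obj ⟶ (s.obj Y).obj) : Prop :=
  ∃ b : s.I X ⟶ s.I Y, s.ι X ≫ b = f ≫ s.ι Y ∧ s.π X ≫ g = b ≫ s.π Y

lemma exists_ind {X Y : P.FullSubcategory} (f : X.obj ⟶ Y.obj) : ∃ g, s.Ind f g := by
  obtain ⟨b, hb⟩ := (s.injective Y).exists_extension (s.conf X) (f ≫ s.ι Y)
  obtain ⟨g, hg⟩ := (s.conf X).exists_desc (b ≫ s.π Y)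
    (by rw [reassoc_of% hb, (s.conf Y).w, comp_zero])
  exact ⟨g, b, hb, hg⟩

lemma Ind.st_eq {s : E.Suspension P} {X Y : P.FullSubcategory} {f f' : X.obj ⟶ Y.obj}
    {g g' : (s.obj X).obj ⟶ (s.obj Y).obj} (h : s.Ind f g) (h' : s.Ind f' g')
    (hf : E.Null (f - f')) : E.st g = E.st g' := by
  obtain ⟨b, hb, hg⟩ := h
  obtain ⟨b', hb', hg'⟩ := h'
  exact st_eq_iff.2 ((s.conf X).null_sub (s.injective Y) (s.conf Y).w hb hg hb' hg' hf)

lemma Ind.comp {s : E.Suspension P} {X Y Z : P.FullSubcategory} {f : X.obj ⟶ Y.obj}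
    {f' : Y.obj ⟶ Z.obj} {g : (s.obj X).obj ⟶ (s.obj Y).obj}
    {g' : (s.obj Y).obj ⟶ (s.obj Z).obj} (h : s.Ind f g) (h' : s.Ind f' g') :
    s.Ind (f ≫ f') (g ≫ g') := by
  obtain ⟨b, hb, hg⟩ := h
  obtain ⟨b', hb', hg'⟩ := h'
  exact ⟨b ≫ b', by rw [reassoc_of% hb, hb', Category.assoc],
    by rw [reassoc_of% hg, hg', Category.assoc]⟩

lemma ind_id (X : P.FullSubcategory) : s.Ind (𝟙 X.obj) (𝟙 (s.obj X).obj) :=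
  ⟨𝟙 _, by simp, by simp⟩

lemma Ind.neg {s : E.Suspension P} {X Y : P.FullSubcategory} {f : X.obj ⟶ Y.obj}
    {g : (s.obj X).obj ⟶ (s.obj Y).obj} (h : s.Ind f g) : s.Ind (-f) (-g) := by
  obtain ⟨b, hb, hg⟩ := h
  exact ⟨-b, by simp [hb], by simp [hg]⟩

/-- A map inducing a given map on the chosen suspensions. -/
def lift {X Y : P.FullSubcategory} (f : X.obj ⟶ Y.obj) : (s.obj X).obj ⟶ (s.obj Y).obj :=
  (s.exists_ind f).choose

lemma ind_lift {X Y : P.FullSubcategory} (f : X.obj ⟶ Y.obj) : s.Ind f (s.lift f) :=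
  (s.exists_ind f).choose_spec

/-- The suspension functor on the stable category. -/
def functor : E.Stable P ⥤ E.Stable P :=
  CategoryTheory.Quotient.lift _
    { obj := fun X => (E.toStable P).obj (s.obj X)
      map := fun f => E.st (s.lift f.hom)
      map_id := fun X => by
        rw [← st_id]
        exact (s.ind_lift _).st_eq (s.ind_id X) (by
          rw [ObjectProperty.FullSubcategory.id_hom, sub_self]; exact Null.zero)
      map_comp := fun f g => by
        rw [← st_comp]
        exact (s.ind_lift _).st_eq ((s.ind_lift _).comp (s.ind_lift _)) (by
          rw [ObjectProperty.FullSubcategory.comp_hom, sub_self]; exact Null.zero) }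
    (fun _ _ _ _ h => (s.ind_lift _).st_eq (s.ind_lift _) ((homotopic_iff _ _).1 h))

/-- The value of the suspension functor. -/
def functorObjIso (X : P.FullSubcategory) :
    s.functor.obj ((E.toStable P).obj X) ≅ (E.toStable P).obj (s.obj X) :=
  Iso.refl _

lemma Ind.functor_map {s : E.Suspension P} {X Y : P.FullSubcategory} {f : X.obj ⟶ Y.obj}
    {g : (s.obj X).obj ⟶ (s.obj Y).obj} (h : s.Ind f g) :
    s.functor.map (E.st f) ≫ (s.functorObjIso Y).hom = (s.functorObjIso X).hom ≫ E.st g :=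
  (Category.comp_id _).trans (((s.ind_lift f).st_eq h (by rw [sub_self]; exact Null.zero)).trans
    (Category.id_comp _).symm)

/-- `c` is a connecting morphism of the conflation `(i, p)`. -/
def Conn {X₁ X₂ X₃ : P.FullSubcategory} (i : X₁.obj ⟶ X₂.obj) (p : X₂.obj ⟶ X₃.obj)
    (c : X₃.obj ⟶ (s.obj X₁).obj) : Prop :=
  ∃ b : X₂.obj ⟶ s.I X₁, i ≫ b = s.ι X₁ ∧ p ≫ c = b ≫ s.π X₁

lemma exists_conn {X₁ X₂ X₃ : P.FullSubcategory} {i : X₁.obj ⟶ X₂.obj} {p : X₂.obj ⟶ X₃.obj}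
    (h : E.Conf i p) : ∃ c, s.Conn i p c := by
  obtain ⟨b, hb⟩ := (s.injective X₁).exists_extension h (s.ι X₁)
  obtain ⟨c, hc⟩ := h.exists_desc (b ≫ s.π X₁) (by rw [reassoc_of% hb, (s.conf X₁).w])
  exact ⟨c, b, hb, hc⟩

/-- Connecting morphisms are natural. -/
lemma Conn.naturality {s : E.Suspension P} {X₁ X₂ X₃ Y₁ Y₂ Y₃ : P.FullSubcategory}
    {i : X₁.obj ⟶ X₂.obj} {p : X₂.obj ⟶ X₃.obj} {c : X₃.obj ⟶ (s.obj X₁).obj}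
    {i' : Y₁.obj ⟶ Y₂.obj} {p' : Y₂.obj ⟶ Y₃.obj} {c' : Y₃.obj ⟶ (s.obj Y₁).obj}
    (hc : s.Conn i p c) (hc' : s.Conn i' p' c') (h : E.Conf i p) (τ₁ : X₁.obj ⟶ Y₁.obj)
    (τ₂ : X₂.obj ⟶ Y₂.obj) (τ₃ : X₃.obj ⟶ Y₃.obj) (h₁ : i ≫ τ₂ = τ₁ ≫ i')
    (h₂ : p ≫ τ₃ = τ₂ ≫ p') {g : (s.obj X₁).obj ⟶ (s.obj Y₁).obj} (hg : s.Ind τ₁ g) :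
    E.st τ₃ ≫ E.st c' = E.st c ≫ E.st g := by
  rw [← st_comp, ← st_comp, st_eq_iff]
  obtain ⟨b, hb, hc⟩ := hc
  obtain ⟨b', hb', hc'⟩ := hc'
  obtain ⟨d, hd, hg⟩ := hg
  refine h.null_sub (s.injective Y₁) (s.conf Y₁).w (a := τ₁) (a' := τ₁) (b := τ₂ ≫ b')
    (b' := b ≫ d) ?_ ?_ ?_ ?_ (by rw [sub_self]; exact Null.zero)
  · rw [reassoc_of% h₁, hb']
  · rw [reassoc_of% h₂, hc', Category.assoc]
  · rw [reassoc_of% hb, hd]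
  · rw [reassoc_of% hc, hg, Category.assoc]

lemma Conn.st_eq {s : E.Suspension P} {X₁ X₂ X₃ : P.FullSubcategory}
    {i : X₁.obj ⟶ X₂.obj} {p : X₂.obj ⟶ X₃.obj} {c c' : X₃.obj ⟶ (s.obj X₁).obj}
    (hc : s.Conn i p c) (hc' : s.Conn i p c') (h : E.Conf i p) : E.st c = E.st c' := by
  have := hc.naturality hc' h (𝟙 _) (𝟙 _) (𝟙 _) (by simp) (by simp) (s.ind_id _)
  rw [st_id, st_id, Category.id_comp, Category.comp_id] at this
  exact this.symm

lemma conn_id (X : P.FullSubcategory) (hX : P (s.I X)) :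
    s.Conn (X₂ := ⟨s.I X, hX⟩) (s.ι X) (s.π X) (𝟙 _) :=
  ⟨𝟙 _, by simp, by simp⟩

/-- The connecting morphism of a conflation with injective middle term is an isomorphism. -/
lemma Conn.isIso {s : E.Suspension P} {X₁ X₂ X₃ : P.FullSubcategory}
    {i : X₁.obj ⟶ X₂.obj} {p : X₂.obj ⟶ X₃.obj} {c : X₃.obj ⟶ (s.obj X₁).obj}
    (hc : s.Conn i p c) (h : E.Conf i p) (hX₂ : E.injectives X₂.obj) : IsIso (E.st c) := by
  obtain ⟨b', hb'⟩ := hX₂.exists_extension (s.conf X₁) i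
  obtain ⟨c', hc'⟩ := (s.conf X₁).exists_desc (b' ≫ p) (by rw [reassoc_of% hb', h.w])
  obtain ⟨b, hb, hc⟩ := hc
  refine (stIso c c' ?_ ?_).isIso_hom
  · refine h.null_sub hX₂ h.w (a := 𝟙 _) (a' := 𝟙 _) (b := b ≫ b') (b' := 𝟙 _) ?_ ?_ ?_ ?_
      (by rw [sub_self]; exact Null.zero)
    · rw [reassoc_of% hb, hb', Category.id_comp]
    · rw [reassoc_of% hc, hc', Category.assoc]
    · simp
    · simp
  · refine (s.conf X₁).null_sub (s.injective X₁) (s.conf X₁).w (a := 𝟙 _) (a' := 𝟙 _)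
      (b := b' ≫ b) (b' := 𝟙 _) ?_ ?_ ?_ ?_ (by rw [sub_self]; exact Null.zero)
    · rw [reassoc_of% hb', hb, Category.id_comp]
    · rw [reassoc_of% hc', hc, Category.assoc]
    · simp
    · simp

end Suspension

namespace InjectiveCotorsionPair

variable (M : E.InjectiveCotorsionPair)

lemma nonempty_suspension (hA : WeaklyIdempotentComplete A) (hE : E.EnoughInjectives) :
    Nonempty (E.Suspension M.F) := by
  choose I C i p hI h using fun X : M.F.FullSubcategory => hE.exists_conf X.obj
  exact ⟨{ I := I
           obj := fun X => ⟨C X, F_right hA (h X) X.property (F_of_injectives (hI X))⟩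
           ι := i, π := p, injective := hI, conf := h }⟩

variable {M} (s : E.Suspension M.F)

/-- Fullness and faithfulness both hold because injective objects are in W, so that maps from them
lift along deflations with kernel in F. A map of cosyzygies thus lifts to the injective middle terms
and restricts to the kernels. -/
instance : s.functor.Full where
  map_surjective {X Y} φ := by
    obtain ⟨X⟩ := X
    obtain ⟨Y⟩ := Y
    obtain ⟨c, rfl⟩ := exists_st (X := s.obj X) (Y := s.obj Y) φ
    obtain ⟨b, hb⟩ := (M.ext (W_of_injectives (s.injective X)) Y.property).exists_lift
      (s.conf Y) (s.π X ≫ c)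
    obtain ⟨a, ha⟩ := (s.conf Y).exists_lift (s.ι X ≫ b)
      (by rw [Category.assoc, hb, reassoc_of% (s.conf X).w, zero_comp])
    refine ⟨E.st a, ?_⟩
    have := Suspension.Ind.functor_map (s := s) (f := a) (g := c) ⟨b, ha.symm, hb.symm⟩
    exact (Category.comp_id _).symm.trans (this.trans (Category.id_comp _))

instance : s.functor.Faithful where
  map_injective {X Y} φ ψ hφψ := by
    obtain ⟨X⟩ := X
    obtain ⟨Y⟩ := Y
    obtain ⟨f, rfl⟩ := exists_st φ
    obtain ⟨f', rfl⟩ := exists_st ψ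
    obtain ⟨g, hg⟩ := s.exists_ind f
    obtain ⟨g', hg'⟩ := s.exists_ind f'
    have hφψ : E.Null (g - g') := by
      rw [← st_eq_iff, ← cancel_epi (s.functorObjIso X).hom, ← hg.functor_map, ← hg'.functor_map,
        hφψ]
    rw [st_eq_iff]
    obtain ⟨b, hb, hg⟩ := hg
    obtain ⟨b', hb', hg'⟩ := hg'
    obtain ⟨J, u, v, hJ, huv⟩ := hφψ
    -- A null homotopy of g - g' lifts to the middle terms. Subtracting it leaves a map w into Y,
    -- and f - f' factors through the injective s.I X.
    obtain ⟨v', hv'⟩ := (M.ext (W_of_injectives hJ) Y.property).exists_lift (s.conf Y) v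
    obtain ⟨w, hw⟩ := (s.conf Y).exists_lift (b - b' - s.π X ≫ u ≫ v') (by
      rw [Preadditive.sub_comp, Preadditive.sub_comp, ← hg, ← hg', ← Preadditive.comp_sub, huv,
        Category.assoc, Category.assoc, hv', sub_self])
    have : f - f' = s.ι X ≫ w := by
      have := (s.conf Y).mono
      rw [← cancel_mono (s.ι Y), Category.assoc, hw, Preadditive.comp_sub, Preadditive.comp_sub,
        hb, hb', reassoc_of% (s.conf X).w, zero_comp, sub_zero, Preadditive.sub_comp]
    rw [this]
    exact (Null.of_injective_left (s.injective X) w).comp_left _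

/-- Y is the suspension of the kernel of its injective cover, through the connecting morphism. -/
lemma essSurj_suspension (hA : WeaklyIdempotentComplete A) : s.functor.EssSurj where
  mem_essImage Y := by
    obtain ⟨Y⟩ := Y
    obtain ⟨K, I, k, q, hK, hI, h⟩ := exists_injective_cover hA Y.property
    obtain ⟨c, hc⟩ := s.exists_conn (X₁ := ⟨K, hK⟩) (X₂ := ⟨I, F_of_injectives hI⟩) (X₃ := Y) h
    have := hc.isIso h hI
    exact ⟨(E.toStable M.F).obj ⟨K, hK⟩, ⟨(asIso (E.st c)).symm⟩⟩

lemma isEquivalence_suspension (hA : WeaklyIdempotentComplete A) : s.functor.IsEquivalence :=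
  have := essSurj_suspension s hA
  { }

end InjectiveCotorsionPair

end ExactStructure

end

/-! ### Triangles of the stable category -/

noncomputable section

/-- Equivalences preserve biproducts. This is applied to the shift functors, as `exists_hasShift`
keeps no record of addition. -/
lemma additive_of_isEquivalence {C D : Type*} [Category* C] [Category* D] [Preadditive C]
    [Preadditive D] [HasZeroObject C] [HasBinaryBiproducts C] (F : C ⥤ D) [F.IsEquivalence] :
    F.Additive := by
  have : F.PreservesZeroMorphisms := inferInstance
  have := preservesBinaryBiproducts_of_preservesBinaryProducts F
  exact Functor.additive_of_preservesBinaryBiproducts F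

namespace ExactStructure

attribute [local instance] preadditiveStable

open Pretriangulated

variable {A : Type u} [Category.{v} A] [Preadditive A] [HasZeroObject A] [HasBinaryBiproducts A]
  {E : ExactStructure A}

lemma hasBinaryBiproducts_stable {P : ObjectProperty A}
    (hP : ∀ X Y : A, P X → P Y → P (X ⊞ Y)) : HasBinaryBiproducts (E.Stable P) where
  has_binary_biproduct X Y := by
    obtain ⟨X⟩ := X
    obtain ⟨Y⟩ := Y
    let XY : P.FullSubcategory := ⟨X.obj ⊞ Y.obj, hP _ _ X.property Y.property⟩
    let inl : X.obj ⟶ XY.obj := biprod.inl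
    let inr : Y.obj ⟶ XY.obj := biprod.inr
    let fst : XY.obj ⟶ X.obj := biprod.fst
    let snd : XY.obj ⟶ Y.obj := biprod.snd
    refine HasBinaryBiproduct.mk ⟨_, isBinaryBilimitOfTotal
      { pt := (E.toStable P).obj XY
        inl := E.st inl
        inr := E.st inr
        fst := E.st fst
        snd := E.st snd
        inl_fst := ?_
        inl_snd := ?_
        inr_fst := ?_
        inr_snd := ?_ } ?_⟩
    · exact (st_comp inl fst).symm.trans
        ((congrArg _ (by simp [inl, fst])).trans (st_id X))
    · exact (st_comp inl snd).symm.trans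
        ((congrArg _ (by simp [inl, snd])).trans st_zero)
    · exact (st_comp inr fst).symm.trans
        ((congrArg _ (by simp [inr, fst])).trans st_zero)
    · exact (st_comp inr snd).symm.trans
        ((congrArg _ (by simp [inr, snd])).trans (st_id Y))
    · change E.st fst ≫ E.st inl + E.st snd ≫ E.st inr = 𝟙 _
      rw [← st_comp, ← st_comp, ← st_add, ← st_id]
      exact congrArg _ (by simp [fst, inl, snd, inr, XY])

namespace InjectiveCotorsionPair

variable {M : E.InjectiveCotorsionPair}

instance : HasZeroObject (E.Stable M.F) :=
  ⟨(E.toStable M.F).obj ⟨0, F_of_injectives injectives_zero⟩, isZero_toStable injectives_zero⟩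

end InjectiveCotorsionPair

/-- An identification of the shift functor of the stable category with a suspension. -/
structure Suspension.ShiftIso {P : ObjectProperty A} (s : E.Suspension P)
    [HasShift (E.Stable P) ℤ] where
  iso (X : P.FullSubcategory) : ((E.toStable P).obj X)⟦(1 : ℤ)⟧ ≅ (E.toStable P).obj (s.obj X)
  comm {X Y : P.FullSubcategory} {f : X.obj ⟶ Y.obj} {g : (s.obj X).obj ⟶ (s.obj Y).obj}
    (h : s.Ind f g) : (E.st f)⟦(1 : ℤ)⟧' ≫ (iso Y).hom = (iso X).hom ≫ E.st g

namespace Suspension.ShiftIso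

variable {P : ObjectProperty A} {s : E.Suspension P} [HasShift (E.Stable P) ℤ] (σ : s.ShiftIso)

lemma comm_inv {X Y : P.FullSubcategory} {f : X.obj ⟶ Y.obj}
    {g : (s.obj X).obj ⟶ (s.obj Y).obj}
    (h : s.Ind f g) : E.st g ≫ (σ.iso Y).inv = (σ.iso X).inv ≫ (E.st f)⟦(1 : ℤ)⟧' := by
  rw [Iso.eq_inv_comp, ← Category.assoc, ← σ.comm h, Category.assoc, Iso.hom_inv_id,
    Category.comp_id]

variable {X₁ X₂ X₃ Y₁ Y₂ Y₃ : P.FullSubcategory}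
    {i : X₁.obj ⟶ X₂.obj} {p : X₂.obj ⟶ X₃.obj} {c : X₃.obj ⟶ (s.obj X₁).obj}
    {i' : Y₁.obj ⟶ Y₂.obj} {p' : Y₂.obj ⟶ Y₃.obj} {c' : Y₃.obj ⟶ (s.obj Y₁).obj}

/-- The connecting morphism of a conflation, in the stable category. -/
def δ (h : E.Conf i p) : (E.toStable P).obj X₃ ⟶ ((E.toStable P).obj X₁)⟦(1 : ℤ)⟧ :=
  E.st (s.exists_conn h).choose ≫ (σ.iso X₁).inv

lemma δ_eq (h : E.Conf i p) (hc : s.Conn i p c) : σ.δ h = E.st c ≫ (σ.iso X₁).inv := by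
  rw [δ, (s.exists_conn h).choose_spec.st_eq hc h]

lemma δ_naturality (h : E.Conf i p) (h' : E.Conf i' p') (τ₁ : X₁.obj ⟶ Y₁.obj)
    (τ₂ : X₂.obj ⟶ Y₂.obj) (τ₃ : X₃.obj ⟶ Y₃.obj) (h₁ : i ≫ τ₂ = τ₁ ≫ i')
    (h₂ : p ≫ τ₃ = τ₂ ≫ p') :
    E.st τ₃ ≫ σ.δ h' = σ.δ h ≫ (E.st τ₁)⟦(1 : ℤ)⟧' := by
  obtain ⟨c, hc⟩ := s.exists_conn h
  obtain ⟨c', hc'⟩ := s.exists_conn h'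
  obtain ⟨g, hg⟩ := s.exists_ind τ₁
  rw [σ.δ_eq h hc, σ.δ_eq h' hc', ← Category.assoc, hc.naturality hc' h τ₁ τ₂ τ₃ h₁ h₂ hg,
    Category.assoc, σ.comm_inv hg, Category.assoc]

/-- The triangle in the stable category given by a conflation. -/
abbrev tri (h : E.Conf i p) : Triangle (E.Stable P) := Triangle.mk (E.st i) (E.st p) (σ.δ h)

/-- The distinguished triangles. -/
def Dist (T : Triangle (E.Stable P)) : Prop :=
  ∃ (X₁ X₂ X₃ : P.FullSubcategory) (i : X₁.obj ⟶ X₂.obj) (p : X₂.obj ⟶ X₃.obj) (h : E.Conf i p),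
    Nonempty (T ≅ σ.tri h)

variable {σ} in
lemma Dist.of_iso {T T' : Triangle (E.Stable P)} (h : σ.Dist T) (e : T' ≅ T) : σ.Dist T' := by
  obtain ⟨X₁, X₂, X₃, i, p, h, ⟨e'⟩⟩ := h
  exact ⟨X₁, X₂, X₃, i, p, h, ⟨e ≪≫ e'⟩⟩

lemma dist_tri (h : E.Conf i p) : σ.Dist (σ.tri h) := ⟨_, _, _, _, _, h, ⟨Iso.refl _⟩⟩

lemma dist_mk (h : E.Conf i p) {T : Triangle (E.Stable P)}
    (e₁ : T.obj₁ ≅ (E.toStable P).obj X₁) (e₂ : T.obj₂ ≅ (E.toStable P).obj X₂)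
    (e₃ : T.obj₃ ≅ (E.toStable P).obj X₃) (h₁ : T.mor₁ ≫ e₂.hom = e₁.hom ≫ E.st i)
    (h₂ : T.mor₂ ≫ e₃.hom = e₂.hom ≫ E.st p)
    (h₃ : T.mor₃ ≫ e₁.hom⟦(1 : ℤ)⟧' = e₃.hom ≫ σ.δ h) : σ.Dist T :=
  ⟨_, _, _, _, _, h, ⟨Triangle.isoMk _ _ e₁ e₂ e₃ h₁ h₂ h₃⟩⟩

/-- A square commuting up to a null map is made strictly commutative: the null homotopy extends
along the inflation i and is subtracted from b. Cokernels then supply c, and naturality of δ does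
the rest. -/
lemma exists_tri_hom (h : E.Conf i p) (h' : E.Conf i' p')
    (a : (E.toStable P).obj X₁ ⟶ (E.toStable P).obj Y₁)
    (b : (E.toStable P).obj X₂ ⟶ (E.toStable P).obj Y₂) (hab : E.st i ≫ b = a ≫ E.st i') :
    ∃ c : (E.toStable P).obj X₃ ⟶ (E.toStable P).obj Y₃, E.st p ≫ c = b ≫ E.st p' ∧
      σ.δ h ≫ a⟦(1 : ℤ)⟧' = c ≫ σ.δ h' := by
  obtain ⟨a, rfl⟩ := exists_st a
  obtain ⟨b, rfl⟩ := exists_st b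
  rw [← st_comp, ← st_comp, st_eq_iff] at hab
  obtain ⟨J, u, v, hJ, huv⟩ := hab
  obtain ⟨u', hu'⟩ := hJ.exists_extension h u
  have hb : E.st (b - u' ≫ v) = E.st b := by
    rw [st_eq_iff, sub_sub_cancel_left]
    exact ((Null.of_injective_left hJ v).comp_left u').neg
  have hsq : i ≫ (b - u' ≫ v) = a ≫ i' := by
    rw [Preadditive.comp_sub, reassoc_of% hu', ← huv, sub_sub_cancel]
  obtain ⟨c, hc⟩ := h.exists_desc ((b - u' ≫ v) ≫ p') (by rw [reassoc_of% hsq, h'.w, comp_zero])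
  refine ⟨E.st c, ?_, ?_⟩
  · rw [← hb, ← st_comp, ← st_comp, hc]
  · exact (σ.δ_naturality h h' a _ c hsq hc).symm

end Suspension.ShiftIso

end ExactStructure

end

/-! ### Existence of cones and morphisms of triangles -/

noncomputable section

open Pretriangulated

lemma CategoryTheory.Pretriangulated.Triangle.complete_of_iso {C : Type*} [Category* C]
    [HasShift C ℤ] {T₁ T₂ T₁' T₂' : Triangle C} (e : T₁ ≅ T₁') (e' : T₂ ≅ T₂')
    (H : ∀ (a : T₁'.obj₁ ⟶ T₂'.obj₁) (b : T₁'.obj₂ ⟶ T₂'.obj₂),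
      T₁'.mor₁ ≫ b = a ≫ T₂'.mor₁ → ∃ c : T₁'.obj₃ ⟶ T₂'.obj₃,
        T₁'.mor₂ ≫ c = b ≫ T₂'.mor₂ ∧ T₁'.mor₃ ≫ a⟦(1 : ℤ)⟧' = c ≫ T₂'.mor₃)
    (a : T₁.obj₁ ⟶ T₂.obj₁) (b : T₁.obj₂ ⟶ T₂.obj₂) (hab : T₁.mor₁ ≫ b = a ≫ T₂.mor₁) :
    ∃ c : T₁.obj₃ ⟶ T₂.obj₃, T₁.mor₂ ≫ c = b ≫ T₂.mor₂ ∧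
      T₁.mor₃ ≫ a⟦(1 : ℤ)⟧' = c ≫ T₂.mor₃ := by
  have r₁ : e.hom.hom₁ ≫ e.inv.hom₁ = 𝟙 T₁.obj₁ := congrArg (·.hom₁) e.hom_inv_id
  have r₂ : e.hom.hom₂ ≫ e.inv.hom₂ = 𝟙 T₁.obj₂ := congrArg (·.hom₂) e.hom_inv_id
  have r₁' : e'.hom.hom₁ ≫ e'.inv.hom₁ = 𝟙 T₂.obj₁ := congrArg (·.hom₁) e'.hom_inv_id
  have r₂' : e'.hom.hom₂ ≫ e'.inv.hom₂ = 𝟙 T₂.obj₂ := congrArg (·.hom₂) e'.hom_inv_id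
  obtain ⟨c, hc, hc'⟩ := H (e.inv.hom₁ ≫ a ≫ e'.hom.hom₁)
    (e.inv.hom₂ ≫ b ≫ e'.hom.hom₂) (by
      rw [e.inv.comm₁_assoc, reassoc_of% hab, e'.hom.comm₁, Category.assoc, Category.assoc])
  refine ⟨e.hom.hom₃ ≫ c ≫ e'.inv.hom₃, ?_, ?_⟩
  · rw [e.hom.comm₂_assoc, reassoc_of% hc, e'.inv.comm₂, reassoc_of% r₂, reassoc_of% r₂']
  · rw [Category.assoc, Category.assoc, ← e'.inv.comm₃, ← reassoc_of% hc', ← e.hom.comm₃_assoc,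
      ← Functor.map_comp, ← Functor.map_comp, Category.assoc, Category.assoc, r₁',
      Category.comp_id, reassoc_of% r₁]

namespace ExactStructure

attribute [local instance] preadditiveStable

variable {A : Type u} [Category.{v} A] [Preadditive A] [HasZeroObject A] [HasBinaryBiproducts A]
  {E : ExactStructure A}

/-- Given a morphism of conflations which is the identity on the third terms, the square on the
first and second terms gives a conflation. -/
lemma Conf.lift_desc_of_hom {K Q X Y Z : A} {k : K ⟶ Q} {q : Q ⟶ Z} (h : E.Conf k q)
    {i : X ⟶ Y} {p : Y ⟶ Z} (h' : E.Conf i p) {a : K ⟶ X} {b : Q ⟶ Y} (h₁ : a ≫ i = k ≫ b)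
    (h₂ : b ≫ p = q) : E.Conf (biprod.lift a k) (biprod.desc i (-b)) := by
  obtain ⟨D, g, j, r, sq, hg, hj⟩ := h.exists_pushout a
  have e₁ : j ≫ sq.desc b i h₁.symm = i := by simp
  have e₂ : sq.desc b i h₁.symm ≫ p = r := by
    refine sq.hom_ext ?_ ?_
    · simp [h₂, hg]
    · simp [h'.w, hj.w]
  have : IsIso (sq.desc b i h₁.symm) := hj.isIso_of_id_id h' _ e₁ e₂
  refine (Conf.lift_desc_of_isPushout h sq).of_iso (Iso.refl _) (Iso.refl _)
    (asIso (sq.desc b i h₁.symm)) (by simp) ?_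
  ext <;> simp

namespace InjectiveCotorsionPair

variable {M : E.InjectiveCotorsionPair}

variable (hA : WeaklyIdempotentComplete A)

include hA in
/-- Every morphism of the stable category is isomorphic to the image of an inflation. -/
lemma exists_inflation (s : E.Suspension M.F) {X Y : M.F.FullSubcategory}
    (φ : (E.toStable M.F).obj X ⟶ (E.toStable M.F).obj Y) :
    ∃ (Y' Z : M.F.FullSubcategory) (i : X.obj ⟶ Y'.obj) (p : Y'.obj ⟶ Z.obj)
      (e : (E.toStable M.F).obj Y ≅ (E.toStable M.F).obj Y'),
      E.Conf i p ∧ φ ≫ e.hom = E.st i := by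
  obtain ⟨f, rfl⟩ := exists_st φ
  -- The mapping cylinder: f is replaced by (f, ι) : X ⟶ Y ⊞ I, with the same stable target.
  obtain ⟨C, q, h⟩ := (s.conf X).exists_lift_conf f
  have hY : M.F (Y.obj ⊞ s.I X) := F_biprod hA Y.property (F_of_injectives (s.injective X))
  refine ⟨⟨_, hY⟩, ⟨C, F_right hA h X.property hY⟩, _, q,
    (stFstIso (s.injective X) hY).symm, h, ?_⟩
  rw [Iso.symm_hom, Iso.comp_inv_eq, stFstIso_hom, ← st_comp]
  exact congrArg _ (by simp)

variable {s : E.Suspension M.F} [HasShift (E.Stable M.F) ℤ] (σ : s.ShiftIso)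

lemma dist_contractible (X : E.Stable M.F) : σ.Dist (contractibleTriangle X) := by
  obtain ⟨X⟩ := X
  refine σ.dist_mk (X₁ := X) (X₂ := X) (X₃ := ⟨0, F_of_injectives injectives_zero⟩)
    (Conf.id_zero X.obj) (Iso.refl _) (Iso.refl _)
    ((isZero_zero _).iso (isZero_toStable injectives_zero)) ?_ ?_ ?_
  · change 𝟙 _ ≫ 𝟙 _ = 𝟙 _ ≫ E.st (𝟙 X.obj)
    rw [st_id]
  · exact (isZero_toStable injectives_zero).eq_of_tgt _ _
  · exact (isZero_zero _).eq_of_src _ _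

include hA in
lemma dist_cocone {X Y : E.Stable M.F} (φ : X ⟶ Y) :
    ∃ (Z : E.Stable M.F) (g : Y ⟶ Z) (h : Z ⟶ X⟦(1 : ℤ)⟧), σ.Dist (Triangle.mk φ g h) := by
  obtain ⟨X⟩ := X
  obtain ⟨Y⟩ := Y
  obtain ⟨Y', Z, i, p, e, h, hi⟩ := exists_inflation hA s (X := X) (Y := Y) φ
  refine ⟨_, e.hom ≫ E.st p, σ.δ h, σ.dist_mk h (Iso.refl _) e (Iso.refl _) ?_ ?_ ?_⟩
  · exact hi.trans (Category.id_comp _).symm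
  · exact Category.comp_id _
  · refine (?_ : σ.δ h ≫ (𝟙 _)⟦(1 : ℤ)⟧' = 𝟙 _ ≫ σ.δ h)
    rw [CategoryTheory.Functor.map_id, Category.comp_id, Category.id_comp]

lemma dist_complete {T₁ T₂ : Triangle (E.Stable M.F)} (h₁ : σ.Dist T₁) (h₂ : σ.Dist T₂)
    (a : T₁.obj₁ ⟶ T₂.obj₁) (b : T₁.obj₂ ⟶ T₂.obj₂) (hab : T₁.mor₁ ≫ b = a ≫ T₂.mor₁) :
    ∃ c : T₁.obj₃ ⟶ T₂.obj₃, T₁.mor₂ ≫ c = b ≫ T₂.mor₂ ∧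
      T₁.mor₃ ≫ a⟦(1 : ℤ)⟧' = c ≫ T₂.mor₃ := by
  obtain ⟨X₁, X₂, X₃, i, p, h, ⟨e⟩⟩ := h₁
  obtain ⟨Y₁, Y₂, Y₃, i', p', h', ⟨e'⟩⟩ := h₂
  exact Triangle.complete_of_iso e e' (fun a b hab => σ.exists_tri_hom h h' a b hab) a b hab

end InjectiveCotorsionPair

end ExactStructure

end

/-! ### Rotation and the octahedral axiom -/

noncomputable section

open Pretriangulated

namespace ExactStructure

attribute [local instance] preadditiveStable

variable {A : Type u} [Category.{v} A] [Preadditive A] [HasZeroObject A] [HasBinaryBiproducts A]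
  {E : ExactStructure A}

namespace InjectiveCotorsionPair

variable {M : E.InjectiveCotorsionPair}

section

variable {s : E.Suspension M.F} [HasShift (E.Stable M.F) ℤ] (σ : s.ShiftIso)

/-- The connecting morphism of the rotated conflation. -/
lemma conn_rotate {X₁ X₂ X₃ : M.F.FullSubcategory} {i : X₁.obj ⟶ X₂.obj} {p : X₂.obj ⟶ X₃.obj}
    (h : E.Conf i p) {b : X₂.obj ⟶ s.I X₁} {c : X₃.obj ⟶ (s.obj X₁).obj} (hb : i ≫ b = s.ι X₁)
    (hF : M.F (X₃.obj ⊞ s.I X₁))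
    (hk : E.Conf (biprod.lift p b) (biprod.desc c (-s.π X₁))) :
    σ.δ (X₂ := ⟨_, hF⟩) hk = -((σ.iso X₁).inv ≫ (E.st i)⟦(1 : ℤ)⟧') := by
  have hI : M.F (s.I X₁) := F_of_injectives (s.injective X₁)
  obtain ⟨d, hd⟩ := s.exists_conn (X₂ := ⟨_, hF⟩) hk
  obtain ⟨g, hg⟩ := s.exists_ind i
  -- Naturality along the morphism (-i, -inr, 𝟙) from the chosen conflation of X₁. The sign is
  -- forced by the -π in the second map of the rotated conflation, and it is the sign of
  -- `Triangle.rotate`.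
  have := (s.conn_id X₁ hI).naturality hd (s.conf X₁) (-i) (-biprod.inr) (𝟙 _)
    (by ext <;> simp [h.w, hb]) (by simp) hg.neg
  rw [st_id, Category.id_comp, Category.id_comp] at this
  rw [σ.δ_eq hk hd, this, st_neg, Preadditive.neg_comp, σ.comm_inv hg]

variable (hA : WeaklyIdempotentComplete A)

include hA in
lemma dist_rotate_tri {X₁ X₂ X₃ : M.F.FullSubcategory} {i : X₁.obj ⟶ X₂.obj}
    {p : X₂.obj ⟶ X₃.obj} (h : E.Conf i p) : σ.Dist (σ.tri h).rotate := by
  obtain ⟨c, hc⟩ := s.exists_conn h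
  obtain ⟨b, hb, hbc⟩ := id hc
  have hF : M.F (X₃.obj ⊞ s.I X₁) := F_biprod hA X₃.property (F_of_injectives (s.injective X₁))
  -- The map to the chosen conflation is the identity on X₁, so its right square is a pullback,
  -- which is turned into a conflation X₂ ⟶ X₃ ⊞ I ⟶ ΣX₁.
  have hk : E.Conf (biprod.lift p b) (biprod.desc c (-s.π X₁)) :=
    Conf.lift_desc_of_isPullback (s.conf X₁) (h.isPullback (s.conf X₁) hb hbc.symm)
  have hk' := conn_rotate σ h hb hF hk
  refine σ.dist_mk (X₁ := X₂) (X₂ := ⟨_, hF⟩) (X₃ := s.obj X₁) hk (Iso.refl _)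
    (stFstIso (s.injective X₁) hF).symm (σ.iso X₁) ?_ ?_ ?_
  · change E.st p ≫ (stFstIso (s.injective X₁) hF).inv = 𝟙 _ ≫ _
    rw [Iso.comp_inv_eq, Category.id_comp, stFstIso_hom, ← st_comp]
    exact congrArg _ (by simp)
  · change σ.δ h ≫ (σ.iso X₁).hom = (stFstIso (s.injective X₁) hF).inv ≫ _
    rw [stFstIso_inv, ← st_comp, σ.δ_eq h hc, Category.assoc, Iso.inv_hom_id, Category.comp_id]
    exact congrArg _ (by simp)
  · change (-(E.st i)⟦(1 : ℤ)⟧') ≫ (𝟙 _)⟦(1 : ℤ)⟧' = (σ.iso X₁).hom ≫ _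
    rw [hk', CategoryTheory.Functor.map_id, Category.comp_id, Preadditive.comp_neg,
      Iso.hom_inv_id_assoc]

include hA in
lemma dist_rotate {T : Triangle (E.Stable M.F)} (hT : σ.Dist T) : σ.Dist T.rotate := by
  obtain ⟨X₁, X₂, X₃, i, p, h, ⟨e⟩⟩ := hT
  exact (dist_rotate_tri σ hA h).of_iso ((rotate _).mapIso e)

include hA in
/-- The triangle of a conflation is a rotation. -/
lemma exists_rotate_iso {X₁ X₂ X₃ : M.F.FullSubcategory} {i : X₁.obj ⟶ X₂.obj}
    {p : X₂.obj ⟶ X₃.obj} (h : E.Conf i p) :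
    ∃ T, σ.Dist T ∧ Nonempty (T.rotate ≅ σ.tri h) := by
  -- K is a desuspension of X₃, and K ⟶ X₁ ⊞ Q ⟶ X₂ is a conflation whose rotated triangle is the
  -- given one.
  obtain ⟨K, Q, k, q, hK, hQ, hkq⟩ := exists_injective_cover hA X₃.property
  obtain ⟨b, hb⟩ := (M.ext (W_of_injectives hQ) X₁.property).exists_lift h q
  obtain ⟨a, ha⟩ := h.exists_lift (k ≫ b) (by rw [Category.assoc, hb, hkq.w])
  have h' := hkq.lift_desc_of_hom h ha hb
  have hF : M.F (X₁.obj ⊞ Q) := F_biprod hA X₁.property (F_of_injectives hQ)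
  let K' : M.F.FullSubcategory := ⟨K, hK⟩
  let Q' : M.F.FullSubcategory := ⟨Q, F_of_injectives hQ⟩
  let Y' : M.F.FullSubcategory := ⟨X₁.obj ⊞ Q, hF⟩
  obtain ⟨κ, hκ⟩ := s.exists_conn (X₁ := K') (X₂ := Q') (X₃ := X₃) hkq
  have := hκ.isIso hkq hQ
  have hδκ := σ.δ_eq hkq hκ
  have nat₁ := σ.δ_naturality (X₁ := K') (X₂ := Y') (X₃ := X₂) (Y₁ := K') (Y₂ := Q') (Y₃ := X₃)
    h' hkq (𝟙 K) biprod.snd (-p) ((biprod.lift_snd a k).trans (Category.id_comp k).symm) (by ext <;> simp [h.w, hb])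
  have nat₂ := σ.δ_naturality (X₁ := K') (X₂ := Q') (X₃ := X₃) hkq h a b (𝟙 X₃.obj) ha.symm
    (by simp [hb])
  have hid : E.st (X := K') (Y := K') (𝟙 K) = 𝟙 _ := st_id K'
  rw [hid, CategoryTheory.Functor.map_id, Category.comp_id, st_neg, Preadditive.neg_comp] at nat₁
  rw [st_id, Category.id_comp] at nat₂
  -- The minus sign compensates both that of the rotation and that of -p in nat₁.
  let e : ((E.toStable M.F).obj K')⟦(1 : ℤ)⟧ ≅ (E.toStable M.F).obj X₃ :=
    { hom := -((σ.iso K').hom ≫ inv (E.st κ))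
      inv := -(E.st κ ≫ (σ.iso K').inv) }
  have he : e.inv = -σ.δ (X₁ := K') (X₂ := Q') (X₃ := X₃) hkq := congrArg _ hδκ.symm
  refine ⟨_, σ.dist_tri (X₁ := K') (X₂ := Y') (X₃ := X₂) h',
    ⟨Triangle.isoMk _ _ (stFstIso hQ hF) (Iso.refl _) e ?_ ?_ ?_⟩⟩
  · change E.st (X := Y') (biprod.desc i (-b)) ≫ 𝟙 _ = E.st (X := Y') (Y := X₁) biprod.fst ≫ E.st i
    rw [Category.comp_id, ← st_comp, st_eq_iff]
    have : biprod.desc i (-b) - biprod.fst ≫ i = biprod.snd ≫ (-b) := by ext <;> simp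
    rw [this]
    exact (Null.of_injective_left hQ _).comp_left _
  · change σ.δ (X₁ := K') (X₂ := Y') (X₃ := X₂) h' ≫ e.hom = 𝟙 _ ≫ E.st p
    rw [← Iso.eq_comp_inv, Category.id_comp, he, Preadditive.comp_neg]
    exact nat₁.symm
  · change (-(E.st (X := K') (Y := Y') (biprod.lift a k))⟦(1 : ℤ)⟧') ≫
      (E.st (X := Y') (Y := X₁) biprod.fst)⟦(1 : ℤ)⟧' = e.hom ≫ σ.δ h
    rw [← Iso.inv_comp_eq, he, Preadditive.neg_comp, Preadditive.neg_comp, Preadditive.comp_neg, neg_neg,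
      ← Functor.map_comp, ← st_comp]
    refine Eq.trans ?_ nat₂.symm
    have : (biprod.lift a k ≫ biprod.fst : K ⟶ X₁.obj) = a := by simp
    exact congrArg (fun z => σ.δ (X₁ := K') (X₂ := Q') (X₃ := X₃) hkq ≫
      (E.st (X := K') (Y := X₁) z)⟦(1 : ℤ)⟧') this

variable [∀ n : ℤ, (shiftFunctor (E.Stable M.F) n).Additive]

-- Rotation is fully faithful, so it suffices that the triangle of every conflation be the rotation
-- of a distinguished one.
include hA in
lemma dist_of_rotate {T : Triangle (E.Stable M.F)} (hT : σ.Dist T.rotate) : σ.Dist T := by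
  obtain ⟨X₁, X₂, X₃, i, p, h, ⟨e⟩⟩ := hT
  obtain ⟨T', hT', ⟨φ⟩⟩ := exists_rotate_iso σ hA h
  exact hT'.of_iso ((rotate (E.Stable M.F)).preimageIso (e ≪≫ φ.symm))

/-- The stable category is pretriangulated. -/
@[reducible]
def pretriangulatedStable : Pretriangulated (E.Stable M.F) where
  distinguishedTriangles := {T | σ.Dist T}
  isomorphic_distinguished _ h _ e := Suspension.ShiftIso.Dist.of_iso h e
  contractible_distinguished := dist_contractible σ
  distinguished_cocone_triangle := dist_cocone hA σ
  rotate_distinguished_triangle _ := ⟨dist_rotate σ hA, dist_of_rotate σ hA⟩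
  complete_distinguished_triangle_morphism _ _ h₁ h₂ := dist_complete σ h₁ h₂

/-- Up to isomorphism the two maps are composable inflations, and the octahedron is Noether's
conflation X₂/X₁ ⟶ X₃/X₁ ⟶ X₃/X₂. Its commutativities are three instances of the naturality of δ. -/
lemma isTriangulated_stable :
    letI := pretriangulatedStable σ hA
    IsTriangulated (E.Stable M.F) := by
  let := pretriangulatedStable σ hA
  refine IsTriangulated.mk' fun X Y Z φ ψ => ?_
  obtain ⟨X⟩ := X
  obtain ⟨Y⟩ := Y
  obtain ⟨Z⟩ := Z
  obtain ⟨Y', C₁, i, p, e₂, h₁, hi⟩ := exists_inflation hA s (X := X) (Y := Y) φ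
  obtain ⟨Z', C₂, j, q, e₃, h₂, hj⟩ := exists_inflation hA s (X := Y') (Y := Z) (e₂.inv ≫ ψ)
  obtain ⟨B, r, a, b, h₃, h₄, sq, hr⟩ := h₁.noether h₂
  let B' : M.F.FullSubcategory := ⟨B, F_right hA h₃ X.property Z'.property⟩
  have hij : E.st i ≫ E.st j = E.st (X := X) (Y := Z') (i ≫ j) := (st_comp i j).symm
  have n₁ := σ.δ_naturality (X₃ := C₁) (Y₃ := B') h₁ h₃ (𝟙 X.obj) j a (by simp) sq.w.symm
  have n₂ := σ.δ_naturality (X₃ := B') (Y₃ := C₂) h₃ h₂ i (𝟙 Z'.obj) b (by simp) (by simp [hr])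
  have n₃ := σ.δ_naturality (X₃ := C₂) (Y₁ := C₁) (Y₂ := B') (Y₃ := C₂) h₂ h₄ p r (𝟙 C₂.obj) sq.w
    (by simp [hr])
  rw [st_id, CategoryTheory.Functor.map_id, Category.comp_id] at n₁
  rw [st_id, Category.id_comp] at n₃
  have d₃ : Triangle.mk (E.st i ≫ E.st j) (E.st (Y := B') r) (σ.δ (X₃ := B') h₃) ∈
      distTriang (E.Stable M.F) := by
    rw [hij]; exact σ.dist_tri (X₃ := B') h₃
  refine ⟨_, _, _, _, _, _, E.st i, E.st j, Iso.refl _, e₂, e₃, ?_, ?_, E.st p, σ.δ h₁,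
    σ.dist_tri h₁, E.st q, σ.δ h₂, σ.dist_tri h₂, E.st (Y := B') r, σ.δ (X₃ := B') h₃, d₃,
    ⟨{ m₁ := E.st (X := C₁) (Y := B') a, m₃ := E.st (X := B') (Y := C₂) b
       comm₁ := ?_, comm₂ := n₁, comm₃ := ?_, comm₄ := n₂.symm, mem := ?_ }⟩⟩
  · exact hi.trans (Category.id_comp _).symm
  · rw [← hj, Category.assoc, Iso.hom_inv_id_assoc]
  · exact (st_comp (Z := B') p a).symm.trans
      ((congrArg _ sq.w.symm).trans (st_comp (Z := B') j r))
  · exact (st_comp (Y := B') r b).symm.trans (congrArg _ hr)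
  · have := σ.dist_tri (X₁ := C₁) (X₂ := B') (X₃ := C₂) h₄
    rw [Suspension.ShiftIso.tri, n₃] at this
    exact this

end

/-- The triangulated structure of the stable category. -/
@[reducible]
def triangulatedStable {s : E.Suspension M.F} [HasShift (E.Stable M.F) ℤ] (σ : s.ShiftIso)
    (hA : WeaklyIdempotentComplete A) : TriangulatedStructure (E.Stable M.F) :=
  have : HasBinaryBiproducts (E.Stable M.F) := hasBinaryBiproducts_stable fun _ _ => F_biprod hA
  have : ∀ n : ℤ, (shiftFunctor (E.Stable M.F) n).Additive := fun _ => additive_of_isEquivalence _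
  { preadditive := preadditiveStable
    hasZeroObject := inferInstance
    hasShift := inferInstance
    shift_additive := inferInstance
    pretriangulated := pretriangulatedStable σ hA
    isTriangulated := isTriangulated_stable σ hA }

variable (M) in
/-- The stable category of an injective cotorsion pair is triangulated. -/
theorem exists_isTriangulatedAlong_toStable (hA : WeaklyIdempotentComplete A)
    (hE : E.EnoughInjectives) : ∃ _ : TriangulatedStructure (E.Stable M.F),
      IsTriangulatedAlong (E.conflationIn M.F) (E.toStable M.F) := by
  obtain ⟨s⟩ := M.nonempty_suspension hA hE
  have := isEquivalence_suspension s hA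
  obtain ⟨_, ⟨τ⟩⟩ := exists_hasShift s.functor
  let σ : s.ShiftIso :=
    { iso := fun X => τ.app _ ≪≫ s.functorObjIso X
      comm := fun {X Y f g} h => by
        change (E.st f)⟦(1 : ℤ)⟧' ≫ τ.hom.app _ ≫ _ = (τ.hom.app _ ≫ _) ≫ _
        rw [τ.hom.naturality_assoc, h.functor_map, Category.assoc] }
  refine ⟨triangulatedStable σ hA, inferInstance, fun S hS => σ.δ ⟨_, hS⟩,
    fun S S' hS hS' φ => ?_, fun t => ⟨?_, ?_⟩⟩
  · exact σ.δ_naturality ⟨_, hS⟩ ⟨_, hS'⟩ φ.τ₁.hom φ.τ₂.hom φ.τ₃.hom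
      (congrArg (·.hom) φ.comm₁₂).symm (congrArg (·.hom) φ.comm₂₃).symm
  · rintro ⟨X₁, X₂, X₃, i, p, h, ⟨e⟩⟩
    exact ⟨ShortComplex.mk (ObjectProperty.homMk i) (ObjectProperty.homMk p)
      (ObjectProperty.hom_ext _ h.1), h.2, ⟨e⟩⟩
  · rintro ⟨S, hS, ⟨e⟩⟩
    exact ⟨_, _, _, _, _, ⟨_, hS⟩, ⟨e⟩⟩

end InjectiveCotorsionPair

end ExactStructure

end

/-! ### Induced triangulated structures and exactness of adjoints -/

noncomputable section

open Pretriangulated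

namespace CategoryTheory.Functor

variable {C D : Type*} [Category* C] [Category* D] [HasZeroObject C] [HasZeroObject D]
  [Preadditive C] [Preadditive D] [HasShift C ℤ] [HasShift D ℤ]
  [∀ n : ℤ, (shiftFunctor C n).Additive] [∀ n : ℤ, (shiftFunctor D n).Additive]
  [Pretriangulated D] (F : C ⥤ D) [F.CommShift ℤ] [F.Additive] [F.Full] [F.Faithful]

/-- The pretriangulated structure induced by a fully faithful functor whose essential image is
closed under cones. -/
@[reducible]
def inducedPretriangulated (hF : ∀ ⦃X Y : C⦄ (f : X ⟶ Y), ∃ (Z : C) (g : F.obj Y ⟶ F.obj Z)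
      (h : F.obj Z ⟶ (F.obj X)⟦(1 : ℤ)⟧), Triangle.mk (F.map f) g h ∈ distTriang D) :
    Pretriangulated C where
  distinguishedTriangles := F.mapTriangle.obj ⁻¹' (distTriang D)
  isomorphic_distinguished T₁ hT₁ T₂ e :=
    isomorphic_distinguished _ hT₁ _ (F.mapTriangle.mapIso e)
  contractible_distinguished X :=
    isomorphic_distinguished _ (contractible_distinguished (F.obj X)) _
      (Triangle.isoMk _ _ (Iso.refl _) (Iso.refl _) F.mapZeroObject
        (by change F.map (𝟙 X) ≫ 𝟙 _ = 𝟙 _ ≫ 𝟙 _; simp)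
        ((isZero_zero D).eq_of_tgt _ _)
        ((F.map_isZero (isZero_zero C)).eq_of_src _ _))
  distinguished_cocone_triangle {X Y} f := by
    obtain ⟨Z, g, h, mem⟩ := hF f
    obtain ⟨g, rfl⟩ := F.map_surjective g
    obtain ⟨h', hh'⟩ := F.map_surjective (h ≫ (F.commShiftIso (1 : ℤ)).inv.app X)
    refine ⟨Z, g, h', isomorphic_distinguished _ mem _
      (Triangle.isoMk _ _ (Iso.refl _) (Iso.refl _) (Iso.refl _) ?_ ?_ ?_)⟩
    · exact (Category.comp_id _).trans (Category.id_comp _).symm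
    · exact (Category.comp_id _).trans (Category.id_comp _).symm
    · change (F.map h' ≫ (F.commShiftIso (1 : ℤ)).hom.app X) ≫ (𝟙 (F.obj X))⟦(1 : ℤ)⟧' = 𝟙 _ ≫ h
      have : F.map h' ≫ (F.commShiftIso (1 : ℤ)).hom.app X = h := by
        rw [hh', Category.assoc]
        exact (congrArg (h ≫ ·) (Iso.inv_hom_id_app (F.commShiftIso (1 : ℤ)) X)).trans
          (Category.comp_id h)
      exact (congr_arg₂ _ this (CategoryTheory.Functor.map_id _ _)).trans
        ((Category.comp_id h).trans (Category.id_comp h).symm)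
  rotate_distinguished_triangle T :=
    (rotate_distinguished_triangle (F.mapTriangle.obj T)).trans
      (distinguished_iff_of_iso (F.mapTriangleRotateIso.app T))
  complete_distinguished_triangle_morphism T₁ T₂ hT₁ hT₂ a b comm := by
    obtain ⟨c, hc₁, hc₂⟩ := complete_distinguished_triangle_morphism (F.mapTriangle.obj T₁)
      (F.mapTriangle.obj T₂) hT₁ hT₂ (F.map a) (F.map b)
      (by
        change F.map _ ≫ F.map _ = F.map _ ≫ F.map _
        rw [← F.map_comp, ← F.map_comp, comm])
    obtain ⟨c, rfl⟩ := F.map_surjective (X := T₁.obj₃) (Y := T₂.obj₃) c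
    replace hc₁ : F.map T₁.mor₂ ≫ F.map c = F.map b ≫ F.map T₂.mor₂ := hc₁
    replace hc₂ : (F.map T₁.mor₃ ≫ (F.commShiftIso (1 : ℤ)).hom.app T₁.obj₁) ≫ (F.map a)⟦(1 : ℤ)⟧' =
      F.map c ≫ F.map T₂.mor₃ ≫ (F.commShiftIso (1 : ℤ)).hom.app T₂.obj₁ := hc₂
    refine ⟨c, F.map_injective ?_, F.map_injective ?_⟩
    · rw [F.map_comp, F.map_comp, hc₁]
    · rw [F.map_comp, F.map_comp, ← cancel_mono ((F.commShiftIso (1 : ℤ)).hom.app T₂.obj₁),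
        Category.assoc, Category.assoc, ← hc₂, Category.assoc]
      exact congrArg _ (F.commShiftIso_hom_naturality a (1 : ℤ))

/-- Closure of the image under shift is given objectwise; full faithfulness makes the chosen
preimages functorial. -/
lemma exists_shiftIso {C D : Type*} [Category* C] [Category* D] [HasShift D ℤ] (F : C ⥤ D) [F.Full]
    [F.Faithful] (hF : ∀ (n : ℤ) (X : C), F.essImage ((F.obj X)⟦n⟧)) (n : ℤ) :
    ∃ s : C ⥤ C, Nonempty (s ⋙ F ≅ F ⋙ shiftFunctor D n) := by
  let e (X : C) : F.obj (hF n X).witness ≅ (F.obj X)⟦n⟧ := (hF n X).getIso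
  let s : C ⥤ C :=
    { obj := fun X => (hF n X).witness
      map := fun {X Y} f => F.preimage ((e X).hom ≫ (F.map f)⟦n⟧' ≫ (e Y).inv)
      map_id := fun X => F.map_injective (by simp)
      map_comp := fun f g => F.map_injective (by simp) }
  exact ⟨s, ⟨NatIso.ofComponents e (fun {X Y} f => by
    change F.map (F.preimage _) ≫ (e Y).hom = (e X).hom ≫ (F.map f)⟦n⟧'
    simp)⟩⟩

end CategoryTheory.Functor

/-- The triangulated structure induced by a fully faithful functor whose essential image is
closed under shifts and cones. -/
theorem exists_inducedTriangulatedStructure {T T' : Type*} [Category* T] [Category* T']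
    [TriangulatedStructure T] (J : T' ⥤ T) [J.Full] [J.Faithful]
    (h₀ : ∃ Z, IsZero (J.obj Z)) (h₁ : ∀ (n : ℤ) (X : T'), J.essImage ((J.obj X)⟦n⟧))
    (h₂ : ∀ ⦃X Y : T'⦄ (f : X ⟶ Y), ∃ (Z : T') (g : J.obj Y ⟶ J.obj Z)
      (h : J.obj Z ⟶ (J.obj X)⟦(1 : ℤ)⟧), Triangle.mk (J.map f) g h ∈ distTriang T) :
    ∃ (_ : TriangulatedStructure T') (_ : J.CommShift ℤ), J.Additive ∧
      ∀ t, t ∈ distTriang T' ↔ J.mapTriangle.obj t ∈ distTriang T := by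
  let : Preadditive T' := .ofFullyFaithful (Functor.FullyFaithful.ofFullyFaithful J)
  have : J.Additive := Functor.FullyFaithful.additive_ofFullyFaithful (.ofFullyFaithful J)
  have : HasZeroObject T' := by
    obtain ⟨Z, hZ⟩ := h₀
    refine ⟨Z, ?_⟩
    rw [IsZero.iff_id_eq_zero] at hZ ⊢
    exact J.map_injective (by rw [J.map_id, hZ, J.map_zero])
  choose s i using J.exists_shiftIso h₁
  let hJ := Functor.FullyFaithful.ofFullyFaithful J
  let : HasShift T' ℤ := hJ.hasShift s (fun n => (i n).some)
  let : J.CommShift ℤ := .ofHasShiftOfFullyFaithful hJ s (fun n => (i n).some)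
  have : ∀ n : ℤ, (shiftFunctor T' n).Additive := fun n => by
    have : (shiftFunctor T' n ⋙ J).Additive := Functor.additive_of_iso (J.commShiftIso n).symm
    exact ⟨fun {X Y f g} => J.map_injective (by
      rw [J.map_add]
      exact (shiftFunctor T' n ⋙ J).map_add)⟩
  let : Pretriangulated T' := J.inducedPretriangulated h₂
  have : J.IsTriangulated := ⟨fun _ h => h⟩
  have : IsTriangulated T' := IsTriangulated.of_fully_faithful_triangulated_functor J
  exact ⟨{ preadditive := inferInstance
           hasZeroObject := inferInstance
           hasShift := inferInstance
           shift_additive := inferInstance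
           pretriangulated := inferInstance
           isTriangulated := inferInstance }, inferInstance, inferInstance, fun _ => Iff.rfl⟩

/-- In the recollement only I and ρ are shown to be exact directly; the other four functors are
reached from them through adjunctions. -/
lemma IsExactFunctor.rightAdjoint {T T' : Type*} [Category* T] [Category* T']
    [TriangulatedStructure T] [TriangulatedStructure T'] {F : T ⥤ T'} {G : T' ⥤ T}
    (hF : IsExactFunctor F) (adj : F ⊣ G) : IsExactFunctor G := by
  obtain ⟨_, _⟩ := hF
  let := adj.rightAdjointCommShift ℤ
  have := adj.commShift_of_leftAdjoint ℤ
  exact ⟨inferInstance, adj.isTriangulated_rightAdjoint⟩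

lemma IsExactFunctor.leftAdjoint {T T' : Type*} [Category* T] [Category* T']
    [TriangulatedStructure T] [TriangulatedStructure T'] {F : T ⥤ T'} {G : T' ⥤ T}
    (hG : IsExactFunctor G) (adj : F ⊣ G) : IsExactFunctor F := by
  obtain ⟨_, _⟩ := hG
  let := adj.leftAdjointCommShift ℤ
  have := adj.commShift_of_rightAdjoint ℤ
  exact ⟨inferInstance, adj.isTriangulated_leftAdjoint⟩

end

/-! ### Special preenvelopes and morphisms of the localization -/

noncomputable section

/-- Each object of the localization is the image of an object of C, so an isomorphism extends with
its components unchanged. The prescribed components are what later identifies the unit with the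
preenvelopes. -/
lemma exists_localizationNatIso {C D : Type*} [Category* C] [Category* D] (W : MorphismProperty C)
    (F G : W.Localization ⥤ D) (τ : W.Q ⋙ F ≅ W.Q ⋙ G) :
    ∃ σ : F ≅ G, ∀ X, σ.hom.app (W.Q.obj X) = τ.hom.app X := by
  let α := Localization.Construction.natTransExtension τ.hom
  have hα : ∀ X, α.app (W.Q.obj X) = τ.hom.app X := fun X =>
    Localization.Construction.NatTransExtension.app_eq _ _
  have (Z : W.Localization) : IsIso (α.app Z) := by
    obtain ⟨X, rfl⟩ := (Localization.Construction.objEquiv W).surjective Z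
    change IsIso (α.app (W.Q.obj X))
    rw [hα]
    infer_instance
  have := NatIso.isIso_of_isIso_app α
  exact ⟨asIso α, hα⟩

namespace ExactStructure

variable {A : Type u} [Category.{v} A] [Preadditive A] [HasZeroObject A] [HasBinaryBiproducts A]
  {E : ExactStructure A}

namespace InjectiveCotorsionPair

lemma IsSpecialPreenvelope.exists_extension {M : E.InjectiveCotorsionPair} {X R Y : A} {j : X ⟶ R}
    (hj : M.IsSpecialPreenvelope j) (hY : M.F Y) (f : X ⟶ Y) : ∃ g : R ⟶ Y, j ≫ g = f := by
  obtain ⟨-, hj⟩ := hj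
  obtain ⟨C, p, h, hC⟩ := monoWithCokernel_iff.1 hj
  exact (M.ext hC hY).exists_extension h f

lemma IsSpecialPreenvelope.null {M : E.InjectiveCotorsionPair} (hA : WeaklyIdempotentComplete A)
    {X R Y : A} {j : X ⟶ R}
    (hj : M.IsSpecialPreenvelope j) (hY : M.F Y) {g : R ⟶ Y} (h : E.Null (j ≫ g)) : E.Null g := by
  obtain ⟨-, hj⟩ := hj
  obtain ⟨C, p, hc, hC⟩ := monoWithCokernel_iff.1 hj
  exact null_sub_of_conf hA hc hC hY g h

/-- A special preenvelope of an object of `F` is a stable isomorphism. -/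
lemma IsSpecialPreenvelope.exists_retraction {M : E.InjectiveCotorsionPair}
    (hA : WeaklyIdempotentComplete A) {X R : A} {j : X ⟶ R} (hj : M.IsSpecialPreenvelope j)
    (hX : M.F X) : ∃ r : R ⟶ X, j ≫ r = 𝟙 X ∧ E.Null (r ≫ j - 𝟙 R) := by
  obtain ⟨r, hr⟩ := hj.exists_extension hX (𝟙 X)
  refine ⟨r, hr, hj.null hA hj.1 ?_⟩
  rw [Preadditive.comp_sub, reassoc_of% hr, Category.comp_id, sub_self]
  exact Null.zero

lemma IsSpecialPreenvelope.comp {M : E.InjectiveCotorsionPair} {X Y R : A} {i : X ⟶ Y} {j : Y ⟶ R}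
    (hj : M.IsSpecialPreenvelope j) (hi : E.monoWithCokernel M.W i) :
    M.IsSpecialPreenvelope (i ≫ j) := by
  obtain ⟨hR, hj⟩ := hj
  obtain ⟨C, p, h, hC⟩ := monoWithCokernel_iff.1 hi
  obtain ⟨D, q, h', hD⟩ := monoWithCokernel_iff.1 hj
  obtain ⟨B, r, a, b, h₁, h₂, -, -⟩ := h.noether h'
  exact ⟨hR, monoWithCokernel_iff.2 ⟨B, r, h₁, W_middle h₂ hC hD⟩⟩

variable (M : E.InjectiveCotorsionPair)

/-- The target of a chosen special preenvelope. -/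
def env (X : A) : M.F.FullSubcategory :=
  ⟨(M.complete.preenvelope X).choose, (M.complete.preenvelope X).choose_spec.choose_spec.1⟩

/-- A chosen special preenvelope. -/
def toEnv (X : A) : X ⟶ (M.env X).obj := (M.complete.preenvelope X).choose_spec.choose

lemma isSpecialPreenvelope_toEnv (X : A) : M.IsSpecialPreenvelope (M.toEnv X) :=
  (M.complete.preenvelope X).choose_spec.choose_spec

/-- An extension to the chosen special preenvelopes. -/
def envMap {X Y : A} (f : X ⟶ Y) : (M.env X).obj ⟶ (M.env Y).obj :=
  ((M.isSpecialPreenvelope_toEnv X).exists_extension (M.env Y).property (f ≫ M.toEnv Y)).choose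

lemma toEnv_envMap {X Y : A} (f : X ⟶ Y) : M.toEnv X ≫ M.envMap f = f ≫ M.toEnv Y :=
  ((M.isSpecialPreenvelope_toEnv X).exists_extension
    (M.env Y).property (f ≫ M.toEnv Y)).choose_spec

lemma toEnv_envMap_assoc {X Y Z : A} (f : X ⟶ Y) (g : (M.env Y).obj ⟶ Z) :
    M.toEnv X ≫ M.envMap f ≫ g = f ≫ M.toEnv Y ≫ g := by
  rw [← Category.assoc, toEnv_envMap, Category.assoc]

variable {M} in
lemma st_eq_of_toEnv_comp (hA : WeaklyIdempotentComplete A) {X : A} {Y : M.F.FullSubcategory}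
    {g g' : (M.env X).obj ⟶ Y.obj} (h : E.Null (M.toEnv X ≫ g - M.toEnv X ≫ g')) :
    E.st g = E.st g' := by
  rw [st_eq_iff]
  refine (M.isSpecialPreenvelope_toEnv X).null hA Y.property ?_
  rwa [Preadditive.comp_sub]

/-- The functor given by special preenvelopes. -/
@[reducible]
def envFunctor (hA : WeaklyIdempotentComplete A) : A ⥤ E.Stable M.F where
  obj X := (E.toStable M.F).obj (M.env X)
  map f := E.st (M.envMap f)
  map_id X := by
    rw [← st_id]
    refine st_eq_of_toEnv_comp hA ?_
    rw [toEnv_envMap, Category.id_comp, Category.comp_id, sub_self]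
    exact Null.zero
  map_comp f g := by
    rw [← st_comp]
    refine st_eq_of_toEnv_comp hA ?_
    rw [toEnv_envMap, toEnv_envMap_assoc, toEnv_envMap, Category.assoc, sub_self]
    exact Null.zero

variable {M} (hA : WeaklyIdempotentComplete A)

lemma envFunctor_map_eq {X Y : A} {f : X ⟶ Y} {g : (M.env X).obj ⟶ (M.env Y).obj}
    (h : E.Null (M.toEnv X ≫ g - f ≫ M.toEnv Y)) : (M.envFunctor hA).map f = E.st g := by
  refine (st_eq_of_toEnv_comp hA ?_).symm
  rwa [toEnv_envMap]

lemma envFunctor_map_eq_of_null {X Y : A} {f g : X ⟶ Y} (h : E.Null (f - g)) :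
    (M.envFunctor hA).map f = (M.envFunctor hA).map g := by
  refine envFunctor_map_eq hA ?_
  rw [toEnv_envMap, ← Preadditive.sub_comp, ← neg_sub]
  exact h.neg.comp_right _

/-- Following i by the preenvelope of Y gives another special preenvelope of X, and two of these are
stably isomorphic. -/
lemma isIso_envFunctor_map_of_inflation {X Y : A} {i : X ⟶ Y} (hi : E.monoWithCokernel M.W i) :
    IsIso ((M.envFunctor hA).map i) := by
  have h := (M.isSpecialPreenvelope_toEnv Y).comp hi
  obtain ⟨g, hg⟩ := h.exists_extension (M.env X).property (M.toEnv X)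
  rw [Category.assoc] at hg
  refine (stIso (M.envMap i) g ?_ ?_).isIso_hom
  · refine (M.isSpecialPreenvelope_toEnv X).null hA (M.env X).property ?_
    rw [Preadditive.comp_sub, toEnv_envMap_assoc, hg, Category.comp_id, sub_self]
    exact Null.zero
  · refine h.null hA (M.env Y).property ?_
    rw [Preadditive.comp_sub, Category.assoc, reassoc_of% hg, toEnv_envMap, Category.comp_id,
      sub_self]
    exact Null.zero

lemma isIso_envFunctor_map_of_retraction {X Y : A} {p : X ⟶ Y} {s : Y ⟶ X}
    (h : E.Null (p ≫ s - 𝟙 X)) (h' : E.Null (s ≫ p - 𝟙 Y)) :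
    IsIso ((M.envFunctor hA).map p) :=
  ⟨(M.envFunctor hA).map s,
    by rw [← Functor.map_comp, envFunctor_map_eq_of_null hA h, CategoryTheory.Functor.map_id],
    by rw [← Functor.map_comp, envFunctor_map_eq_of_null hA h', CategoryTheory.Functor.map_id]⟩

/-- A deflation with injective kernel splits. -/
lemma exists_section_of_injective {X Y : A} {p : X ⟶ Y} (hp : E.epiWithKernel E.injectives p) :
    ∃ s : Y ⟶ X, s ≫ p = 𝟙 Y ∧ E.Null (p ≫ s - 𝟙 X) := by
  obtain ⟨K, i, h, hK⟩ := epiWithKernel_iff.1 hp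
  obtain ⟨r, hr⟩ := hK.exists_extension h (𝟙 K)
  obtain ⟨s, hs, hs'⟩ := h.exists_section r hr
  refine ⟨s, hs, ?_⟩
  rw [← hs']
  have : p ≫ s - (r ≫ i + p ≫ s) = -(r ≫ i) := by abel
  rw [this]
  exact ((Null.of_injective_left hK i).comp_left r).neg

/-- A weak equivalence is an inflation with cokernel in W followed by a deflation with kernel in W ∩
F. The kernel is injective, so this deflation splits and is a homotopy equivalence. -/
lemma isInvertedBy_envFunctor :
    (E.model M.triple).weq.IsInvertedBy (M.envFunctor hA) := by
  rintro X Y f ⟨Z, i, p, hi, hp, rfl⟩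
  rw [Functor.map_comp]
  have : IsIso ((M.envFunctor hA).map i) := by
    refine isIso_envFunctor_map_of_inflation hA ?_
    obtain ⟨C, q, h, hC⟩ := monoWithCokernel_iff.1 hi
    exact monoWithCokernel_iff.2 ⟨C, q, h, hC.2⟩
  have : IsIso ((M.envFunctor hA).map p) := by
    obtain ⟨C, q, h, hC⟩ := epiWithKernel_iff.1 hp
    obtain ⟨s, hs, hs'⟩ := exists_section_of_injective
      (epiWithKernel_iff.2 ⟨C, q, h, injectives_of hC.2 hC.1⟩)
    exact isIso_envFunctor_map_of_retraction hA hs' (by rw [hs, sub_self]; exact Null.zero)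
  infer_instance

lemma isIso_γ_map_of_inflation {X Y : A} {i : X ⟶ Y} (hi : E.monoWithCokernel M.W i) :
    IsIso (M.γ.map i) := by
  refine MorphismProperty.Q_inverts _ _ ⟨Y, i, 𝟙 Y, ?_, ?_, Category.comp_id i⟩
  · obtain ⟨C, q, h, hC⟩ := monoWithCokernel_iff.1 hi
    exact monoWithCokernel_iff.2 ⟨C, q, h, trivial, hC⟩
  · exact epiWithKernel_iff.2 ⟨_, _, Conf.zero_id Y, F_of_injectives injectives_zero,
      W_of_injectives injectives_zero⟩

instance (X : A) : IsIso (M.γ.map (M.toEnv X)) :=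
  isIso_γ_map_of_inflation (M.isSpecialPreenvelope_toEnv X).2

lemma γ_map_eq_of_null {X Y : A} {f g : X ⟶ Y} (h : E.Null (f - g)) : M.γ.map f = M.γ.map g := by
  obtain ⟨I, a, b, hI, h⟩ := h
  exact (M.γ_map_eq hI a b h).symm

variable (M) in
/-- The functor `A/W ⥤ F/∼` given by special preenvelopes. -/
def hoEnv : M.Ho ⥤ E.Stable M.F :=
  Localization.Construction.lift (M.envFunctor hA) (isInvertedBy_envFunctor hA)

lemma hoEnv_map {X Y : A} (f : X ⟶ Y) :
    (M.hoEnv hA).map (M.γ.map f) = (M.envFunctor hA).map f :=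
  (Functor.congr_hom (Localization.Construction.fac (M.envFunctor hA)
    (isInvertedBy_envFunctor hA)) f).trans
      ((Category.id_comp _).trans (Category.comp_id _))

lemma exists_hoEnvIso : ∃ η : 𝟭 M.Ho ≅ M.hoEnv hA ⋙ M.quotientFunctor M.F,
    ∀ X, η.hom.app (M.γ.obj X) = M.γ.map (M.toEnv X) := by
  let e (X : A) : M.γ.obj X ≅ M.γ.obj (M.env X).obj := asIso (M.γ.map (M.toEnv X))
  let τ : M.γ ⋙ 𝟭 M.Ho ≅ M.γ ⋙ M.hoEnv hA ⋙ M.quotientFunctor M.F :=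
    NatIso.ofComponents e (fun {X Y} f => by
      change M.γ.map f ≫ M.γ.map (M.toEnv Y) = M.γ.map (M.toEnv X) ≫
        (M.quotientFunctor M.F).map ((M.hoEnv hA).map (M.γ.map f))
      rw [hoEnv_map]
      change _ = M.γ.map (M.toEnv X) ≫ M.γ.map (M.envMap f)
      rw [← Functor.map_comp, ← Functor.map_comp, toEnv_envMap])
  exact exists_localizationNatIso _ _ _ τ

-- With `null_of_γ_map_eq` this computes the maps of A/W into a fibrant object as homotopy classes.
-- No cofibrant replacement is needed, as every object is cofibrant.
include hA in
lemma γ_map_surjective {X R : A} (hR : M.F R) (φ : M.γ.obj X ⟶ M.γ.obj R) :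
    ∃ f : X ⟶ R, M.γ.map f = φ := by
  obtain ⟨η, hη⟩ := exists_hoEnvIso (M := M) hA
  obtain ⟨r, hr, hr'⟩ := (M.isSpecialPreenvelope_toEnv R).exists_retraction hA hR
  obtain ⟨g, hg⟩ := exists_st (X := M.env X) (Y := M.env R) ((M.hoEnv hA).map φ)
  refine ⟨M.toEnv X ≫ g ≫ r, ?_⟩
  have h : φ ≫ η.hom.app (M.γ.obj R) = η.hom.app (M.γ.obj X) ≫
    (M.quotientFunctor M.F).map ((M.hoEnv hA).map φ) := η.hom.naturality φ
  rw [hη, hη, ← hg] at h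
  have h' : φ ≫ M.γ.map (M.toEnv R) = M.γ.map (M.toEnv X) ≫ M.γ.map g := h
  have hr₁ : M.γ.map (M.toEnv R) ≫ M.γ.map r = 𝟙 _ := by
    rw [← Functor.map_comp, hr, CategoryTheory.Functor.map_id]
  rw [Functor.map_comp, Functor.map_comp, ← reassoc_of% h', hr₁, Category.comp_id]

-- The preenvelope functor factors through A/W, so it identifies f and g, and composing with a
-- retraction of the preenvelope of R recovers f - g.
include hA in
lemma null_of_γ_map_eq {X R : A} (hR : M.F R) {f g : X ⟶ R} (h : M.γ.map f = M.γ.map g) :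
    E.Null (f - g) := by
  have h₁ : (M.envFunctor hA).map f = (M.envFunctor hA).map g := by
    rw [← hoEnv_map, ← hoEnv_map, h]
  obtain ⟨r, hr, -⟩ := (M.isSpecialPreenvelope_toEnv R).exists_retraction hA hR
  rw [st_eq_iff] at h₁
  have h₂ : f - g = M.toEnv X ≫ (M.envMap f - M.envMap g) ≫ r := by
    rw [Preadditive.sub_comp, Preadditive.comp_sub, toEnv_envMap_assoc, toEnv_envMap_assoc, hr,
      Category.comp_id, Category.comp_id]
  rw [h₂]
  exact (h₁.comp_right r).comp_left _

end InjectiveCotorsionPair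

end ExactStructure

end

/-! ### Adjoints of inclusions of stable categories -/

noncomputable section

namespace CategoryTheory.Functor

variable {C D : Type*} [Category* C] [Category* D]

/-- A section of a fully faithful functor, given by its values on objects. -/
def sectionOfIso (K : D ⥤ C) [K.Full] [K.Faithful] (d : C → D) (e : ∀ Z, K.obj (d Z) ≅ Z) :
    C ⥤ D where
  obj := d
  map {X Y} f := K.preimage ((e X).hom ≫ f ≫ (e Y).inv)
  map_id X := K.map_injective (by simp)
  map_comp f g := K.map_injective (by simp)

/-- The natural isomorphism of `sectionOfIso`. -/
def sectionOfIsoCompIso (K : D ⥤ C) [K.Full] [K.Faithful] (d : C → D) (e : ∀ Z, K.obj (d Z) ≅ Z) :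
    K.sectionOfIso d e ⋙ K ≅ 𝟭 C :=
  NatIso.ofComponents e (fun {X Y} f => by
    change K.map (K.preimage _) ≫ (e Y).hom = (e X).hom ≫ f
    simp)

lemma comp_map_ofBijective_symm (I : D ⥤ C) {X : C} {Y Z : D} {j : X ⟶ I.obj Y}
    (h : Function.Bijective (fun f : Y ⟶ Z => j ≫ I.map f)) (g : X ⟶ I.obj Z) :
    j ≫ I.map ((Equiv.ofBijective _ h).symm g) = g :=
  (Equiv.ofBijective _ h).apply_symm_apply g

lemma map_ofBijective_symm_comp (I : D ⥤ C) {X : C} {Y Z : D} {p : I.obj Y ⟶ X}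
    (h : Function.Bijective (fun f : Z ⟶ Y => I.map f ≫ p)) (g : I.obj Z ⟶ X) :
    I.map ((Equiv.ofBijective _ h).symm g) ≫ p = g :=
  (Equiv.ofBijective _ h).apply_symm_apply g

/-- The left adjoint of a functor, given by universal arrows. -/
def leftAdjointOfUniversal (I : D ⥤ C) (d : C → D) (j : ∀ X, X ⟶ I.obj (d X))
    (h : ∀ X Y, Function.Bijective (fun f : d X ⟶ Y => j X ≫ I.map f)) : C ⥤ D where
  obj := d
  map {X Y} f := (Equiv.ofBijective _ (h X (d Y))).symm (f ≫ j Y)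
  map_id X := (h X (d X)).injective (by
    rw [comp_map_ofBijective_symm, I.map_id, Category.id_comp, Category.comp_id])
  map_comp {X Y Z} f g := (h X (d Z)).injective (by
    rw [comp_map_ofBijective_symm, I.map_comp, ← Category.assoc (j X), comp_map_ofBijective_symm,
      Category.assoc, Category.assoc, comp_map_ofBijective_symm])

/-- The unit of `leftAdjointOfUniversal`. -/
def unitOfUniversal (I : D ⥤ C) (d : C → D) (j : ∀ X, X ⟶ I.obj (d X))
    (h : ∀ X Y, Function.Bijective (fun f : d X ⟶ Y => j X ≫ I.map f)) :
    𝟭 C ⟶ I.leftAdjointOfUniversal d j h ⋙ I where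
  app := j
  naturality X Y f := (comp_map_ofBijective_symm I (h X (d Y)) (f ≫ j Y)).symm

/-- The right adjoint of a functor, given by couniversal arrows. -/
def rightAdjointOfCouniversal (I : D ⥤ C) (d : C → D) (p : ∀ X, I.obj (d X) ⟶ X)
    (h : ∀ X Y, Function.Bijective (fun f : Y ⟶ d X => I.map f ≫ p X)) : C ⥤ D where
  obj := d
  map {X Y} f := (Equiv.ofBijective _ (h Y (d X))).symm (p X ≫ f)
  map_id X := (h X (d X)).injective (by
    rw [map_ofBijective_symm_comp, I.map_id, Category.id_comp, Category.comp_id])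
  map_comp {X Y Z} f g := (h Z (d X)).injective (by
    rw [map_ofBijective_symm_comp, I.map_comp, Category.assoc, map_ofBijective_symm_comp,
      ← Category.assoc, ← Category.assoc, map_ofBijective_symm_comp])

/-- The counit of `rightAdjointOfCouniversal`. -/
def counitOfCouniversal (I : D ⥤ C) (d : C → D) (p : ∀ X, I.obj (d X) ⟶ X)
    (h : ∀ X Y, Function.Bijective (fun f : Y ⟶ d X => I.map f ≫ p X)) :
    I.rightAdjointOfCouniversal d p h ⋙ I ⟶ 𝟭 C where
  app := p
  naturality X Y f := map_ofBijective_symm_comp I (h Y (d X)) (p X ≫ f)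

end CategoryTheory.Functor

namespace CategoryTheory.Adjunction

variable {C D : Type*} [Category* C] [Category* D]

/-- An adjunction given by a universal natural transformation. -/
def ofUniversalUnit {F : C ⥤ D} {G : D ⥤ C} (η : 𝟭 C ⟶ F ⋙ G)
    (h : ∀ X Y, Function.Bijective (fun f : F.obj X ⟶ Y => η.app X ≫ G.map f)) : F ⊣ G :=
  mkOfHomEquiv
    { homEquiv := fun X Y => Equiv.ofBijective _ (h X Y)
      homEquiv_naturality_left_symm := fun {X' X Y} f g => by
        rw [Equiv.symm_apply_eq]
        change f ≫ g = η.app X' ≫ G.map (F.map f ≫ (Equiv.ofBijective _ (h X Y)).symm g)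
        have h₁ := η.naturality f
        have h₂ : η.app X ≫ G.map ((Equiv.ofBijective _ (h X Y)).symm g) = g :=
          (Equiv.ofBijective _ (h X Y)).apply_symm_apply g
        change f ≫ η.app X = η.app X' ≫ G.map (F.map f) at h₁
        rw [G.map_comp, ← reassoc_of% h₁, h₂]
      homEquiv_naturality_right := fun {X Y Y'} f g => by
        change η.app X ≫ G.map (f ≫ g) = (η.app X ≫ G.map f) ≫ G.map g
        rw [G.map_comp, Category.assoc] }

/-- An adjunction given by a couniversal natural transformation. -/
def ofCouniversalCounit {F : C ⥤ D} {G : D ⥤ C} (ε : G ⋙ F ⟶ 𝟭 D)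
    (h : ∀ X Y, Function.Bijective (fun f : X ⟶ G.obj Y => F.map f ≫ ε.app Y)) : F ⊣ G :=
  mkOfHomEquiv
    { homEquiv := fun X Y => (Equiv.ofBijective _ (h X Y)).symm
      homEquiv_naturality_left_symm := fun {X' X Y} f g => by
        change F.map (f ≫ g) ≫ ε.app Y = F.map f ≫ F.map g ≫ ε.app Y
        rw [F.map_comp, Category.assoc]
      homEquiv_naturality_right := fun {X Y Y'} f g => by
        rw [Equiv.symm_apply_eq]
        change f ≫ g = F.map ((Equiv.ofBijective _ (h X Y)).symm f ≫ G.map g) ≫ ε.app Y'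
        have h₁ := ε.naturality g
        have h₂ : F.map ((Equiv.ofBijective _ (h X Y)).symm f) ≫ ε.app Y = f :=
          (Equiv.ofBijective _ (h X Y)).apply_symm_apply f
        change F.map (G.map g) ≫ ε.app Y' = ε.app Y ≫ g at h₁
        rw [F.map_comp, Category.assoc, h₁, reassoc_of% h₂] }

end CategoryTheory.Adjunction

namespace ExactStructure

variable {A : Type u} [Category.{v} A] [Preadditive A] [HasZeroObject A] [HasBinaryBiproducts A]
  {E : ExactStructure A}

section

variable {P P' : ObjectProperty A} (h : P' ≤ P)

lemma stableInclusion_map {X Y : P'.FullSubcategory} (f : X.obj ⟶ Y.obj) :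
    (E.stableInclusion h).map (E.st f) =
      E.st (X := (ObjectProperty.ιOfLE h).obj X) (Y := (ObjectProperty.ιOfLE h).obj Y) f := rfl

/-- Homotopy is tested on injectives of the ambient category, hence does not depend on the
subcategory; this gives faithfulness below, while fullness is clear. -/
instance : (E.stableInclusion h).Full where
  map_surjective {X Y} φ := by
    obtain ⟨X⟩ := X
    obtain ⟨Y⟩ := Y
    obtain ⟨f, hf⟩ := exists_st (X := (ObjectProperty.ιOfLE h).obj X)
      (Y := (ObjectProperty.ιOfLE h).obj Y) φ
    exact ⟨E.st (X := X) (Y := Y) f, hf⟩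

instance : (E.stableInclusion h).Faithful where
  map_injective {X Y} φ ψ hφψ := by
    obtain ⟨X⟩ := X
    obtain ⟨Y⟩ := Y
    obtain ⟨f, rfl⟩ := exists_st (X := X) (Y := Y) φ
    obtain ⟨g, rfl⟩ := exists_st (X := X) (Y := Y) ψ
    rw [stableInclusion_map, stableInclusion_map] at hφψ
    exact st_eq_iff.2 (st_eq_iff (X := (ObjectProperty.ιOfLE h).obj X)
      (Y := (ObjectProperty.ιOfLE h).obj Y).1 hφψ)

end

namespace InjectiveCotorsionPair

lemma IsSpecialPrecover.exists_lift {M : E.InjectiveCotorsionPair} {X C Z : A} {p : C ⟶ X}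
    (hp : M.IsSpecialPrecover p) (hZ : M.W Z) (f : Z ⟶ X) : ∃ g : Z ⟶ C, g ≫ p = f := by
  obtain ⟨-, hp⟩ := hp
  obtain ⟨K, k, h, hK⟩ := epiWithKernel_iff.1 hp
  exact (M.ext hZ hK).exists_lift h f

lemma IsSpecialPrecover.null {M : E.InjectiveCotorsionPair} (hA : WeaklyIdempotentComplete A)
    {X C Z : A} {p : C ⟶ X} (hp : M.IsSpecialPrecover p) (hZ : M.W Z) {g : Z ⟶ C}
    (h : E.Null (g ≫ p)) : E.Null g := by
  obtain ⟨-, hp⟩ := hp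
  obtain ⟨K, k, h', hK⟩ := epiWithKernel_iff.1 hp
  exact null_of_comp_precover hA h' hK hZ g h

lemma IsSpecialPrecover.F_of {M M' : E.InjectiveCotorsionPair} (hA : WeaklyIdempotentComplete A)
    (hM : M'.F ≤ M.F) {X C : A} {p : C ⟶ X} (hp : M'.IsSpecialPrecover p) (hX : M.F X) :
    M.F C := by
  obtain ⟨-, hp⟩ := hp
  obtain ⟨K, k, h', hK⟩ := epiWithKernel_iff.1 hp
  exact F_middle hA h' (hM _ hK) hX

variable (M : E.InjectiveCotorsionPair)

/-- The source of a chosen special precover. -/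
def cov (X : A) : A := (M.complete.precover X).choose

/-- A chosen special precover. -/
def fromCov (X : A) : M.cov X ⟶ X := (M.complete.precover X).choose_spec.choose

lemma isSpecialPrecover_fromCov (X : A) : M.IsSpecialPrecover (M.fromCov X) :=
  (M.complete.precover X).choose_spec.choose_spec

variable (hA : WeaklyIdempotentComplete A)

include hA in
/-- Special preenvelopes give a left adjoint of the inclusion of stable categories. -/
theorem exists_isPreenvelopeFunctor {P : ObjectProperty A} (h : M.F ≤ P) :
    ∃ e : E.Stable P ⥤ E.Stable M.F, M.IsPreenvelopeFunctor h e ∧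
      Nonempty (e ⊣ E.stableInclusion h) := by
  let d (X : E.Stable P) : E.Stable M.F := (E.toStable M.F).obj (M.env X.as.obj)
  let j (X : E.Stable P) : X ⟶ (E.stableInclusion h).obj (d X) :=
    E.st (X := X.as) (Y := (ObjectProperty.ιOfLE h).obj (M.env X.as.obj)) (M.toEnv X.as.obj)
  -- The preenvelope is a universal arrow: maps to F extend along it, and the extension is unique up
  -- to null maps.
  have hj (X : E.Stable P) (Y : E.Stable M.F) :
      Function.Bijective (fun f : d X ⟶ Y => j X ≫ (E.stableInclusion h).map f) := by
    obtain ⟨X⟩ := X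
    obtain ⟨Y⟩ := Y
    have key (g : (M.env X.obj).obj ⟶ Y.obj) :
        j ⟨X⟩ ≫ (E.stableInclusion h).map (E.st (X := M.env X.obj) (Y := Y) g) =
        E.st (X := X) (Y := (ObjectProperty.ιOfLE h).obj Y) (M.toEnv X.obj ≫ g) :=
      (st_comp (X := X) (Y := (ObjectProperty.ιOfLE h).obj (M.env X.obj))
        (Z := (ObjectProperty.ιOfLE h).obj Y) _ _).symm
    refine ⟨fun f g hfg => ?_, fun f => ?_⟩
    · obtain ⟨f, rfl⟩ := exists_st (X := M.env X.obj) (Y := Y) f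
      obtain ⟨g, rfl⟩ := exists_st (X := M.env X.obj) (Y := Y) g
      exact st_eq_of_toEnv_comp hA (st_eq_iff.1 ((key f).symm.trans (Eq.trans hfg (key g))))
    · obtain ⟨f, rfl⟩ := exists_st (X := X) (Y := (ObjectProperty.ιOfLE h).obj Y) f
      obtain ⟨g, hg⟩ := (M.isSpecialPreenvelope_toEnv X.obj).exists_extension Y.property f
      exact ⟨E.st (X := M.env X.obj) (Y := Y) g, (key g).trans (congrArg _ hg)⟩
  exact ⟨(E.stableInclusion h).leftAdjointOfUniversal d j hj,
    ⟨(E.stableInclusion h).unitOfUniversal d j hj, fun X =>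
      ⟨ObjectProperty.homMk (M.toEnv X.obj), M.isSpecialPreenvelope_toEnv X.obj, rfl⟩⟩,
    ⟨Adjunction.ofUniversalUnit ((E.stableInclusion h).unitOfUniversal d j hj) hj⟩⟩

include hA in
/-- Special precovers give a right adjoint of the inclusion of stable categories. -/
theorem exists_isPrecoverFunctor {P P' : ObjectProperty A} (h : P' ≤ P)
    (hW : P' ≤ M.W) (hP : ∀ X, P X → P' (M.cov X)) :
    ∃ c : E.Stable P ⥤ E.Stable P', M.IsPrecoverFunctor h c ∧
      Nonempty (E.stableInclusion h ⊣ c) := by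
  let d₀ (X : P.FullSubcategory) : P'.FullSubcategory := ⟨M.cov X.obj, hP _ X.property⟩
  let d (X : E.Stable P) : E.Stable P' := (E.toStable P').obj (d₀ X.as)
  let p (X : E.Stable P) : (E.stableInclusion h).obj (d X) ⟶ X :=
    E.st (X := (ObjectProperty.ιOfLE h).obj (d₀ X.as)) (Y := X.as) (M.fromCov X.as.obj)
  have hp (X : E.Stable P) (Y : E.Stable P') :
      Function.Bijective (fun f : Y ⟶ d X => (E.stableInclusion h).map f ≫ p X) := by
    obtain ⟨X⟩ := X
    obtain ⟨Y⟩ := Y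
    have key (g : Y.obj ⟶ (d₀ X).obj) :
        (E.stableInclusion h).map (E.st (X := Y) (Y := d₀ X) g) ≫ p ⟨X⟩ =
        E.st (X := (ObjectProperty.ιOfLE h).obj Y) (Y := X) (g ≫ M.fromCov X.obj) :=
      (st_comp (X := (ObjectProperty.ιOfLE h).obj Y) (Y := (ObjectProperty.ιOfLE h).obj (d₀ X))
        (Z := X) _ _).symm
    refine ⟨fun f g hfg => ?_, fun f => ?_⟩
    · obtain ⟨f, rfl⟩ := exists_st (X := Y) (Y := d₀ X) f
      obtain ⟨g, rfl⟩ := exists_st (X := Y) (Y := d₀ X) g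
      have hfg' := st_eq_iff.1 ((key f).symm.trans (Eq.trans hfg (key g)))
      rw [← Preadditive.sub_comp] at hfg'
      exact st_eq_iff.2 ((M.isSpecialPrecover_fromCov X.obj).null hA (hW _ Y.property) hfg')
    · obtain ⟨f, rfl⟩ := exists_st (X := (ObjectProperty.ιOfLE h).obj Y) (Y := X) f
      obtain ⟨g, hg⟩ := (M.isSpecialPrecover_fromCov X.obj).exists_lift (hW _ Y.property) f
      exact ⟨E.st (X := Y) (Y := d₀ X) g, (key g).trans (congrArg _ hg)⟩
  exact ⟨(E.stableInclusion h).rightAdjointOfCouniversal d p hp,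
    ⟨(E.stableInclusion h).counitOfCouniversal d p hp, fun X =>
      ⟨ObjectProperty.homMk (M.fromCov X.obj), M.isSpecialPrecover_fromCov X.obj, rfl⟩⟩,
    ⟨Adjunction.ofCouniversalCounit ((E.stableInclusion h).counitOfCouniversal d p hp)
      (fun Y X => hp X Y)⟩⟩

end InjectiveCotorsionPair

end ExactStructure

end

/-! ### The quotient functor and its two sections -/

noncomputable section

namespace CategoryTheory.Functor

variable {C D : Type*} [Category* C] [Category* D]

lemma full_of_section {K : D ⥤ C} [K.Faithful] {s : C ⥤ D} (e : s ⋙ K ≅ 𝟭 C) : s.Full :=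
  Functor.Full.of_comp_faithful_iso e

lemma faithful_of_section {K : D ⥤ C} {s : C ⥤ D} (e : s ⋙ K ≅ 𝟭 C) : s.Faithful :=
  Functor.Faithful.of_comp_iso e

lemma isEquivalence_of_section {K : D ⥤ C} [K.Full] [K.Faithful] {s : C ⥤ D} (e : s ⋙ K ≅ 𝟭 C) :
    K.IsEquivalence :=
  have : K.EssSurj := ⟨fun Z => ⟨s.obj Z, ⟨e.app Z⟩⟩⟩
  { }

/-- A section of an equivalence is its inverse. -/
def sectionIsoInv {K : D ⥤ C} [K.IsEquivalence] {s : C ⥤ D} (e : s ⋙ K ≅ 𝟭 C) : s ≅ K.inv :=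
  s.rightUnitor.symm ≪≫ isoWhiskerLeft s K.asEquivalence.unitIso ≪≫
    (Functor.associator s K K.inv).symm ≪≫ isoWhiskerRight e K.inv ≪≫ K.inv.leftUnitor

end CategoryTheory.Functor

namespace ExactStructure

variable {A : Type u} [Category.{v} A] [Preadditive A] [HasZeroObject A] [HasBinaryBiproducts A]
  {E : ExactStructure A}

namespace InjectiveCotorsionPair

lemma quotientFunctor_bijective_of {M : E.InjectiveCotorsionPair} {P : ObjectProperty A}
    {X Y : E.Stable P}
    (h₁ : ∀ f g : X.as.obj ⟶ Y.as.obj, M.γ.map f = M.γ.map g → E.Null (f - g))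
    (h₂ : ∀ φ : M.γ.obj X.as.obj ⟶ M.γ.obj Y.as.obj, ∃ f : X.as.obj ⟶ Y.as.obj, M.γ.map f = φ) :
    Function.Bijective (fun f : X ⟶ Y => (M.quotientFunctor P).map f) := by
  obtain ⟨X⟩ := X
  obtain ⟨Y⟩ := Y
  refine ⟨fun f g hfg => ?_, fun φ => ?_⟩
  · obtain ⟨f, rfl⟩ := exists_st (X := X) (Y := Y) f
    obtain ⟨g, rfl⟩ := exists_st (X := X) (Y := Y) g
    exact st_eq_iff.2 (h₁ f g hfg)
  · obtain ⟨f, hf⟩ := h₂ φ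
    exact ⟨E.st (X := X) (Y := Y) f, hf⟩

lemma quotientFunctor_bijective {M : E.InjectiveCotorsionPair} (hA : WeaklyIdempotentComplete A)
    {P : ObjectProperty A} (X : E.Stable P) {Y : E.Stable P} (hY : M.F Y.as.obj) :
    Function.Bijective (fun f : X ⟶ Y => (M.quotientFunctor P).map f) :=
  quotientFunctor_bijective_of (fun _ _ => null_of_γ_map_eq hA hY)
    (fun φ => γ_map_surjective hA hY φ)

variable {M₁ M₂ M₃ : E.InjectiveCotorsionPair} (hA : WeaklyIdempotentComplete A)

include hA in
/-- For `Z` in `W₂` and a conflation in `F₁` with third term in `F₂`, the first map induces a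
surjection on stable morphisms from `Z`. -/
lemma exists_null_comp_sub {X R B Z : A} {r : X ⟶ R} {q : R ⟶ B} (h : E.Conf r q) (hX : M₁.F X)
    (hB : M₂.F B) (hZ : M₂.W Z) (g : Z ⟶ R) : ∃ f : Z ⟶ X, E.Null (g - f ≫ r) := by
  -- The composite to B goes from W₂ to F₂, so it is null. Its factorization lifts to R, and the
  -- corrected map g - a ≫ b' lands in X.
  obtain ⟨I, a, b, hI, hab⟩ := null_of_W_F hA hZ hB (g ≫ q)
  obtain ⟨b', hb'⟩ := (M₁.ext (W_of_injectives hI) hX).exists_lift h b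
  obtain ⟨f, hf⟩ := h.exists_lift (g - a ≫ b') (by
    rw [Preadditive.sub_comp, hab, Category.assoc, hb', sub_self])
  refine ⟨f, ?_⟩
  rw [hf, sub_sub_cancel]
  exact (Null.of_injective_left hI b').comp_left a

include hA in
/-- For `Z` in `W₂` and a conflation in `F₁` with third term in `F₂`, the first map induces an
injection on stable morphisms from `Z`. -/
lemma null_of_null_comp {X R B Z : A} {r : X ⟶ R} {q : R ⟶ B} (h : E.Conf r q) (hX : M₁.F X)
    (hB : M₂.F B) (hZ : M₂.W Z) {f : Z ⟶ X} (hf : E.Null (f ≫ r)) : E.Null f := by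
  -- Here K is a desuspension of B within F₂, and K ⟶ X ⊞ Q ⟶ R is a conflation. A map to X that is
  -- null in R comes, up to null maps, from a map Z ⟶ K, itself null.
  obtain ⟨K, Q, k, p, hK, hQ, hkp⟩ := exists_injective_cover hA hB
  obtain ⟨β, hβ⟩ := (M₁.ext (W_of_injectives hQ) hX).exists_lift h p
  obtain ⟨α, hα⟩ := h.exists_lift (k ≫ β) (by rw [Category.assoc, hβ, hkp.w])
  have h' := hkp.lift_desc_of_hom h hα hβ
  obtain ⟨I, a, b, hI, hab⟩ := hf
  obtain ⟨b', hb'⟩ := (M₂.ext (W_of_injectives hI) hK).exists_lift h' b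
  obtain ⟨w, hw⟩ := h'.exists_lift (f ≫ biprod.inl - a ≫ b') (by
    rw [Preadditive.sub_comp, Category.assoc, Category.assoc, hb', biprod.inl_desc, hab, sub_self])
  have hf : f = w ≫ α + a ≫ b' ≫ biprod.fst := by
    have := congrArg (· ≫ biprod.fst) hw
    simp only [Category.assoc, biprod.lift_fst, Preadditive.sub_comp, biprod.inl_fst,
      Category.comp_id] at this
    rw [this, sub_add_cancel]
  rw [hf]
  exact ((null_of_W_F hA hZ hK w).comp_right α).add ((Null.of_injective_left hI _).comp_left a)

section

variable (h₃₁ : M₃.F ≤ M₁.F) (h : M₃.W ⊓ M₁.F = M₂.F)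

-- The cokernel is in W₃ by the choice of the preenvelope and in F₁ by `F_right`, hence in F₂. This
-- is where W₃ ∩ F₁ = F₂ enters the study of Q on W₂.
include hA h₃₁ h in
lemma exists_conf_env {X : A} (hX : M₁.F X) :
    ∃ (B : A) (q : (M₃.env X).obj ⟶ B), E.Conf (M₃.toEnv X) q ∧ M₂.F B := by
  obtain ⟨hR, hj⟩ := M₃.isSpecialPreenvelope_toEnv X
  obtain ⟨B, q, hc, hB⟩ := monoWithCokernel_iff.1 hj
  refine ⟨B, q, hc, ?_⟩
  rw [← h]
  exact ⟨hB, F_right hA hc hX (h₃₁ _ hR)⟩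

-- The M₃-preenvelope of Y is invertible in A/W₃ and has cokernel in F₂, which X in W₂ does not
-- detect. So Y may be replaced by an object of F₃, where the maps of A/W₃ are known.
include hA h₃₁ h in
lemma quotientFunctor_bijective_of_W {X Y : E.Stable M₁.F} (hX : M₂.W X.as.obj) :
    Function.Bijective (fun f : X ⟶ Y => (M₃.quotientFunctor M₁.F).map f) := by
  obtain ⟨B, q, hc, hB⟩ := exists_conf_env hA h₃₁ h Y.as.property
  refine quotientFunctor_bijective_of (fun f g hfg => ?_) (fun φ => ?_)
  · refine null_of_null_comp hA hc Y.as.property hB hX ?_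
    rw [Preadditive.sub_comp]
    refine null_of_γ_map_eq hA (M₃.env Y.as.obj).property ?_
    rw [Functor.map_comp, Functor.map_comp, hfg]
  · obtain ⟨g, hg⟩ := γ_map_surjective hA (M₃.env Y.as.obj).property
      (φ ≫ M₃.γ.map (M₃.toEnv Y.as.obj))
    obtain ⟨f, hf⟩ := exists_null_comp_sub hA hc Y.as.property hB hX g
    refine ⟨f, ?_⟩
    rw [← cancel_mono (M₃.γ.map (M₃.toEnv Y.as.obj)), ← Functor.map_comp, ← hg]
    exact (γ_map_eq_of_null hf).symm

include hA in
lemma full_inclusion_quotientFunctor :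
    (E.stableInclusion h₃₁ ⋙ M₃.quotientFunctor M₁.F).Full where
  map_surjective {X Y} φ := by
    obtain ⟨ψ, hψ⟩ := (quotientFunctor_bijective (M := M₃) hA ((E.stableInclusion h₃₁).obj X)
      (Y := (E.stableInclusion h₃₁).obj Y) Y.as.property).2 φ
    obtain ⟨f, rfl⟩ := (E.stableInclusion h₃₁).map_surjective ψ
    exact ⟨f, hψ⟩

include hA in
lemma faithful_inclusion_quotientFunctor :
    (E.stableInclusion h₃₁ ⋙ M₃.quotientFunctor M₁.F).Faithful where
  map_injective {X Y} _ _ hfg := (E.stableInclusion h₃₁).map_injective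
    ((quotientFunctor_bijective (M := M₃) hA ((E.stableInclusion h₃₁).obj X)
      (Y := (E.stableInclusion h₃₁).obj Y) Y.as.property).1 hfg)

include hA h₃₁ h in
lemma full_inclusion_quotientFunctor_of_W :
    (E.stableInclusion (inf_le_right : M₂.W ⊓ M₁.F ≤ M₁.F) ⋙ M₃.quotientFunctor M₁.F).Full where
  map_surjective {X Y} φ := by
    obtain ⟨ψ, hψ⟩ := (quotientFunctor_bijective_of_W hA h₃₁ h
      (X := (E.stableInclusion inf_le_right).obj X)
      (Y := (E.stableInclusion inf_le_right).obj Y) X.as.property.1).2 φ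
    obtain ⟨f, rfl⟩ := (E.stableInclusion inf_le_right).map_surjective ψ
    exact ⟨f, hψ⟩

include hA h₃₁ h in
lemma faithful_inclusion_quotientFunctor_of_W :
    (E.stableInclusion (inf_le_right : M₂.W ⊓ M₁.F ≤ M₁.F) ⋙
      M₃.quotientFunctor M₁.F).Faithful where
  map_injective {X Y} _ _ hfg := (E.stableInclusion inf_le_right).map_injective
    ((quotientFunctor_bijective_of_W hA h₃₁ h
      (X := (E.stableInclusion inf_le_right).obj X)
      (Y := (E.stableInclusion inf_le_right).obj Y) X.as.property.1).1 hfg)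

include hA in
theorem exists_isPreenvelopeSection : ∃ ρ : M₃.Ho ⥤ E.Stable M₃.F,
    M₃.IsPreenvelopeSection M₁.F M₃ (ρ ⋙ E.stableInclusion h₃₁) ∧
    Nonempty (ρ ⋙ E.stableInclusion h₃₁ ⋙ M₃.quotientFunctor M₁.F ≅ 𝟭 M₃.Ho) := by
  have := full_inclusion_quotientFunctor (M₁ := M₁) hA h₃₁
  have := faithful_inclusion_quotientFunctor (M₁ := M₁) hA h₃₁
  -- Objects of the localization are those of A, so the values of ρ can be prescribed to be the
  -- chosen preenvelopes.
  let o := Localization.Construction.objEquiv (E.model M₃.triple).weq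
  let e (Z : M₃.Ho) : (E.stableInclusion h₃₁ ⋙ M₃.quotientFunctor M₁.F).obj
      ((E.toStable M₃.F).obj (M₃.env (o.symm Z))) ≅ Z :=
    (asIso (M₃.γ.map (M₃.toEnv (o.symm Z)))).symm
  let i := (E.stableInclusion h₃₁ ⋙ M₃.quotientFunctor M₁.F).sectionOfIsoCompIso _ e
  exact ⟨(E.stableInclusion h₃₁ ⋙ M₃.quotientFunctor M₁.F).sectionOfIso _ e,
    ⟨i.symm, fun X => ⟨M₃.toEnv X, M₃.isSpecialPreenvelope_toEnv X, rfl⟩⟩, ⟨i⟩⟩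

variable (h₂₁ : M₂.F ≤ M₁.F) (hE : E.EnoughInjectives)

-- The kernel is only in W, not in W ∩ F, so p is not a trivial fibration in general and its cone is
-- used instead.
include hA hE in
lemma isIso_γ_map_of_deflation {M : E.InjectiveCotorsionPair} {X Y : A} {p : X ⟶ Y}
    (hp : E.epiWithKernel M.W p) : IsIso (M.γ.map p) := by
  obtain ⟨K, k, hc, hK⟩ := epiWithKernel_iff.1 hp
  exact MorphismProperty.Q_inverts _ _ (((isHoveyTriple_triple hE M).weq_iff hA hE p).2
    (hasConeIn_of_deflation M.thick (fun _ => W_of_injectives) hE hc hK))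

include h₃₁ in
lemma isIso_γ_map_toEnv (X : A) : IsIso (M₃.γ.map (M₁.toEnv X)) := by
  obtain ⟨C, q, hc, hC⟩ := monoWithCokernel_iff.1 (M₁.isSpecialPreenvelope_toEnv X).2
  exact isIso_γ_map_of_inflation (monoWithCokernel_iff.2 ⟨C, q, hc, W_le h₃₁ _ hC⟩)

include hA h₃₁ h h₂₁ hE in
theorem exists_isPrecoverPreenvelopeSection : ∃ l : M₃.Ho ⥤ E.Stable (M₂.W ⊓ M₁.F),
    M₃.IsPrecoverPreenvelopeSection M₁.F M₂ M₁ (l ⋙ E.stableInclusion inf_le_right) ∧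
    Nonempty (l ⋙ E.stableInclusion inf_le_right ⋙ M₃.quotientFunctor M₁.F ≅ 𝟭 M₃.Ho) := by
  have := full_inclusion_quotientFunctor_of_W hA h₃₁ h
  have := faithful_inclusion_quotientFunctor_of_W hA h₃₁ h
  let o := Localization.Construction.objEquiv (E.model M₃.triple).weq
  let d (X : A) : (M₂.W ⊓ M₁.F).FullSubcategory :=
    ⟨M₂.cov (M₁.env X).obj, (M₂.isSpecialPrecover_fromCov _).1,
      (M₂.isSpecialPrecover_fromCov _).F_of hA h₂₁ (M₁.env X).property⟩
  have h₁ (X : A) : IsIso (M₃.γ.map (M₁.toEnv X)) := isIso_γ_map_toEnv h₃₁ X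
  -- The kernel of an M₂-precover is in F₂ ⊆ W₃.
  have h₂ (X : A) : IsIso (M₃.γ.map (M₂.fromCov X)) := by
    obtain ⟨K, k, hc, hK⟩ := epiWithKernel_iff.1 (M₂.isSpecialPrecover_fromCov X).2
    exact isIso_γ_map_of_deflation hA hE (epiWithKernel_iff.2 ⟨K, k, hc, F_le_W h _ hK⟩)
  let e₀ (X : A) : M₃.γ.obj (M₂.cov (M₁.env X).obj) ≅ M₃.γ.obj X :=
    asIso (M₃.γ.map (M₂.fromCov (M₁.env X).obj)) ≪≫ (asIso (M₃.γ.map (M₁.toEnv X))).symm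
  let e (Z : M₃.Ho) : (E.stableInclusion inf_le_right ⋙ M₃.quotientFunctor M₁.F).obj
      ((E.toStable (M₂.W ⊓ M₁.F)).obj (d (o.symm Z))) ≅ Z := e₀ (o.symm Z)
  let i := (E.stableInclusion inf_le_right ⋙ M₃.quotientFunctor M₁.F).sectionOfIsoCompIso _ e
  refine ⟨(E.stableInclusion inf_le_right ⋙ M₃.quotientFunctor M₁.F).sectionOfIso _ e,
    ⟨i, fun X => ⟨(M₁.env X).obj, M₁.toEnv X, M₂.fromCov (M₁.env X).obj,
      M₁.isSpecialPreenvelope_toEnv X, M₂.isSpecialPrecover_fromCov _, ?_⟩⟩, ⟨i⟩⟩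
  change (M₃.γ.map (M₂.fromCov (M₁.env X).obj) ≫ inv (M₃.γ.map (M₁.toEnv X))) ≫
    M₃.γ.map (M₁.toEnv X) = _
  rw [Category.assoc, IsIso.inv_hom_id]
  exact Category.comp_id _

end

end InjectiveCotorsionPair

end ExactStructure

end

/-! ### Triangulated subcategories of the stable category -/

noncomputable section

open Pretriangulated

namespace ExactStructure

variable {A : Type u} [Category.{v} A] [Preadditive A] [HasZeroObject A] [HasBinaryBiproducts A]
  {E : ExactStructure A}

/-- Natural connecting morphisms for the conflations in `P` which determine the distinguished
triangles of the stable category. -/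
structure Connecting (P : ObjectProperty A) [TriangulatedStructure (E.Stable P)] where
  δ {X₁ X₂ X₃ : P.FullSubcategory} {i : X₁.obj ⟶ X₂.obj} {p : X₂.obj ⟶ X₃.obj} (h : E.Conf i p) :
    (E.toStable P).obj X₃ ⟶ ((E.toStable P).obj X₁)⟦(1 : ℤ)⟧
  naturality {X₁ X₂ X₃ Y₁ Y₂ Y₃ : P.FullSubcategory} {i : X₁.obj ⟶ X₂.obj} {p : X₂.obj ⟶ X₃.obj}
    {i' : Y₁.obj ⟶ Y₂.obj} {p' : Y₂.obj ⟶ Y₃.obj} (h : E.Conf i p) (h' : E.Conf i' p')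
    (τ₁ : X₁.obj ⟶ Y₁.obj) (τ₂ : X₂.obj ⟶ Y₂.obj) (τ₃ : X₃.obj ⟶ Y₃.obj)
    (h₁ : i ≫ τ₂ = τ₁ ≫ i') (h₂ : p ≫ τ₃ = τ₂ ≫ p') :
    E.st τ₃ ≫ δ h' = δ h ≫ (E.st τ₁)⟦(1 : ℤ)⟧'
  dist_iff (t : Triangle (E.Stable P)) : t ∈ distTriang (E.Stable P) ↔
    ∃ (X₁ X₂ X₃ : P.FullSubcategory) (i : X₁.obj ⟶ X₂.obj) (p : X₂.obj ⟶ X₃.obj)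
      (h : E.Conf i p), Nonempty (t ≅ Triangle.mk (E.st i) (E.st p) (δ h))

lemma nonempty_connecting {P : ObjectProperty A} [TriangulatedStructure (E.Stable P)]
    (hT : IsTriangulatedAlong (E.conflationIn P) (E.toStable P)) :
    Nonempty (E.Connecting P) := by
  obtain ⟨-, δ, hδ, hd⟩ := hT
  let S {X₁ X₂ X₃ : P.FullSubcategory} {i : X₁.obj ⟶ X₂.obj} {p : X₂.obj ⟶ X₃.obj}
    (h : E.Conf i p) : ShortComplex P.FullSubcategory := ShortComplex.mk (ObjectProperty.homMk i)
      (ObjectProperty.homMk p) (ObjectProperty.hom_ext _ h.w)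
  have hS {X₁ X₂ X₃ : P.FullSubcategory} {i : X₁.obj ⟶ X₂.obj} {p : X₂.obj ⟶ X₃.obj}
    (h : E.Conf i p) : E.conflationIn P (S h) := h.2
  refine ⟨⟨fun h => δ (S h) (hS h), fun h h' τ₁ τ₂ τ₃ h₁ h₂ => ?_, fun t => ?_⟩⟩
  · exact hδ (S h) (S h') (hS h) (hS h') ⟨ObjectProperty.homMk τ₁, ObjectProperty.homMk τ₂,
      ObjectProperty.homMk τ₃, ObjectProperty.hom_ext _ h₁.symm, ObjectProperty.hom_ext _ h₂.symm⟩
  · rw [hd]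
    exact ⟨fun ⟨S, hS, e⟩ => ⟨_, _, _, _, _, ⟨_, hS⟩, e⟩,
      fun ⟨_, _, _, _, _, h, e⟩ => ⟨S h, hS h, e⟩⟩

lemma Connecting.isTriangulatedAlong {P : ObjectProperty A} [TriangulatedStructure (E.Stable P)]
    (D : E.Connecting P) (h : (E.toStable P).Additive) :
    IsTriangulatedAlong (E.conflationIn P) (E.toStable P) := by
  refine ⟨h, fun S hS => D.δ ⟨_, hS⟩, fun S S' hS hS' φ => ?_, fun t => ?_⟩
  · exact D.naturality ⟨_, hS⟩ ⟨_, hS'⟩ φ.τ₁.hom φ.τ₂.hom φ.τ₃.hom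
      (congrArg (·.hom) φ.comm₁₂).symm (congrArg (·.hom) φ.comm₂₃).symm
  · rw [D.dist_iff]
    refine ⟨fun ⟨X₁, X₂, X₃, i, p, h, e⟩ => ?_, fun ⟨S, hS, e⟩ => ⟨_, _, _, _, _, ⟨_, hS⟩, e⟩⟩
    exact ⟨ShortComplex.mk (ObjectProperty.homMk i) (ObjectProperty.homMk p)
      (ObjectProperty.hom_ext _ h.1), h.2, e⟩

namespace Connecting

variable {P : ObjectProperty A} [TriangulatedStructure (E.Stable P)] (D : E.Connecting P)

lemma mem_distTriang {X₁ X₂ X₃ : P.FullSubcategory} {i : X₁.obj ⟶ X₂.obj} {p : X₂.obj ⟶ X₃.obj}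
    (h : E.Conf i p) : Triangle.mk (E.st i) (E.st p) (D.δ h) ∈ distTriang (E.Stable P) :=
  (D.dist_iff _).2 ⟨_, _, _, _, _, h, ⟨Iso.refl _⟩⟩

lemma isIso_δ {X₁ X₂ X₃ : P.FullSubcategory} {i : X₁.obj ⟶ X₂.obj} {p : X₂.obj ⟶ X₃.obj}
    (h : E.Conf i p) (hX₂ : E.injectives X₂.obj) : IsIso (D.δ h) :=
  (Triangle.isZero₂_iff_isIso₃ _ (D.mem_distTriang h)).1 (isZero_toStable hX₂)

end Connecting

namespace InjectiveCotorsionPair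

variable {M M' : E.InjectiveCotorsionPair} [TriangulatedStructure (E.Stable M.F)]
  (D : E.Connecting M.F) (hA : WeaklyIdempotentComplete A) (hE : E.EnoughInjectives)

omit [TriangulatedStructure (E.Stable M.F)] in
include hA in
lemma F_of_stable_iso {P : ObjectProperty A} {X Y : E.Stable P} (e : X ≅ Y)
    (hY : M'.F Y.as.obj) : M'.F X.as.obj := by
  obtain ⟨X⟩ := X
  obtain ⟨Y⟩ := Y
  obtain ⟨f, hf⟩ := exists_st (X := X) (Y := Y) e.hom
  obtain ⟨g, hg⟩ := exists_st (X := Y) (Y := X) e.inv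
  have : E.st (X := X) (Y := X) (𝟙 X.obj) = E.st (f ≫ g) := by
    rw [st_id, st_comp, hf, hg]
    exact e.hom_inv_id.symm
  exact F_of_null hA (st_eq_iff.1 this) hY

-- The connecting morphism of a conflation with injective middle term identifies the shift of X with
-- a cosyzygy, which is in F' by `F_right`. For the inverse shift the injective cover in F' is used.
include D hA hE in
lemma F_shift_one (h : M'.F ≤ M.F) {X : E.Stable M.F} (hX : M'.F X.as.obj) :
    M'.F (X⟦(1 : ℤ)⟧).as.obj := by
  obtain ⟨X⟩ := X
  obtain ⟨I, C, i, p, hI, hip⟩ := hE.exists_conf X.obj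
  have hC := F_right hA hip hX (F_of_injectives hI)
  have := D.isIso_δ (X₁ := X) (X₂ := ⟨I, F_of_injectives hI⟩) (X₃ := ⟨C, h _ hC⟩) hip hI
  exact F_of_stable_iso hA (asIso (D.δ (X₁ := X) (X₂ := ⟨I, F_of_injectives hI⟩)
    (X₃ := ⟨C, h _ hC⟩) hip)).symm hC

include D hA in
lemma F_shift_neg_one (h : M'.F ≤ M.F) {X : E.Stable M.F} (hX : M'.F X.as.obj) :
    M'.F (X⟦(-1 : ℤ)⟧).as.obj := by
  obtain ⟨X⟩ := X
  obtain ⟨K, I, k, q, hK, hI, hkq⟩ := exists_injective_cover hA hX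
  have := D.isIso_δ (X₁ := ⟨K, h _ hK⟩) (X₂ := ⟨I, F_of_injectives hI⟩) (X₃ := X) hkq hI
  exact F_of_stable_iso hA ((shiftFunctor (E.Stable M.F) (-1 : ℤ)).mapIso
    (asIso (D.δ (X₁ := ⟨K, h _ hK⟩) (X₂ := ⟨I, F_of_injectives hI⟩) (X₃ := X) hkq)) ≪≫
      shiftShiftNeg ((E.toStable M.F).obj ⟨K, h _ hK⟩) (1 : ℤ)) hK

include D hA hE in
lemma F_shift (h : M'.F ≤ M.F) {X : E.Stable M.F} (hX : M'.F X.as.obj) (n : ℤ) :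
    M'.F (X⟦n⟧).as.obj := by
  induction n using Int.induction_on with
  | zero => exact F_of_stable_iso hA (shiftZero ℤ X) hX
  | succ n ih => exact F_of_stable_iso hA (shiftAdd X (n : ℤ) 1) (F_shift_one D hA hE h ih)
  | pred n ih => exact F_of_stable_iso hA (shiftAdd X (-n : ℤ) (-1)) (F_shift_neg_one D hA h ih)

-- Since F' contains the injectives and is closed under cokernels of inflations, the mapping
-- cylinder of f and its cokernel stay in F'.
include D hA hE in
lemma exists_cone (h : M'.F ≤ M.F) {X Y : E.Stable M.F} (hX : M'.F X.as.obj) (hY : M'.F Y.as.obj)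
    (f : X ⟶ Y) : ∃ (Z : E.Stable M.F) (g : Y ⟶ Z) (d : Z ⟶ X⟦(1 : ℤ)⟧),
      Triangle.mk f g d ∈ distTriang (E.Stable M.F) ∧ M'.F Z.as.obj := by
  obtain ⟨X⟩ := X
  obtain ⟨Y⟩ := Y
  obtain ⟨f, rfl⟩ := exists_st (X := X) (Y := Y) f
  obtain ⟨I, C, i, p, hI, hip⟩ := hE.exists_conf X.obj
  obtain ⟨Z, q, hq⟩ := hip.exists_lift_conf f
  have hF : M'.F (Y.obj ⊞ I) := F_biprod hA hY (F_of_injectives hI)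
  have hZ := F_right hA hq hX hF
  let Y' : M.F.FullSubcategory := ⟨Y.obj ⊞ I, h _ hF⟩
  let Z' : M.F.FullSubcategory := ⟨Z, h _ hZ⟩
  refine ⟨(E.toStable M.F).obj Z', (stFstIso hI (h _ hF)).inv ≫ E.st (X := Y') (Y := Z') q,
    D.δ (X₁ := X) (X₂ := Y') (X₃ := Z') hq, isomorphic_distinguished _
      (D.mem_distTriang (X₁ := X) (X₂ := Y') (X₃ := Z') hq) _
      (Triangle.isoMk _ _ (Iso.refl _) (stFstIso hI (h _ hF)).symm (Iso.refl _) ?_ ?_ ?_), hZ⟩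
  · change E.st f ≫ (stFstIso hI (h _ hF)).inv = 𝟙 _ ≫ E.st (X := X) (Y := Y') (biprod.lift f i)
    rw [Iso.comp_inv_eq, Category.id_comp, stFstIso_hom, ← st_comp]
    exact congrArg _ (by simp)
  · exact Category.comp_id _
  · change D.δ (X₁ := X) (X₂ := Y') (X₃ := Z') hq ≫ (𝟙 _)⟦(1 : ℤ)⟧' =
      𝟙 _ ≫ D.δ (X₁ := X) (X₂ := Y') (X₃ := Z') hq
    rw [CategoryTheory.Functor.map_id, Category.id_comp, Category.comp_id]

include D hA hE in
/-- The triangulated structure on a category embedded in `F/∼` with image `F'/∼`. -/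
theorem exists_triangulatedStructure_of_essImage {T : Type*} [Category* T]
    (J : T ⥤ E.Stable M.F) [J.Full] [J.Faithful] (h : M'.F ≤ M.F)
    (hJ : ∀ X, J.essImage X ↔ M'.F X.as.obj) :
    ∃ (_ : TriangulatedStructure T) (_ : J.CommShift ℤ), J.Additive ∧
      ∀ t, t ∈ distTriang T ↔ J.mapTriangle.obj t ∈ distTriang (E.Stable M.F) := by
  refine exists_inducedTriangulatedStructure J ?_ (fun n X => ?_) (fun X Y f => ?_)
  · obtain ⟨Z, ⟨e⟩⟩ := (hJ ((E.toStable M.F).obj ⟨0, F_of_injectives injectives_zero⟩)).2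
      (F_of_injectives injectives_zero)
    exact ⟨Z, (isZero_toStable injectives_zero).of_iso e⟩
  · rw [hJ]
    exact F_shift D hA hE h ((hJ _).1 (J.obj_mem_essImage X)) n
  · obtain ⟨Z, g, d, ht, hZ⟩ := exists_cone D hA hE h ((hJ _).1 (J.obj_mem_essImage X))
      ((hJ _).1 (J.obj_mem_essImage Y)) (J.map f)
    obtain ⟨Z', ⟨e⟩⟩ := (hJ Z).2 hZ
    refine ⟨Z', g ≫ e.inv, e.hom ≫ d, isomorphic_distinguished _ ht _
      (Triangle.isoMk _ _ (Iso.refl _) (Iso.refl _) e ?_ ?_ ?_)⟩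
    · exact (Category.comp_id _).trans (Category.id_comp _).symm
    · change (g ≫ e.inv) ≫ e.hom = 𝟙 _ ≫ g
      rw [Category.assoc, Iso.inv_hom_id, Category.comp_id, Category.id_comp]
    · change (e.hom ≫ d) ≫ (𝟙 _)⟦(1 : ℤ)⟧' = e.hom ≫ d
      rw [CategoryTheory.Functor.map_id, Category.comp_id]

end InjectiveCotorsionPair

end ExactStructure

end

/-! ### The inherited triangles of the smaller stable category come from its conflations -/

noncomputable section

open Pretriangulated

namespace ExactStructure

variable {A : Type u} [Category.{v} A] [Preadditive A] [HasZeroObject A] [HasBinaryBiproducts A]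
  {E : ExactStructure A}

namespace InjectiveCotorsionPair

variable {M M' : E.InjectiveCotorsionPair} (hA : WeaklyIdempotentComplete A)
  [TriangulatedStructure (E.Stable M.F)] [TriangulatedStructure (E.Stable M'.F)]
  (D : E.Connecting M.F) (h : M'.F ≤ M.F) [(E.stableInclusion h).CommShift ℤ]

section

variable {X₁ X₂ X₃ : M'.F.FullSubcategory} {i : X₁.obj ⟶ X₂.obj} {p : X₂.obj ⟶ X₃.obj}

/-- The connecting morphism in the larger stable category. -/
abbrev δLarge (hc : E.Conf i p) :
    (E.stableInclusion h).obj ((E.toStable M'.F).obj X₃) ⟶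
      ((E.stableInclusion h).obj ((E.toStable M'.F).obj X₁))⟦(1 : ℤ)⟧ :=
  D.δ (X₁ := (ObjectProperty.ιOfLE h).obj X₁) (X₂ := (ObjectProperty.ιOfLE h).obj X₂)
    (X₃ := (ObjectProperty.ιOfLE h).obj X₃) hc

/-- The connecting morphism induced on the smaller stable category. -/
def δInduced (hc : E.Conf i p) :
    (E.toStable M'.F).obj X₃ ⟶ ((E.toStable M'.F).obj X₁)⟦(1 : ℤ)⟧ :=
  (E.stableInclusion h).preimage (δLarge D h hc ≫
    ((E.stableInclusion h).commShiftIso (1 : ℤ)).inv.app ((E.toStable M'.F).obj X₁))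

lemma map_δInduced (hc : E.Conf i p) :
    (E.stableInclusion h).map (δInduced D h hc) ≫
      ((E.stableInclusion h).commShiftIso (1 : ℤ)).hom.app ((E.toStable M'.F).obj X₁) =
    δLarge D h hc := by
  rw [δInduced, Functor.map_preimage, Category.assoc]
  exact (congrArg (δLarge D h hc ≫ ·) (Iso.inv_hom_id_app
    ((E.stableInclusion h).commShiftIso (1 : ℤ)) _)).trans (Category.comp_id _)

/-- The image of the triangle of a conflation under the inclusion functor. -/
def mapTriangleInclusionIso (hc : E.Conf i p) :
    (E.stableInclusion h).mapTriangle.obj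
      (Triangle.mk (E.st i) (E.st p) (δInduced D h hc)) ≅
    Triangle.mk ((E.stableInclusion h).map (E.st i)) ((E.stableInclusion h).map (E.st p))
      (δLarge D h hc) :=
  Triangle.isoMk _ _ (Iso.refl _) (Iso.refl _) (Iso.refl _)
    ((Category.comp_id _).trans (Category.id_comp _).symm)
    ((Category.comp_id _).trans (Category.id_comp _).symm)
    ((congr_arg₂ _ (map_δInduced D h hc) (CategoryTheory.Functor.map_id _ _)).trans
      ((Category.comp_id _).trans (Category.id_comp _).symm))

end

-- A triangle of F'/∼ becomes isomorphic to that of a conflation of F. The terms of the conflation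
-- are stably isomorphic to objects of F', hence in F', and the isomorphism descends by full
-- faithfulness.
include D hA in
theorem isTriangulatedAlong_of_inclusion
    (ht : ∀ t, t ∈ distTriang (E.Stable M'.F) ↔
      (E.stableInclusion h).mapTriangle.obj t ∈ distTriang (E.Stable M.F))
    (h₁ : (E.toStable M.F).Additive) (h₂ : (E.stableInclusion h).Additive) :
    IsTriangulatedAlong (E.conflationIn M'.F) (E.toStable M'.F) := by
  have hadd : (E.toStable M'.F).Additive := ⟨fun {X Y f g} =>
    (E.stableInclusion h).map_injective (by
      refine Eq.trans ?_ (E.stableInclusion h).map_add.symm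
      exact (E.toStable M.F).map_add (f := (ObjectProperty.ιOfLE h).map f)
        (g := (ObjectProperty.ιOfLE h).map g))⟩
  refine Connecting.isTriangulatedAlong (E := E) ⟨δInduced D h,
    fun {X₁ X₂ X₃ Y₁ Y₂ Y₃ i p i' p'} hc hc' τ₁ τ₂ τ₃ c₁ c₂ => ?_, fun t => ?_⟩ hadd
  · apply (E.stableInclusion h).map_injective
    rw [Functor.map_comp, Functor.map_comp, ← cancel_mono
      (((E.stableInclusion h).commShiftIso (1 : ℤ)).hom.app ((E.toStable M'.F).obj Y₁)),
      Category.assoc, map_δInduced, Category.assoc]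
    refine Eq.trans (D.naturality (X₁ := (ObjectProperty.ιOfLE h).obj X₁)
      (X₂ := (ObjectProperty.ιOfLE h).obj X₂) (X₃ := (ObjectProperty.ιOfLE h).obj X₃)
      (Y₁ := (ObjectProperty.ιOfLE h).obj Y₁) (Y₂ := (ObjectProperty.ιOfLE h).obj Y₂)
      (Y₃ := (ObjectProperty.ιOfLE h).obj Y₃) hc hc' τ₁ τ₂ τ₃ c₁ c₂) ?_
    have := (E.stableInclusion h).commShiftIso_hom_naturality
      (E.st (X := X₁) (Y := Y₁) τ₁) (1 : ℤ)
    rw [this, ← Category.assoc, map_δInduced]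
    rfl
  · rw [ht, D.dist_iff]
    constructor
    · rintro ⟨X₁, X₂, X₃, i, p, hc, ⟨e⟩⟩
      have h₁ : M'.F X₁.obj := F_of_stable_iso (X := (E.toStable M.F).obj X₁) hA
        (Triangle.π₁.mapIso e).symm t.obj₁.as.property
      have h₂ : M'.F X₂.obj := F_of_stable_iso (X := (E.toStable M.F).obj X₂) hA
        (Triangle.π₂.mapIso e).symm t.obj₂.as.property
      have h₃ : M'.F X₃.obj := F_of_stable_iso (X := (E.toStable M.F).obj X₃) hA
        (Triangle.π₃.mapIso e).symm t.obj₃.as.property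
      exact ⟨⟨_, h₁⟩, ⟨_, h₂⟩, ⟨_, h₃⟩, i, p, hc, ⟨(E.stableInclusion h).mapTriangle.preimageIso
        (e ≪≫ (mapTriangleInclusionIso D h (X₁ := ⟨_, h₁⟩) (X₂ := ⟨_, h₂⟩) (X₃ := ⟨_, h₃⟩)
          hc).symm)⟩⟩
    · rintro ⟨X₁, X₂, X₃, i, p, hc, ⟨e⟩⟩
      exact ⟨(ObjectProperty.ιOfLE h).obj X₁, (ObjectProperty.ιOfLE h).obj X₂,
        (ObjectProperty.ιOfLE h).obj X₃, i, p, hc,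
        ⟨(E.stableInclusion h).mapTriangle.mapIso e ≪≫ mapTriangleInclusionIso D h hc⟩⟩

end InjectiveCotorsionPair

end ExactStructure

end

/-! ### Triangles of conflations of the ambient category -/

noncomputable section

open Pretriangulated

namespace ExactStructure

variable {A : Type u} [Category.{v} A] [Preadditive A] [HasZeroObject A] [HasBinaryBiproducts A]
  {E : ExactStructure A}

namespace InjectiveCotorsionPair

variable {M : E.InjectiveCotorsionPair} (s : E.Suspension M.F) (hA : WeaklyIdempotentComplete A)

section

variable {X₁ X₂ X₃ Y₁ Y₂ Y₃ : A} {i' : Y₁ ⟶ Y₂} {p' : Y₂ ⟶ Y₃} {i : X₁ ⟶ X₂} {p : X₂ ⟶ X₃}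

/-- `c` is induced by the conflation `(i, p)` on special preenvelopes. -/
def EnvConn (i : X₁ ⟶ X₂) (p : X₂ ⟶ X₃) (c : (M.env X₃).obj ⟶ (s.obj (M.env X₁)).obj) : Prop :=
  ∃ b : X₂ ⟶ s.I (M.env X₁), i ≫ b = M.toEnv X₁ ≫ s.ι _ ∧ p ≫ M.toEnv X₃ ≫ c = b ≫ s.π _

lemma exists_envConn (h : E.Conf i p) : ∃ c, EnvConn s i p c := by
  obtain ⟨b, hb⟩ := (s.injective (M.env X₁)).exists_extension h (M.toEnv X₁ ≫ s.ι _)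
  obtain ⟨d, hd⟩ := h.exists_desc (b ≫ s.π _) (by
    rw [reassoc_of% hb, (s.conf _).w, comp_zero])
  obtain ⟨c, hc⟩ := (M.isSpecialPreenvelope_toEnv X₃).exists_extension
    (s.obj (M.env X₁)).property d
  exact ⟨c, b, hb, by rw [hc, hd]⟩

variable {s} in
include hA in
lemma EnvConn.naturality {c : (M.env X₃).obj ⟶ (s.obj (M.env X₁)).obj}
    {c' : (M.env Y₃).obj ⟶ (s.obj (M.env Y₁)).obj} (hc : EnvConn s i p c)
    (hc' : EnvConn s i' p' c') (h : E.Conf i p) (τ₁ : X₁ ⟶ Y₁) (τ₂ : X₂ ⟶ Y₂) (τ₃ : X₃ ⟶ Y₃)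
    (h₁ : i ≫ τ₂ = τ₁ ≫ i') (h₂ : p ≫ τ₃ = τ₂ ≫ p')
    {g : (s.obj (M.env X₁)).obj ⟶ (s.obj (M.env Y₁)).obj} (hg : s.Ind (M.envMap τ₁) g) :
    E.st (M.envMap τ₃) ≫ E.st c' = E.st c ≫ E.st g := by
  rw [← st_comp, ← st_comp]
  refine st_eq_of_toEnv_comp hA ?_
  obtain ⟨b, hb, hc⟩ := hc
  obtain ⟨b', hb', hc'⟩ := hc'
  obtain ⟨d, hd, hg⟩ := hg
  refine h.null_sub (s.injective (M.env Y₁)) (s.conf _).w (a := τ₁ ≫ M.toEnv Y₁)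
    (a' := τ₁ ≫ M.toEnv Y₁) (b := τ₂ ≫ b') (b' := b ≫ d) ?_ ?_ ?_ ?_
    (by rw [sub_self]; exact Null.zero)
  · rw [reassoc_of% h₁, hb', Category.assoc]
  · rw [toEnv_envMap_assoc, reassoc_of% h₂, hc', Category.assoc]
  · rw [reassoc_of% hb, hd, toEnv_envMap_assoc, Category.assoc]
  · rw [reassoc_of% hc, hg, Category.assoc]

variable [TriangulatedStructure (E.Stable M.F)] (D : E.Connecting M.F)

/-- The connecting morphism of the chosen conflation with injective middle term. -/
def κ (X : M.F.FullSubcategory) :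
    (E.toStable M.F).obj (s.obj X) ⟶ ((E.toStable M.F).obj X)⟦(1 : ℤ)⟧ :=
  D.δ (X₂ := ⟨s.I X, F_of_injectives (s.injective X)⟩) (s.conf X)

lemma κ_naturality {X Y : M.F.FullSubcategory} {f : X.obj ⟶ Y.obj}
    {g : (s.obj X).obj ⟶ (s.obj Y).obj} (hg : s.Ind f g) :
    E.st g ≫ κ s D Y = κ s D X ≫ (E.st f)⟦(1 : ℤ)⟧' := by
  obtain ⟨b, hb, hg⟩ := hg
  exact D.naturality (X₂ := ⟨s.I X, F_of_injectives (s.injective X)⟩)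
    (Y₂ := ⟨s.I Y, F_of_injectives (s.injective Y)⟩) (s.conf X) (s.conf Y) f b g hb hg

/-- The connecting morphism of a conflation of the ambient category. -/
def δEnv (h : E.Conf i p) :
    (E.toStable M.F).obj (M.env X₃) ⟶ ((E.toStable M.F).obj (M.env X₁))⟦(1 : ℤ)⟧ :=
  E.st (exists_envConn s h).choose ≫ κ s D (M.env X₁)

include hA in
lemma δEnv_naturality (h : E.Conf i p) (h' : E.Conf i' p') (τ₁ : X₁ ⟶ Y₁) (τ₂ : X₂ ⟶ Y₂)
    (τ₃ : X₃ ⟶ Y₃) (h₁ : i ≫ τ₂ = τ₁ ≫ i') (h₂ : p ≫ τ₃ = τ₂ ≫ p') :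
    E.st (M.envMap τ₃) ≫ δEnv s D h' = δEnv s D h ≫ (E.st (M.envMap τ₁))⟦(1 : ℤ)⟧' := by
  obtain ⟨g, hg⟩ := s.exists_ind (M.envMap τ₁)
  rw [δEnv, ← Category.assoc, (exists_envConn s h).choose_spec.naturality hA
    (exists_envConn s h').choose_spec h τ₁ τ₂ τ₃ h₁ h₂ hg, Category.assoc, κ_naturality s D hg,
    δEnv, Category.assoc]

end

include hA in
/-- On `F`, special preenvelopes are stable isomorphisms. -/
lemma isIso_st_toEnv (X : M.F.FullSubcategory) :
    IsIso (E.st (X := X) (Y := M.env X.obj) (M.toEnv X.obj)) := by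
  obtain ⟨r, hr, hr'⟩ := (M.isSpecialPreenvelope_toEnv X.obj).exists_retraction hA X.property
  exact (stIso (X := X) (Y := M.env X.obj) (M.toEnv X.obj) r
    (by rw [hr, sub_self]; exact Null.zero) hr').isIso_hom

variable [TriangulatedStructure (E.Stable M.F)] (D : E.Connecting M.F)

/-- The triangle of a conflation of the ambient category. -/
abbrev triEnv {X₁ X₂ X₃ : A} {i : X₁ ⟶ X₂} {p : X₂ ⟶ X₃} (h : E.Conf i p) :
    Triangle (E.Stable M.F) :=
  Triangle.mk (E.st (M.envMap i)) (E.st (M.envMap p)) (δEnv s D h)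

-- For a conflation already in F the two connecting morphisms agree: a choice of `EnvConn` is part
-- of a morphism to the chosen conflation of the preenvelope of X₁, to which naturality of D
-- applies.
include hA in
lemma nonempty_triEnvIso {X₁ X₂ X₃ : M.F.FullSubcategory} {i : X₁.obj ⟶ X₂.obj}
    {p : X₂.obj ⟶ X₃.obj} (h : E.Conf i p) :
    Nonempty (Triangle.mk (E.st i) (E.st p) (D.δ h) ≅ triEnv s D h) := by
  let e₁ := @asIso _ _ _ _ (E.st (X := X₁) (Y := M.env X₁.obj) (M.toEnv X₁.obj))
    (isIso_st_toEnv hA X₁)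
  let e₂ := @asIso _ _ _ _ (E.st (X := X₂) (Y := M.env X₂.obj) (M.toEnv X₂.obj))
    (isIso_st_toEnv hA X₂)
  let e₃ := @asIso _ _ _ _ (E.st (X := X₃) (Y := M.env X₃.obj) (M.toEnv X₃.obj))
    (isIso_st_toEnv hA X₃)
  obtain ⟨b, hb, hc⟩ := (exists_envConn (M := M) s h).choose_spec
  refine ⟨Triangle.isoMk _ _ e₁ e₂ e₃ ?_ ?_ ?_⟩
  · change E.st i ≫ E.st (X := X₂) (Y := M.env X₂.obj) _ =
      E.st (X := X₁) (Y := M.env X₁.obj) _ ≫ E.st _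
    rw [← st_comp, ← st_comp, toEnv_envMap]
  · change E.st p ≫ E.st (X := X₃) (Y := M.env X₃.obj) _ =
      E.st (X := X₂) (Y := M.env X₂.obj) _ ≫ E.st _
    rw [← st_comp, ← st_comp, toEnv_envMap]
  · change D.δ h ≫ (E.st (X := X₁) (Y := M.env X₁.obj) _)⟦(1 : ℤ)⟧' =
      E.st (X := X₃) (Y := M.env X₃.obj) _ ≫ δEnv s D h
    rw [δEnv, ← Category.assoc, ← st_comp]
    exact (D.naturality (Y₁ := M.env X₁.obj) (Y₂ := ⟨s.I _, F_of_injectives (s.injective _)⟩)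
      (Y₃ := s.obj _) h (s.conf (M.env X₁.obj)) (M.toEnv X₁.obj) b _ hb hc).symm

-- The chosen preenvelopes need not form a conflation. The horseshoe lemma gives a conflation in F
-- with a map from the given one, and the preenvelope functor inverts its three components.
include hA in
lemma triEnv_mem {X₁ X₂ X₃ : A} {i : X₁ ⟶ X₂} {p : X₂ ⟶ X₃} (h : E.Conf i p) :
    triEnv s D h ∈ distTriang (E.Stable M.F) := by
  obtain ⟨Y₁, Y₂, Y₃, i', p', a, b, c, h', h₁, h₂, ha, hb, hc⟩ := M.horseshoe hA h
  have ha' : IsIso (E.st (M.envMap a)) := isIso_envFunctor_map_of_inflation hA ha.2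
  have hb' : IsIso (E.st (M.envMap b)) := isIso_envFunctor_map_of_inflation hA hb.2
  have hc' : IsIso (E.st (M.envMap c)) := isIso_envFunctor_map_of_inflation hA hc.2
  let ea := @asIso _ _ _ _ (E.st (M.envMap a)) ha'
  let eb := @asIso _ _ _ _ (E.st (M.envMap b)) hb'
  let ec := @asIso _ _ _ _ (E.st (M.envMap c)) hc'
  obtain ⟨e⟩ := nonempty_triEnvIso s hA D (X₁ := ⟨Y₁, ha.1⟩) (X₂ := ⟨Y₂, hb.1⟩)
    (X₃ := ⟨Y₃, hc.1⟩) h'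
  have key := isomorphic_distinguished _
    (D.mem_distTriang (X₁ := ⟨Y₁, ha.1⟩) (X₂ := ⟨Y₂, hb.1⟩) (X₃ := ⟨Y₃, hc.1⟩) h') _ e.symm
  refine isomorphic_distinguished _ key _ (Triangle.isoMk _ _ ea eb ec ?_ ?_ ?_)
  · change (M.envFunctor hA).map i ≫ (M.envFunctor hA).map b =
      (M.envFunctor hA).map a ≫ (M.envFunctor hA).map i'
    rw [← Functor.map_comp, ← Functor.map_comp, h₁]
  · change (M.envFunctor hA).map p ≫ (M.envFunctor hA).map c =
      (M.envFunctor hA).map b ≫ (M.envFunctor hA).map p'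
    rw [← Functor.map_comp, ← Functor.map_comp, h₂]
  · exact (δEnv_naturality s hA D h h' a b c h₁.symm h₂.symm).symm

include s D in
/-- The triangulated structure of the stable category is determined by the conflations of the
ambient category. -/
theorem isTriangulatedAlong_envFunctor (hadd : (E.toStable M.F).Additive) :
    IsTriangulatedAlong E.conflation (M.envFunctor hA) := by
  refine ⟨⟨fun {X Y f g} => ?_⟩, fun S hS => δEnv s D ⟨S.zero, hS⟩, fun S S' hS hS' φ =>
    δEnv_naturality s hA D ⟨S.zero, hS⟩ ⟨S'.zero, hS'⟩ φ.τ₁ φ.τ₂ φ.τ₃ φ.comm₁₂.symm φ.comm₂₃.symm,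
    fun t => ⟨fun ht => ?_, ?_⟩⟩
  · refine Eq.trans ?_ (hadd.map_add (f := ObjectProperty.homMk (M.envMap f))
      (g := ObjectProperty.homMk (M.envMap g)))
    refine envFunctor_map_eq hA (g := M.envMap f + M.envMap g) ?_
    rw [Preadditive.comp_add, toEnv_envMap, toEnv_envMap, Preadditive.add_comp, sub_self]
    exact Null.zero
  · obtain ⟨X₁, X₂, X₃, i, p, h, ⟨e⟩⟩ := (D.dist_iff t).1 ht
    obtain ⟨e'⟩ := nonempty_triEnvIso s hA D h
    exact ⟨ShortComplex.mk i p h.w, h.2, ⟨e ≪≫ e'⟩⟩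
  · rintro ⟨S, hS, ⟨e⟩⟩
    exact isomorphic_distinguished _ (triEnv_mem s hA D ⟨S.zero, hS⟩) _ e

end InjectiveCotorsionPair

end ExactStructure

end

/-! ### Transport of triangles to the localization -/

noncomputable section

open Pretriangulated

section

variable {T T' : Type*} [Category* T] [Category* T'] [TriangulatedStructure T']
  [TriangulatedStructure T]

/-- If an exact functor has an exact section, every distinguished triangle lifts along it. -/
lemma exists_distTriang_lift (Q : T ⥤ T') [Q.CommShift ℤ] [Q.IsTriangulated] {R : T' ⥤ T}
    (hR : IsExactFunctor R) (θ : R ⋙ Q ≅ 𝟭 T') (t : Triangle T') (ht : t ∈ distTriang T') :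
    ∃ t' ∈ distTriang T, Nonempty (t ≅ Q.mapTriangle.obj t') := by
  obtain ⟨_, _⟩ := hR
  have h := R.map_distinguished t ht
  -- The lift is the image of t under the section R. It suffices to compare the first two terms.
  refine ⟨_, h, ⟨(isoTriangleOfIso₁₂ _ _ (Q.map_distinguished _ h) ht (θ.app t.obj₁)
    (θ.app t.obj₂) ?_).symm⟩⟩
  exact θ.hom.naturality t.mor₁

/-- A triangulated structure determined by short exact sequences is transported along an exact
functor with an exact section. -/
theorem IsTriangulatedAlong.comp {B : Type*} [Category* B] [Preadditive B]
    {conf : ShortComplex B → Prop} {G : B ⥤ T} (hG : IsTriangulatedAlong conf G) {Q : T ⥤ T'}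
    (hQ : IsExactFunctor Q) {R : T' ⥤ T} (hR : IsExactFunctor R) (θ : R ⋙ Q ≅ 𝟭 T')
    {K : B ⥤ T'} (α : K ≅ G ⋙ Q) : IsTriangulatedAlong conf K := by
  obtain ⟨_, _⟩ := hQ
  obtain ⟨hadd, δ, hδ, hd⟩ := hG
  let d (S : ShortComplex B) (hS : conf S) : Q.obj (G.obj S.X₃) ⟶ (Q.obj (G.obj S.X₁))⟦(1 : ℤ)⟧ :=
    Q.map (δ S hS) ≫ (Q.commShiftIso (1 : ℤ)).hom.app (G.obj S.X₁)
  let δ' (S : ShortComplex B) (hS : conf S) : K.obj S.X₃ ⟶ (K.obj S.X₁)⟦(1 : ℤ)⟧ :=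
    α.hom.app S.X₃ ≫ d S hS ≫ (α.inv.app S.X₁)⟦(1 : ℤ)⟧'
  have hiso (S : ShortComplex B) (hS : conf S) :
      Nonempty (Triangle.mk (K.map S.f) (K.map S.g) (δ' S hS) ≅
        Q.mapTriangle.obj (Triangle.mk (G.map S.f) (G.map S.g) (δ S hS))) := by
    refine ⟨Triangle.isoMk _ _ (α.app _) (α.app _) (α.app _) (α.hom.naturality _)
      (α.hom.naturality _) ?_⟩
    change (α.hom.app S.X₃ ≫ d S hS ≫ (α.inv.app S.X₁)⟦(1 : ℤ)⟧') ≫ (α.hom.app S.X₁)⟦(1 : ℤ)⟧' =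
      α.hom.app S.X₃ ≫ d S hS
    rw [Category.assoc, Category.assoc, ← Functor.map_comp, Iso.inv_hom_id_app]
    exact congrArg _ ((congrArg _ (CategoryTheory.Functor.map_id _ _)).trans (Category.comp_id _))
  refine ⟨Functor.additive_of_iso α.symm, δ', fun S S' hS hS' φ => ?_, fun t => ⟨fun ht => ?_, ?_⟩⟩
  · have h₁ : Q.map (G.map φ.τ₃) ≫ d S' hS' = d S hS ≫ (Q.map (G.map φ.τ₁))⟦(1 : ℤ)⟧' := by
      change Q.map (G.map φ.τ₃) ≫ Q.map (δ S' hS') ≫ _ = (Q.map (δ S hS) ≫ _) ≫ _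
      rw [← Functor.map_comp_assoc, hδ S S' hS hS' φ, Functor.map_comp, Category.assoc,
        Category.assoc, Q.commShiftIso_hom_naturality]
    have h₂ := α.hom.naturality φ.τ₃
    have h₃ := α.inv.naturality φ.τ₁
    change K.map φ.τ₃ ≫ α.hom.app S'.X₃ = α.hom.app S.X₃ ≫ Q.map (G.map φ.τ₃) at h₂
    change Q.map (G.map φ.τ₁) ≫ α.inv.app S'.X₁ = α.inv.app S.X₁ ≫ K.map φ.τ₁ at h₃
    change K.map φ.τ₃ ≫ α.hom.app S'.X₃ ≫ d S' hS' ≫ _ = (α.hom.app S.X₃ ≫ d S hS ≫ _) ≫ _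
    rw [reassoc_of% h₂, reassoc_of% h₁, ← Functor.map_comp, h₃, Functor.map_comp]
    simp only [Category.assoc]
  · obtain ⟨t', ht', ⟨e⟩⟩ := exists_distTriang_lift Q hR θ t ht
    obtain ⟨S, hS, ⟨e'⟩⟩ := (hd t').1 ht'
    exact ⟨S, hS, ⟨e ≪≫ Q.mapTriangle.mapIso e' ≪≫ (hiso S hS).some.symm⟩⟩
  · rintro ⟨S, hS, ⟨e⟩⟩
    exact isomorphic_distinguished _ (Q.map_distinguished _ ((hd _).2 ⟨S, hS, ⟨Iso.refl _⟩⟩)) _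
      (e ≪≫ (hiso S hS).some)

end

namespace ExactStructure.InjectiveCotorsionPair

variable {A : Type u} [Category.{v} A] [Preadditive A] [HasZeroObject A] [HasBinaryBiproducts A]
  {E : ExactStructure A} {M₁ M₂ M₃ : E.InjectiveCotorsionPair} (hA : WeaklyIdempotentComplete A)
  (h₃₁ : M₃.F ≤ M₁.F)

-- M₁-preenvelopes have cokernel in W₁ ⊆ W₃, so they are inverted in A/W₃. This lets the triangles
-- of A/W₃ be read off from those of F₁/∼.
include h₃₁ in
lemma nonempty_γ_iso : Nonempty (M₃.γ ≅ M₁.envFunctor hA ⋙ M₃.quotientFunctor M₁.F) := by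
  let e (X : A) : M₃.γ.obj X ≅ M₃.γ.obj (M₁.env X).obj :=
    @asIso _ _ _ _ (M₃.γ.map (M₁.toEnv X)) (isIso_γ_map_toEnv h₃₁ X)
  refine ⟨NatIso.ofComponents e (fun {X Y} f => ?_)⟩
  change M₃.γ.map f ≫ M₃.γ.map (M₁.toEnv Y) = M₃.γ.map (M₁.toEnv X) ≫ M₃.γ.map (M₁.envMap f)
  rw [← Functor.map_comp, ← Functor.map_comp, toEnv_envMap]

end ExactStructure.InjectiveCotorsionPair

end

/-! ### Assembly of the recollement -/

noncomputable section

open Pretriangulated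

namespace CategoryTheory.Functor

variable {C D : Type*} [Category* C] [Category* D]

lemma essSurj_of_section {K : D ⥤ C} [K.Full] [K.Faithful] {s : C ⥤ D} (e : s ⋙ K ≅ 𝟭 C) :
    s.EssSurj :=
  have := isEquivalence_of_section e
  Functor.essSurj_of_iso (sectionIsoInv e).symm

end CategoryTheory.Functor

namespace ExactStructure

variable {A : Type u} [Category.{v} A] [Preadditive A] [HasZeroObject A] [HasBinaryBiproducts A]
  {E : ExactStructure A}

lemma essImage_stableInclusion_iff {P P' : ObjectProperty A} (h : P' ≤ P)
    (hP' : ∀ {X Y : E.Stable P}, (X ≅ Y) → P' Y.as.obj → P' X.as.obj) (X : E.Stable P) :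
    (E.stableInclusion h).essImage X ↔ P' X.as.obj :=
  ⟨fun ⟨Z, ⟨e⟩⟩ => hP' e.symm Z.as.property, fun hX => ⟨⟨⟨X.as.obj, hX⟩⟩, ⟨Iso.refl _⟩⟩⟩

namespace InjectiveCotorsionPair

section

variable {M : E.InjectiveCotorsionPair} (hA : WeaklyIdempotentComplete A)

lemma W_of_stable_iso {P : ObjectProperty A} {X Y : E.Stable P} (e : X ≅ Y)
    (hY : M.W Y.as.obj) : M.W X.as.obj := by
  obtain ⟨X⟩ := X
  obtain ⟨Y⟩ := Y
  obtain ⟨f, hf⟩ := exists_st (X := X) (Y := Y) e.hom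
  obtain ⟨g, hg⟩ := exists_st (X := Y) (Y := X) e.inv
  have : E.st (X := X) (Y := X) (𝟙 X.obj) = E.st (f ≫ g) := by
    rw [st_id, st_comp, hf, hg]
    exact e.hom_inv_id.symm
  exact W_of_null (st_eq_iff.1 this) hY

-- If γ X = 0 then the preenvelope of X is a null map, hence so is the identity of its target. The
-- target is then in W, and therefore X is.
include hA in
lemma isZero_γ_obj_iff [Preadditive M.Ho] [M.γ.Additive] (X : A) :
    IsZero (M.γ.obj X) ↔ M.W X := by
  obtain ⟨C, q, hc, hC⟩ := monoWithCokernel_iff.1 (M.isSpecialPreenvelope_toEnv X).2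
  constructor
  · intro hX
    -- The composite through 0 is written out so that the target is seen to be a retract of 0 up to
    -- null maps.
    have h₁ : E.Null (M.toEnv X ≫ (𝟙 (M.env X).obj - (0 : _ ⟶ (0 : A)) ≫ 0)) := by
      rw [comp_zero, sub_zero, Category.comp_id, ← sub_zero (M.toEnv X)]
      exact null_of_γ_map_eq hA (M.env X).property (hX.eq_of_src _ _)
    exact W_left hc (W_of_null ((M.isSpecialPreenvelope_toEnv X).null hA (M.env X).property h₁)
      (W_of_injectives injectives_zero)) hC
  · intro hX
    refine IsZero.of_iso ?_ (asIso (M.γ.map (M.toEnv X)))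
    rw [IsZero.iff_id_eq_zero, ← M.γ.map_id, ← M.γ.map_zero]
    refine γ_map_eq_of_null ?_
    rw [sub_zero]
    exact Null.of_injective_left (injectives_of (W_middle hc hX hC) (M.env X).property) _

end

section

variable {M₁ M₂ M₃ : E.InjectiveCotorsionPair} (hA : WeaklyIdempotentComplete A)
  (hE : E.EnoughInjectives) (h₂₁ : M₂.F ≤ M₁.F) (h₃₁ : M₃.F ≤ M₁.F) (h : M₃.W ⊓ M₁.F = M₂.F)

include hA in
lemma essImage_section_iff {ρ : M₃.Ho ⥤ E.Stable M₃.F}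
    (θ : ρ ⋙ E.stableInclusion h₃₁ ⋙ M₃.quotientFunctor M₁.F ≅ 𝟭 M₃.Ho) (X : E.Stable M₁.F) :
    (ρ ⋙ E.stableInclusion h₃₁).essImage X ↔ M₃.F X.as.obj := by
  have := full_inclusion_quotientFunctor (M₁ := M₁) hA h₃₁
  have := faithful_inclusion_quotientFunctor (M₁ := M₁) hA h₃₁
  have := Functor.essSurj_of_section θ
  rw [Functor.essImage_comp_of_essSurj, essImage_stableInclusion_iff h₃₁ (F_of_stable_iso hA)]

include hA h₃₁ h in
lemma essImage_section_iff_W {l : M₃.Ho ⥤ E.Stable (M₂.W ⊓ M₁.F)}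
    (θ : l ⋙ E.stableInclusion inf_le_right ⋙ M₃.quotientFunctor M₁.F ≅ 𝟭 M₃.Ho)
    (X : E.Stable M₁.F) :
    (l ⋙ E.stableInclusion inf_le_right).essImage X ↔ M₂.W X.as.obj := by
  have := full_inclusion_quotientFunctor_of_W hA h₃₁ h
  have := faithful_inclusion_quotientFunctor_of_W hA h₃₁ h
  have := Functor.essSurj_of_section θ
  rw [Functor.essImage_comp_of_essSurj, essImage_stableInclusion_iff inf_le_right
    (fun {X Y} e hY => ⟨W_of_stable_iso e hY.1, X.as.property⟩)]
  exact ⟨fun hX => hX.1, fun hX => ⟨hX, X.as.property⟩⟩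

-- The counit is the isomorphism θ; its universality is the bijectivity of Q on maps into F₃.
include hA in
lemma nonempty_quotientFunctor_adjunction {ρ : M₃.Ho ⥤ E.Stable M₃.F}
    (θ : ρ ⋙ E.stableInclusion h₃₁ ⋙ M₃.quotientFunctor M₁.F ≅ 𝟭 M₃.Ho) :
    Nonempty (M₃.quotientFunctor M₁.F ⊣ ρ ⋙ E.stableInclusion h₃₁) := by
  refine ⟨Adjunction.ofCouniversalCounit (G := ρ ⋙ E.stableInclusion h₃₁) θ.hom fun X Y => ?_⟩
  have h₁ := quotientFunctor_bijective (M := M₃) hA X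
    (Y := (ρ ⋙ E.stableInclusion h₃₁).obj Y) (ρ.obj Y).as.property
  exact ((θ.app Y).homToEquiv (Z := (M₃.quotientFunctor M₁.F).obj X)).bijective.comp h₁

-- Dually, the unit is the inverse of θ, and Q is bijective on maps out of W₂.
include hA h₃₁ h in
lemma nonempty_adjunction_quotientFunctor {l : M₃.Ho ⥤ E.Stable (M₂.W ⊓ M₁.F)}
    (θ : l ⋙ E.stableInclusion inf_le_right ⋙ M₃.quotientFunctor M₁.F ≅ 𝟭 M₃.Ho) :
    Nonempty (l ⋙ E.stableInclusion inf_le_right ⊣ M₃.quotientFunctor M₁.F) := by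
  refine ⟨Adjunction.ofUniversalUnit (F := l ⋙ E.stableInclusion inf_le_right) θ.inv
    fun X Y => ?_⟩
  have h₁ := quotientFunctor_bijective_of_W hA h₃₁ h
    (X := (l ⋙ E.stableInclusion inf_le_right).obj X) (Y := Y) (l.obj X).as.property.1
  exact ((θ.app X).homFromEquiv (Z := (M₃.quotientFunctor M₁.F).obj Y)).bijective.comp h₁

include hA h in
/-- The equivalence between the images of the two adjoints of the quotient functor. -/
theorem exists_equivalence_section {ρ : M₃.Ho ⥤ E.Stable M₃.F}
    (θ : ρ ⋙ E.stableInclusion h₃₁ ⋙ M₃.quotientFunctor M₁.F ≅ 𝟭 M₃.Ho)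
    {l : M₃.Ho ⥤ E.Stable (M₂.W ⊓ M₁.F)}
    (θ' : l ⋙ E.stableInclusion inf_le_right ⋙ M₃.quotientFunctor M₁.F ≅ 𝟭 M₃.Ho) :
    ∃ e : E.Stable M₃.F ≌ E.Stable (M₂.W ⊓ M₁.F),
      Nonempty (e.functor ⋙ E.stableInclusion inf_le_right ≅
        E.stableInclusion h₃₁ ⋙ M₃.quotientFunctor M₁.F ⋙ l ⋙ E.stableInclusion inf_le_right) ∧
      Nonempty (e.inverse ⋙ E.stableInclusion h₃₁ ≅
        E.stableInclusion inf_le_right ⋙ M₃.quotientFunctor M₁.F ⋙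
          ρ ⋙ E.stableInclusion h₃₁) := by
  have := full_inclusion_quotientFunctor (M₁ := M₁) hA h₃₁
  have := faithful_inclusion_quotientFunctor (M₁ := M₁) hA h₃₁
  have := full_inclusion_quotientFunctor_of_W hA h₃₁ h
  have := faithful_inclusion_quotientFunctor_of_W hA h₃₁ h
  have := Functor.isEquivalence_of_section θ
  have := Functor.isEquivalence_of_section θ'
  -- F₃/∼ and (W₂ ∩ F₁)/∼ are both equivalent to A/W₃ through Q, with inverses ρ and l.
  let K := E.stableInclusion h₃₁ ⋙ M₃.quotientFunctor M₁.F
  let K' := E.stableInclusion (inf_le_right : M₂.W ⊓ M₁.F ≤ M₁.F) ⋙ M₃.quotientFunctor M₁.F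
  exact ⟨K.asEquivalence.trans K'.asEquivalence.symm,
    ⟨Functor.isoWhiskerLeft K (Functor.isoWhiskerRight (Functor.sectionIsoInv θ').symm
      (E.stableInclusion inf_le_right))⟩,
    ⟨Functor.isoWhiskerLeft K' (Functor.isoWhiskerRight (Functor.sectionIsoInv θ).symm
      (E.stableInclusion h₃₁))⟩⟩

include hA hE h in
/-- The recollement of stable categories. -/
theorem exists_isRecollement {e c : E.Stable M₁.F ⥤ E.Stable M₂.F}
    (adj : e ⊣ E.stableInclusion h₂₁) (adj' : E.stableInclusion h₂₁ ⊣ c)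
    {ρ : M₃.Ho ⥤ E.Stable M₃.F}
    (θ : ρ ⋙ E.stableInclusion h₃₁ ⋙ M₃.quotientFunctor M₁.F ≅ 𝟭 M₃.Ho)
    {l : M₃.Ho ⥤ E.Stable (M₂.W ⊓ M₁.F)}
    (θ' : l ⋙ E.stableInclusion inf_le_right ⋙ M₃.quotientFunctor M₁.F ≅ 𝟭 M₃.Ho) :
    ∃ (_ : TriangulatedStructure (E.Stable M₂.F)) (_ : TriangulatedStructure (E.Stable M₁.F))
        (_ : TriangulatedStructure M₃.Ho),
      IsTriangulatedAlong (E.conflationIn M₂.F) (E.toStable M₂.F) ∧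
      IsTriangulatedAlong (E.conflationIn M₁.F) (E.toStable M₁.F) ∧
      IsTriangulatedAlong E.conflation M₃.γ ∧
      IsRecollement (E.stableInclusion h₂₁) e c (M₃.quotientFunctor M₁.F)
        (l ⋙ E.stableInclusion inf_le_right) (ρ ⋙ E.stableInclusion h₃₁) := by
  obtain ⟨_, hT⟩ := exists_isTriangulatedAlong_toStable M₁ hA hE
  obtain ⟨D⟩ := nonempty_connecting hT
  obtain ⟨s⟩ := nonempty_suspension M₁ hA hE
  have := full_inclusion_quotientFunctor (M₁ := M₁) hA h₃₁
  have := faithful_inclusion_quotientFunctor (M₁ := M₁) hA h₃₁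
  have := full_inclusion_quotientFunctor_of_W hA h₃₁ h
  have := faithful_inclusion_quotientFunctor_of_W hA h₃₁ h
  have := Functor.full_of_section θ
  have := Functor.faithful_of_section θ
  have := Functor.full_of_section θ'
  have := Functor.faithful_of_section θ'
  have hI := essImage_stableInclusion_iff h₂₁ (F_of_stable_iso hA)
  obtain ⟨_, _, hI₁, hI₂⟩ :=
    exists_triangulatedStructure_of_essImage D hA hE (E.stableInclusion h₂₁) h₂₁ hI
  -- The triangles of A/W₃ are defined through ρ, which embeds it in F₁/∼ with image F₃/∼.
  obtain ⟨_, _, hρ₁, hρ₂⟩ := exists_triangulatedStructure_of_essImage D hA hE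
    (ρ ⋙ E.stableInclusion h₃₁) h₃₁ (essImage_section_iff hA h₃₁ θ)
  have hI₃ : IsExactFunctor (E.stableInclusion h₂₁) := ⟨inferInstance, ⟨fun t => (hI₂ t).1⟩⟩
  have hρ₃ : IsExactFunctor (ρ ⋙ E.stableInclusion h₃₁) := ⟨inferInstance, ⟨fun t => (hρ₂ t).1⟩⟩
  obtain ⟨adjρ⟩ := nonempty_quotientFunctor_adjunction hA h₃₁ θ
  obtain ⟨adjl⟩ := nonempty_adjunction_quotientFunctor hA h₃₁ h θ'
  -- Exactness of Q comes first; with the exact section ρ it then shows that the triangles of A/W₃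
  -- are those of the conflations of A.
  have hQ := hρ₃.leftAdjoint adjρ
  have hγ : IsTriangulatedAlong E.conflation M₃.γ :=
    (isTriangulatedAlong_envFunctor s hA D hT.1).comp hQ hρ₃ θ (nonempty_γ_iso hA h₃₁).some
  have := hγ.1
  exact ⟨inferInstance, inferInstance, inferInstance,
    isTriangulatedAlong_of_inclusion hA D h₂₁ hI₂ hT.1 hI₁, hT, hγ,
    { exact_I := hI₃
      exact_Iₗ := hI₃.leftAdjoint adj
      exact_Iᵣ := hI₃.rightAdjoint adj'
      exact_Q := hQ
      exact_Qₗ := hQ.leftAdjoint adjl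
      exact_Qᵣ := hρ₃
      adj_Iₗ := ⟨adj⟩
      adj_Iᵣ := ⟨adj'⟩
      adj_Qₗ := ⟨adjl⟩
      adj_Qᵣ := ⟨adjρ⟩
      full_I := inferInstance
      faithful_I := inferInstance
      full_Qₗ := inferInstance
      faithful_Qₗ := inferInstance
      full_Qᵣ := inferInstance
      faithful_Qᵣ := inferInstance
      kernel_Q := fun X => by
        rw [hI, ← h]
        exact (isZero_γ_obj_iff hA X.as.obj).trans
          ⟨fun hX => ⟨hX, X.as.property⟩, fun hX => hX.1⟩ }⟩

end

end InjectiveCotorsionPair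

end ExactStructure

end

theorem mainTheorem1 {A : Type u} [Category.{v} A] [Preadditive A] [HasZeroObject A]
    [HasBinaryBiproducts A] (E : ExactStructure A) (hA : WeaklyIdempotentComplete A)
    (hE : E.EnoughInjectives) (M₁ M₂ M₃ : E.InjectiveCotorsionPair)
    (h₂₁ : M₂.F ≤ M₁.F) (h₃₁ : M₃.F ≤ M₁.F) :
    (M₃.W ⊓ M₁.F = M₂.F ↔ M₂.W ⊓ M₃.W = M₁.W ∧ M₂.F ≤ M₃.W) ∧
    (M₃.W ⊓ M₁.F = M₂.F →
      -- the right localizations are Hovey triples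
      E.IsHoveyTriple (M₁.rightLocalization M₂) ∧ E.IsHoveyTriple (M₁.rightLocalization M₃) ∧
      -- the Quillen equivalences, given by the identity functor of `A`
      (E.model (M₁.rightLocalization M₂)).IsQuillenEquivalence (E.model M₃.triple)
        (Adjunction.id (C := A)) ∧
      (E.model (M₁.rightLocalization M₃)).IsQuillenEquivalence (E.model M₂.triple)
        (Adjunction.id (C := A)) ∧
      -- the recollement
      ∃ (e₂ c₃ : E.Stable M₁.F ⥤ E.Stable M₂.F) (l ρ : M₃.Ho ⥤ E.Stable M₁.F),
        M₂.IsPreenvelopeFunctor h₂₁ e₂ ∧ M₃.IsPrecoverFunctor h₂₁ c₃ ∧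
        M₃.IsPrecoverPreenvelopeSection M₁.F M₂ M₁ l ∧ M₃.IsPreenvelopeSection M₁.F M₃ ρ ∧
        (∃ (_ : TriangulatedStructure (E.Stable M₂.F)) (_ : TriangulatedStructure (E.Stable M₁.F))
            (_ : TriangulatedStructure M₃.Ho),
          IsTriangulatedAlong (E.conflationIn M₂.F) (E.toStable M₂.F) ∧
          IsTriangulatedAlong (E.conflationIn M₁.F) (E.toStable M₁.F) ∧
          IsTriangulatedAlong E.conflation M₃.γ ∧
          IsRecollement (E.stableInclusion h₂₁) e₂ c₃ (M₃.quotientFunctor M₁.F) l ρ) ∧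
        -- the essential images of the two adjoints of the quotient functor
        (∀ X : E.Stable M₁.F, l.essImage X ↔ M₂.W X.as.obj) ∧
        (∀ X : E.Stable M₁.F, ρ.essImage X ↔ M₃.F X.as.obj) ∧
        -- the equivalence between these essential images
        ∃ e : E.Stable M₃.F ≌ E.Stable (M₂.W ⊓ M₁.F),
          Nonempty (e.functor ⋙ E.stableInclusion inf_le_right ≅
            E.stableInclusion h₃₁ ⋙ M₃.quotientFunctor M₁.F ⋙ l) ∧
          Nonempty (e.inverse ⋙ E.stableInclusion h₃₁ ≅
            E.stableInclusion inf_le_right ⋙ M₃.quotientFunctor M₁.F ⋙ ρ)) := by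
  refine ⟨ExactStructure.InjectiveCotorsionPair.W_inf_F_eq_iff h₂₁ h₃₁, fun h => ?_⟩
  obtain ⟨e, he, ⟨adj⟩⟩ := M₂.exists_isPreenvelopeFunctor hA h₂₁
  -- An M₃-precover of an object of F₁ is in W₃, and in F₁ as an extension by an object of F₃, so it
  -- lies in F₂.
  obtain ⟨c, hc, ⟨adj'⟩⟩ := M₃.exists_isPrecoverFunctor hA h₂₁
    (ExactStructure.InjectiveCotorsionPair.F_le_W h) (fun X hX => by
      rw [← h]
      exact ⟨(M₃.isSpecialPrecover_fromCov X).1,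
        (M₃.isSpecialPrecover_fromCov X).F_of hA h₃₁ hX⟩)
  obtain ⟨ρ, hρ, ⟨θ⟩⟩ := ExactStructure.InjectiveCotorsionPair.exists_isPreenvelopeSection (M₁ := M₁) hA h₃₁
  obtain ⟨l, hl, ⟨θ'⟩⟩ :=
    ExactStructure.InjectiveCotorsionPair.exists_isPrecoverPreenvelopeSection hA h₃₁ h h₂₁ hE
  exact ⟨ExactStructure.InjectiveCotorsionPair.isHoveyTriple_rightLocalization hA h₂₁,
    ExactStructure.InjectiveCotorsionPair.isHoveyTriple_rightLocalization hA h₃₁,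
    ExactStructure.InjectiveCotorsionPair.isQuillenEquivalence_right hA hE h₂₁ h₃₁ h,
    ExactStructure.InjectiveCotorsionPair.isQuillenEquivalence_left hA hE h₂₁ h₃₁ h,
    e, c, l ⋙ E.stableInclusion inf_le_right, ρ ⋙ E.stableInclusion h₃₁, he, hc, hl, hρ,
    ExactStructure.InjectiveCotorsionPair.exists_isRecollement hA hE h₂₁ h₃₁ h adj adj' θ θ',
    ExactStructure.InjectiveCotorsionPair.essImage_section_iff_W hA h₃₁ h θ',
    ExactStructure.InjectiveCotorsionPair.essImage_section_iff hA h₃₁ θ,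
    ExactStructure.InjectiveCotorsionPair.exists_equivalence_section hA h₃₁ h θ θ'⟩
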